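/- **Setting.** Let $d\ge 2$ and $T>0$. Let $A_1(0),\dots,A_d(0)$ be real $3\times3$ matrices with $A_d(0)$ invertible, and for $\alpha=(\tau,\eta,\xi)\in\mathbb R\times\mathbb R^{d-1}\times\mathbb R$ put $L(0,\alpha)=\tau I+\sum_{i=1}^{d-1}\eta_iA_i(0)+\xi A_d(0)$. For $\zeta\in\{\varphi,\psi\}$ let $\zeta=(\tau_\zeta,\eta_\zeta)\in\mathbb R\times\mathbb R^{d-1}$ be a boundary frequency for which there are three distinct real numbers $\xi_1(\zeta),\xi_2(\zeta),\xi_3(\zeta)$ such that $\det L(0,\zeta_j)=0$, where $\zeta_j:=(\zeta,\xi_j(\zeta))$. Assume the small divisors condition: there are $C>0$ and $m_0>0$ such that $|\det L(0,\lambda_1\zeta_1+\lambda_3\zeta_3)|\ge C|(\lambda_1,\lambda_3)|^{-m_0}$ for $\zeta=\varphi,\psi$ and all $\lambda_1,\lambda_3\in\mathbb Z\setminus\{0\}$. Put $$\delta_\zeta^1=\frac{\xi_1(\zeta)-\xi_2(\zeta)}{\xi_3(\zeta)-\xi_1(\zeta)},\qquad \delta_\zeta^3=\frac{\xi_3(\zeta)-\xi_2(\zeta)}{\xi_3(\zeta)-\xi_1(\zeta)}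 .$$ Let $\mathbf v_\zeta\in\mathbb R^{d-1}$, $D_\zeta\in\mathbb C$ and $\mathbf w_\zeta,K_\zeta\in\mathbb R$ be arbitrary. **Spaces.** Let $\mathbb T=\mathbb R/2\pi\mathbb Z$. For $u(y,\Theta)=\sum_{\lambda\in\mathbb Z}u_\lambda(y)e^{i\lambda\Theta}$ in $L^2(\mathbb R^{d-1}\times\mathbb T;\mathbb C)$ let $\widehat u_\lambda$ be the Fourier transform of $u_\lambda$, $\widehat u_\lambda(\xi)=\int u_\lambda(y)e^{-i\xi\cdot y}\,dy$. With $\langle x\rangle=(1+|x|^2)^{1/2}$ and an integer $d^*$ fixed below, $Y_s$ ($0<s\le1$) is the space of those $u$ with $$\|u\|_{Y_s}^2=\int_{\mathbb R^{d-1}}\sum_{\lambda\in\mathbb Z}e^{2s|(\lambda,\xi)|}\langle(\lambda,\xi)\rangle^{2d^*}|\widehat u_\lambda(\xi)|^2\,d\xi<\infty ,$$ and $\mathbf Y_s^2$ is the space of pairs of sequences $\mathbf a=(a_\varphi^n,a_\psi^n)_{n\ge1}$ in $Y_s$ with $$\|\mathbf a\|_{\mathbf Y_s^2}^2=\sum_{\zeta=\varphi,\psi}\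 \sum_{n\ge1}e^{2sn}\langle n\rangle^{2d^*}\|a_\zeta^n\|_{Y_s}^2<\infty .$$ **System.** The unknown $\mathbf a=(a_\varphi^n,a_\psi^n)_{n\ge1}$ satisfies $\mathbf a(0)=0$ and, for $\zeta=\varphi,\psi$ and $n\ge1$, $$\partial_ta_\zeta^n=\mathbf v_\zeta\cdot\nabla_ya_\zeta^n-D_\zeta\,\partial_\Theta(a_\zeta^1a_\zeta^n)-\mathbf w_\zeta\,\mathbb F_\zeta^{\rm per}[\partial_\Theta a_\zeta^1,\partial_\Theta a_\zeta^n]+H_\zeta^n+K_\zeta\sum_{k=1}^{n-1}\partial_\Theta(a_\varphi^ka_\psi^{n-k}),\tag{3.13}$$ where $$\mathbb F_\zeta^{\rm per}[u,v]=\sum_{\lambda\in\mathbb Z\setminus\{0\}}\ \sum_{\substack{\lambda_1+\lambda_3=\lambda\\ \lambda_1\lambda_3\ne0}}\frac{i\,u_{\lambda_1}v_{\lambda_3}}{\lambda_1\delta_\zeta^1+\lambda_3\delta_\zeta^3}\,e^{i\lambda\Theta}.$$ **Proposition 3.9.** (i) There is $\widetilde m_0\ge0$ such that, for some $C>0$,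 all $\lambda_1,\lambda_3\in\mathbb Z\setminus\{0\}$ and $\zeta=\varphi,\psi$, $$\lambda_1\delta^1_\zeta+\lambda_3\delta^3_\zeta\neq0\quad\text{and}\quad |\lambda_1\delta^1_\zeta+\lambda_3\delta^3_\zeta|^{-1}\le C\min(|\lambda_1|^{\widetilde m_0},|\lambda_3|^{\widetilde m_0}).\tag{3.10}$$ (ii) Let $\widetilde m_0\ge0$ be any number with this property and $d^*$ any integer with $d^*>\widetilde m_0+2+(d+1)/2$. For every $M_0>0$ there exists $\delta\in(0,T)$ such that for all $\mathbf H=(H_\varphi^n,H_\psi^n)_{n\ge1}$ in $\mathcal C([-T,T],\mathbf Y_1^2)$ satisfying $$\sup_{|t|<T}\|\mathbf H(t)\|_{\mathbf Y_s^2}\le\frac{M_0}{1-s}\qquad(0<s<1),$$ system (3.13) admits a solution $\mathbf a$ which belongs to $\mathcal C^1((-\delta(1-s),\delta(1-s)),\mathbf Y_s^2)$ for every $0<s\le1$, and it is unique: for each $0<s\le1$, every solution of (3.13) in $\mathcal C^1((-\delta(1-s),\delta(1-s)),\mathbf Y_s^2)$ coincides with $\mathbf a$ on $(-\delta(1-s),\delta(1-s))$.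 -/

import Mathlib

open MeasureTheory Filter Topology FourierTransform
open scoped ENNReal

noncomputable section

namespace BoundaryModel

instance fact_two_pi_pos : Fact (0 < 2 * Real.pi) := ⟨Real.two_pi_pos⟩

/-- The tangential space `ℝ^{d-1}` (variables `y`, dual variables `ξ` or `η`). -/
abbrev Tan (d : ℕ) := EuclideanSpace ℝ (Fin (d - 1))

/-- The torus `𝕋 = ℝ / 2πℤ`, with variable `Θ`. -/
abbrev Torus := AddCircle (2 * Real.pi)

/-- The measure on `ℝ^{d-1} × 𝕋`: Lebesgue measure times normalized Haar measure. -/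
abbrev domMeasure (d : ℕ) : Measure (Tan d × Torus) :=
  (volume : Measure (Tan d)).prod AddCircle.haarAddCircle

/-- The space `L²(ℝ^{d-1} × 𝕋)` of complex valued functions. -/
abbrev L2 (d : ℕ) := Lp ℂ 2 (domMeasure d)

/-! ### Fourier series in `Θ`, Fourier transform in `y` -/

/-- The Fourier coefficient `u_l(y) = (1/2π) ∫ u(y,Θ) e^{-ilΘ} dΘ`. -/
def modeFun {d : ℕ} (u : L2 d) (l : ℤ) (y : Tan d) : ℂ :=
  fourierCoeff (fun θ : Torus => u (y, θ)) l

theorem memLp_modeFun {d : ℕ} (u : L2 d) (l : ℤ) :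
    MemLp (modeFun u l) 2 (volume : Measure (Tan d)) := by
  have hu : MemLp (u : Tan d × Torus → ℂ) 2 (domMeasure d) := Lp.memLp u
  have hsq : Integrable (fun z => ‖u z‖ ^ 2) (domMeasure d) :=
    (memLp_two_iff_integrable_sq_norm hu.1).1 hu
  have hmeas : AEStronglyMeasurable (modeFun u l) (volume : Measure (Tan d)) := by
    have h1 : AEStronglyMeasurable
        (fun z : Tan d × Torus => fourier (-l) z.2 • u z) (domMeasure d) :=
      AEStronglyMeasurable.smul
        ((fourier (-l)).continuous.comp continuous_snd).aestronglyMeasurable hu.1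
    exact h1.integral_prod_right'
  refine (memLp_two_iff_integrable_sq_norm hmeas).2 ?_
  refine hsq.integral_prod_left.mono' (hmeas.norm.pow 2) ?_
  filter_upwards [hsq.prod_right_ae, hu.1.prodMk_left] with y hy hym
  have hL2 : MemLp (fun θ : Torus => u (y, θ)) 2 AddCircle.haarAddCircle :=
    (memLp_two_iff_integrable_sq_norm hym).2 hy
  have hint : Integrable (fun θ : Torus => ‖u (y, θ)‖) AddCircle.haarAddCircle :=
    (hL2.integrable (by norm_num)).norm
  have h1 : ‖modeFun u l y‖ ≤ ∫ θ : Torus, ‖u (y, θ)‖ ∂AddCircle.haarAddCircle := by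
    unfold modeFun fourierCoeff
    refine (norm_integral_le_integral_norm _).trans (le_of_eq ?_)
    congr 1
    ext θ
    rw [norm_smul, fourier_apply, Circle.norm_coe, one_mul]
  have h2 : (∫ θ : Torus, ‖u (y, θ)‖ ∂AddCircle.haarAddCircle) ^ 2 ≤
      ∫ θ : Torus, ‖u (y, θ)‖ ^ 2 ∂AddCircle.haarAddCircle :=
    (convexOn_pow 2).map_integral_le (s := Set.Ici (0 : ℝ)) (continuous_pow 2).continuousOn
      isClosed_Ici (Eventually.of_forall fun θ => norm_nonneg _) hint hy
  rw [Real.norm_of_nonneg (by positivity)]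
  exact (pow_le_pow_left₀ (norm_nonneg _) h1 2).trans h2

/-- The Fourier coefficient `u_l` as an element of `L²(ℝ^{d-1})`. -/
def mode {d : ℕ} (u : L2 d) (l : ℤ) : Lp ℂ 2 (volume : Measure (Tan d)) :=
  (memLp_modeFun u l).toLp (modeFun u l)

/-- `û_l(ξ)`, the `L²` Fourier transform of `u_l` in the convention
`û_l(ξ) = ∫ u_l(y) e^{-i ξ·y} dy`. (Mathlib's transform `𝓕` uses the kernel `e^{-2πi ξ·y}`,
whence the rescaling.) -/
def hat {d : ℕ} (u : L2 d) (l : ℤ) (ξ : Tan d) : ℂ :=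
  (𝓕 (mode u l) : Lp ℂ 2 (volume : Measure (Tan d))) ((2 * Real.pi)⁻¹ • ξ)

/-! ### The scale of spaces -/

/-- The Euclidean length `|(l,ξ)|`. -/
def len {d : ℕ} (l : ℤ) (ξ : Tan d) : ℝ := Real.sqrt ((l : ℝ) ^ 2 + ‖ξ‖ ^ 2)

/-- The Japanese bracket `⟨x⟩ = (1 + x²)^{1/2}`. -/
def jap (x : ℝ) : ℝ := Real.sqrt (1 + x ^ 2)

/-- The norm of `Y_s` (with weight exponent `N`), as an extended nonnegative number:
`u ∈ L²` belongs to `Y_s` iff this is finite. -/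
def normY {d : ℕ} (N : ℕ) (s : ℝ) (u : L2 d) : ℝ≥0∞ :=
  (∫⁻ ξ : Tan d, ∑' l : ℤ, ENNReal.ofReal
    (Real.exp (2 * s * len l ξ) * jap (len l ξ) ^ (2 * N) * ‖hat u l ξ‖ ^ 2)) ^ (1 / 2 : ℝ)

/-- Pairs of sequences `(a_φ^n, a_ψ^n)_{n ≥ 1}` of functions of `L²(ℝ^{d-1} × 𝕋)`; the index
`0 : Fin 2` stands for `φ` and `1 : Fin 2` for `ψ`. -/
abbrev Profiles (d : ℕ) := Fin 2 → ℕ+ → L2 d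

/-- The norm of the space of pairs of sequences `𝐘_s²`, as an extended nonnegative number:
`a` belongs to `𝐘_s²` iff this is finite. -/
def normYY {d : ℕ} (N : ℕ) (s : ℝ) (a : Profiles d) : ℝ≥0∞ :=
  (∑ ζ : Fin 2, ∑' n : ℕ+, ENNReal.ofReal
    (Real.exp (2 * s * (n : ℝ)) * jap (n : ℝ) ^ (2 * N)) * normY N s (a ζ n) ^ 2) ^ (1 / 2 : ℝ)

/-- `H` takes values in `𝐘_s²` on `J` and is continuous on `J` for the norm of `𝐘_s²`. -/
def ContinuousOnYY {d : ℕ} (N : ℕ) (s : ℝ) (H : ℝ → Profiles d) (J : Set ℝ) : Prop :=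
  ∀ t ∈ J, normYY N s (H t) < ∞ ∧
    Tendsto (fun t' => normYY N s (H t' - H t)) (𝓝[J] t) (𝓝 0)

/-- On the open set `J`, `a` is a `C¹` function with values in the normed space `𝐘_s²`, with
derivative `a'`. -/
def HasC1DerivYY {d : ℕ} (N : ℕ) (s : ℝ) (a a' : ℝ → Profiles d) (J : Set ℝ) : Prop :=
  (∀ t ∈ J, normYY N s (a t) < ∞ ∧
    Tendsto (fun h : ℝ => normYY N s ((h⁻¹ : ℂ) • (a (t + h) - a t) - a' t)) (𝓝[≠] 0) (𝓝 0)) ∧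
  ContinuousOnYY N s a' J

/-! ### The operators of the model

Each operator below is given its natural value in `L²(ℝ^{d-1} × 𝕋)` whenever there is one, and the
value `0` otherwise. -/

open Classical in
/-- The Fourier multiplier of symbol `m(l,ξ)`: the function `w ∈ L²` with
`ŵ_l(ξ) = m(l,ξ) û_l(ξ)`. -/
def multiplier {d : ℕ} (m : ℤ → Tan d → ℂ) (u : L2 d) : L2 d :=
  if h : ∃ w : L2 d, ∀ l : ℤ, ∀ᵐ ξ : Tan d, hat w l ξ = m l ξ * hat u l ξ then h.choose else 0

/-- `∂_Θ u`. -/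
def dTheta {d : ℕ} (u : L2 d) : L2 d :=
  multiplier (fun l _ => Complex.I * (l : ℂ)) u

/-- `v · ∇_y u`. -/
def dirDeriv {d : ℕ} (v : Tan d) (u : L2 d) : L2 d :=
  multiplier (fun _ ξ => Complex.I * ((inner ℝ v ξ : ℝ) : ℂ)) u

open Classical in
/-- The pointwise product `u v`. -/
def mul {d : ℕ} (u v : L2 d) : L2 d :=
  if h : MemLp (fun z => u z * v z) 2 (domMeasure d) then h.toLp _ else 0

/-- `w = 𝔽^per[u,v]`: the Fourier coefficients of `w` are
`w_l = ∑_{l₁ + l₃ = l, l₁ l₃ ≠ 0} i u_{l₁} v_{l₃} / (l₁ δ₁ + l₃ δ₃)` for `l ≠ 0`, and `w_0 = 0`. -/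
def IsFper {d : ℕ} (δ₁ δ₃ : ℝ) (u v w : L2 d) : Prop :=
  ∀ l : ℤ, ∀ᵐ y : Tan d,
    if l = 0 then mode w l y = 0
    else HasSum (fun l₁ : {k : ℤ // k ≠ 0 ∧ l - k ≠ 0} =>
      Complex.I * mode u l₁.1 y * mode v (l - l₁.1) y /
        ((l₁.1 : ℂ) * (δ₁ : ℂ) + ((l - l₁.1 : ℤ) : ℂ) * (δ₃ : ℂ))) (mode w l y)

open Classical in
/-- The bilinear operator `𝔽^per[u,v]`. -/
def Fper {d : ℕ} (δ₁ δ₃ : ℝ) (u v : L2 d) : L2 d :=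
  if h : ∃ w : L2 d, IsFper δ₁ δ₃ u v w then h.choose else 0

/-- The scalar and vector coefficients of the model, indexed by `ζ = φ, ψ`. -/
structure Coeffs (d : ℕ) where
  /-- the velocities `v_ζ^Lop` -/
  v : Fin 2 → Tan d
  /-- the coefficients `D_ζ^Lop` of the Burgers terms -/
  D : Fin 2 → ℂ
  /-- the coefficients `w_ζ` of the small divisor terms -/
  w : Fin 2 → ℝ
  /-- the coefficients `K_ζ^Lop` of the convolution terms -/
  K : Fin 2 → ℝ
  /-- the coefficients `δ_ζ^1` in the small divisors -/
  δ₁ : Fin 2 → ℝ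
  /-- the coefficients `δ_ζ^3` in the small divisors -/
  δ₃ : Fin 2 → ℝ

/-- The right-hand side
`L a - ∂_Θ D^Lop(a,a) - 𝔽^per(∂_Θ a, ∂_Θ a) + H + K^Lop(a,a)` of the model. -/
def rhs {d : ℕ} (c : Coeffs d) (H a : Profiles d) : Profiles d := fun ζ n =>
  dirDeriv (c.v ζ) (a ζ n)
    - dTheta (c.D ζ • mul (a ζ 1) (a ζ n))
    - (c.w ζ : ℂ) • Fper (c.δ₁ ζ) (c.δ₃ ζ) (dTheta (a ζ 1)) (dTheta (a ζ n))
    + H ζ n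
    + (c.K ζ : ℂ) • ∑ k ∈ Finset.Iio n, dTheta (mul (a 0 k) (a 1 (n - k)))

/-- `a ∈ C¹((-r, r), 𝐘_s²)` solves `∂_t a = L a - … + H + K^Lop(a,a)` on `(-r, r)`, and
`a(0) = 0`. -/
def IsSolution {d : ℕ} (c : Coeffs d) (N : ℕ) (H : ℝ → Profiles d) (s r : ℝ)
    (a : ℝ → Profiles d) : Prop :=
  a 0 = 0 ∧ ∃ a' : ℝ → Profiles d, HasC1DerivYY N s a a' (Set.Ioo (-r) r) ∧
    ∀ t ∈ Set.Ioo (-r) r, a' t = rhs c (H t) (a t)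

/-! ### The symbol and the small divisors -/

/-- The symbol `L(0,α) = τ I + ∑_{i<d} η_i A_i(0) + ξ A_d(0)` at `α = (τ, η, ξ)`. -/
def symbol {d : ℕ} (A : Fin (d - 1) → Matrix (Fin 3) (Fin 3) ℝ) (Ad : Matrix (Fin 3) (Fin 3) ℝ)
    (α : ℝ × Tan d × ℝ) : Matrix (Fin 3) (Fin 3) ℝ :=
  α.1 • (1 : Matrix (Fin 3) (Fin 3) ℝ) + ∑ i, α.2.1 i • A i + α.2.2 • Ad

/-- The bound `1/|l₁ δ_ζ^1 + l₃ δ_ζ^3| ≤ C min(|l₁|^m, |l₃|^m)` (with nonzero denominators), for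
some `C`, all nonzero integers `l₁, l₃` and `ζ = φ, ψ`. -/
def SmallDivisorExponent {d : ℕ} (c : Coeffs d) (m : ℝ) : Prop :=
  ∃ C : ℝ, 0 < C ∧ ∀ ζ : Fin 2, ∀ l₁ l₃ : ℤ, l₁ ≠ 0 → l₃ ≠ 0 →
    (l₁ : ℝ) * c.δ₁ ζ + (l₃ : ℝ) * c.δ₃ ζ ≠ 0 ∧
    1 / |(l₁ : ℝ) * c.δ₁ ζ + (l₃ : ℝ) * c.δ₃ ζ| ≤ C * min (|(l₁ : ℝ)| ^ m) (|(l₃ : ℝ)| ^ m)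

end BoundaryModel

end

open MeasureTheory Filter Topology FourierTransform
open scoped ENNReal

noncomputable section

/-! The weighted Fourier transform identifies `𝐘_s²` with one fixed `L²` space over the frequencies
`((ζ, n), (l, ξ))`. Lowering `s` to `s'` then becomes multiplication by `e^{-(s-s')ρ}`, where `ρ = n
+ |(l,ξ)|`. The system is an equation `u' = G(u) + H` in which `G` loses one factor `ρ`. It is
solved by a Cauchy–Kovalevskaya argument carried out frequency by frequency, with pointwise
majorants in place of a scale of norms.

`Dom ρ κ f U` means `|f| ≤ e^{-κρ} U` almost everywhere. The analytic input is `MajorantLip`: if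
`f`, `g`, `f - g` are dominated at rate `κ` by `U`, `V`, `D`, then `G f - G g` is dominated at the
same rate by `ρ M`, where `‖M‖ ≤ C (1 + ‖U‖ + ‖V‖) ‖D‖` and `M` does not depend on `κ`. The rate may
therefore decrease in time, `κ(t) = κ₀ - λ|t|`. Since the integral of `ρ e^{-κ(τ)ρ}` between `0` and
`t` is at most `λ⁻¹ e^{-κ(t)ρ}` (`lintegral_exp_weight_le`, `dom_integral`), integration in time
gives back the lost factor with a coefficient `λ⁻¹`, small for large `λ`. Picard iteration converges
(`MajorantLip.exists_solution`), and the same estimate, iterated on the difference of two solutions,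
gives local uniqueness (`MajorantLip.eventually_eq`).

For the model, this property (`majorantLip_modelMap`) rests on the small divisor bound. The
coefficients of `𝔽^per[∂_Θ u, ∂_Θ v]` are at most `C |l₁ l₃| min(|l₁|, |l₃|)^m`, and the larger
index is at most the smaller one times `1 + |l₁ + l₃|`. So one derivative falls on the output and `m
+ 2` powers fall on the smaller frequency (`norm_perDerivCoeff_le`). The weight `⟨·⟩^{-N}` of the
smaller frequency absorbs these powers, and what remains, `⟨·⟩^{-(N-m-2)}`, is square integrable by
the hypothesis on `N`. Cauchy–Schwarz and Young's inequality conclude (`l2_wconv_le`). The index `n`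
is treated in the same way.

For a given `s`, the source is measured at the intermediate index `(1 + s)/2`: its blow-up like
`1/(1 - s)` is compensated by the length of the time interval, proportional to `δ(1 - s)`. Solutions
obtained for different `s` agree by uniqueness (`IsSolution.eq_on`) and are glued together
(`exists_unique_solution`).

The existence of an exponent is algebraic. On the plane spanned by `ζ₁` and `ζ₃` the determinant is
a binary cubic form with known roots, equal to a nonzero constant times `l₁ l₃ (l₁ δ₁ + l₃ δ₃)`
(`det_symbol_combination`). If the last factor is smaller than `1`, then `l₁` and `l₃` are
comparable, so a bound in `|(l₁, l₃)|` is a bound in either index (`exists_smallDivisor_bound`). -/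

namespace BoundaryModel

/-! ### Square integrals of functions with values in `[0, ∞]`. -/

section SquareIntegral

variable {Ω : Type*} [MeasurableSpace Ω]

/-- The `L²` size of a nonnegative function. -/
def l2 (μ : Measure Ω) (U : Ω → ℝ≥0∞) : ℝ≥0∞ := (∫⁻ x, U x ^ 2 ∂μ) ^ (1 / 2 : ℝ)

variable {μ : Measure Ω}

theorem l2_sq (U : Ω → ℝ≥0∞) : l2 μ U ^ 2 = ∫⁻ x, U x ^ 2 ∂μ := by
  rw [l2, ← ENNReal.rpow_natCast, ← ENNReal.rpow_mul]
  norm_num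

theorem l2_mono_ae {U V : Ω → ℝ≥0∞} (h : ∀ᵐ x ∂μ, U x ≤ V x) : l2 μ U ≤ l2 μ V := by
  refine ENNReal.rpow_le_rpow (lintegral_mono_ae ?_) (by norm_num)
  filter_upwards [h] with x hx
  gcongr

theorem l2_mono {U V : Ω → ℝ≥0∞} (h : ∀ x, U x ≤ V x) : l2 μ U ≤ l2 μ V :=
  l2_mono_ae (Eventually.of_forall h)

theorem l2_congr_ae {U V : Ω → ℝ≥0∞} (h : ∀ᵐ x ∂μ, U x = V x) : l2 μ U = l2 μ V :=
  le_antisymm (l2_mono_ae (h.mono fun _ hx => hx.le)) (l2_mono_ae (h.mono fun _ hx => hx.ge))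

theorem l2_add_le {U V : Ω → ℝ≥0∞} (hU : AEMeasurable U μ) (hV : AEMeasurable V μ) :
    l2 μ (fun x => U x + V x) ≤ l2 μ U + l2 μ V := by
  have := ENNReal.lintegral_Lp_add_le hU hV (p := 2) (by norm_num)
  simpa [l2] using this

theorem l2_const_mul {U : Ω → ℝ≥0∞} (c : ℝ≥0∞) (hU : AEMeasurable U μ) :
    l2 μ (fun x => c * U x) = c * l2 μ U := by
  have : ∀ x, (c * U x) ^ 2 = c ^ 2 * U x ^ 2 := fun x => mul_pow _ _ _
  simp only [l2, this]
  rw [lintegral_const_mul'' _ (hU.pow_const 2), ENNReal.mul_rpow_of_nonneg _ _ (by norm_num)]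
  congr 1
  rw [← ENNReal.rpow_natCast, ← ENNReal.rpow_mul]
  norm_num

theorem l2_finset_sum_le {ι : Type*} (s : Finset ι) {U : ι → Ω → ℝ≥0∞}
    (hU : ∀ i, AEMeasurable (U i) μ) :
    l2 μ (fun x => ∑ i ∈ s, U i x) ≤ ∑ i ∈ s, l2 μ (U i) := by
  classical
  induction s using Finset.induction_on with
  | empty => simp [l2]
  | insert i s hi ih =>
    simp only [Finset.sum_insert hi]
    exact (l2_add_le (hU i) (Finset.aemeasurable_fun_sum s fun j _ => hU j)).trans
      (by gcongr)

theorem l2_tsum_le {U : ℕ → Ω → ℝ≥0∞} (hU : ∀ i, Measurable (U i)) :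
    l2 μ (fun x => ∑' i, U i x) ≤ ∑' i, l2 μ (U i) := by
  have h1 : l2 μ (fun x => ∑' i, U i x) ^ 2 ≤ (∑' i, l2 μ (U i)) ^ 2 := by
    rw [l2_sq]
    have h2 : ∀ x, (∑' i, U i x) ^ 2 = ⨆ n : ℕ, (∑ i ∈ Finset.range n, U i x) ^ 2 := by
      intro x
      rw [ENNReal.tsum_eq_iSup_nat]
      refine (Monotone.map_iSup_of_continuousAt (f := fun y : ℝ≥0∞ => y ^ 2)
        (ENNReal.continuous_pow 2).continuousAt (fun a b h => pow_le_pow_left' h 2) (by simp))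
    simp only [h2]
    rw [lintegral_iSup]
    · refine iSup_le fun n => ?_
      rw [← l2_sq]
      gcongr
      exact (l2_finset_sum_le _ fun i => (hU i).aemeasurable).trans (ENNReal.sum_le_tsum _)
    · intro n
      exact (Finset.measurable_fun_sum _ fun i _ => hU i).pow_const 2
    · intro a b hab x
      simp only
      gcongr
  by_contra hlt
  exact absurd h1 (not_le.2 (ENNReal.pow_lt_pow_left two_ne_zero (not_le.1 hlt)))

theorem l2_enorm_eq {F : Type*} [NormedAddCommGroup F] (f : Lp F 2 μ) : l2 μ (fun x => ‖f x‖ₑ) = ‖f‖ₑ := by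
  rw [Lp.enorm_def, eLpNorm_eq_lintegral_rpow_enorm_toReal (by norm_num) (by norm_num)]
  simp [l2]

theorem enorm_le_l2 {f : Lp ℂ 2 μ} {U : Ω → ℝ≥0∞} (h : ∀ᵐ x ∂μ, ‖f x‖ₑ ≤ U x) :
    ‖f‖ₑ ≤ l2 μ U := by
  rw [← l2_enorm_eq]
  exact l2_mono_ae h

theorem ae_lt_top_of_l2 {U : Ω → ℝ≥0∞} (hU : Measurable U) (h : l2 μ U ≠ ∞) :
    ∀ᵐ x ∂μ, U x < ∞ := by
  have : ∫⁻ x, U x ^ 2 ∂μ ≠ ∞ := by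
    rw [← l2_sq]
    exact ENNReal.pow_ne_top h
  filter_upwards [ae_lt_top (hU.pow_const 2) this] with x hx
  by_contra hx'
  simp [top_le_iff.1 (not_lt.1 hx')] at hx

theorem memLp_of_l2 {f : Ω → ℂ} (hf : AEStronglyMeasurable f μ) {U : Ω → ℝ≥0∞}
    (h : ∀ᵐ x ∂μ, ‖f x‖ₑ ≤ U x) (hU : l2 μ U ≠ ∞) : MemLp f 2 μ := by
  refine ⟨hf, ?_⟩
  rw [eLpNorm_eq_lintegral_rpow_enorm_toReal (by norm_num) (by norm_num)]
  have := (l2_mono_ae h).trans_lt hU.lt_top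
  simpa [l2] using this

theorem measurable_enorm_coe (f : Lp ℂ 2 μ) : Measurable fun x => ‖f x‖ₑ :=
  (Lp.stronglyMeasurable f).measurable.enorm

end SquareIntegral

/-! ### Pointwise bounds for integrals with values in `L²`. -/

section DominatedIntegral

variable {Ω : Type*} [MeasurableSpace Ω] {μ : Measure Ω}

/-- The test function is the phase of `f` restricted to `A`. It has modulus at most one, so the
pairing is sharp for `f` and an upper bound for every other `g`. -/
theorem exists_inner_eq_setLIntegral (f : Lp ℂ 2 μ) {A : Set Ω} (hA : MeasurableSet A)
    (hμA : μ A < ∞) : ∃ φ : Lp ℂ 2 μ, ‖(inner ℂ φ f : ℂ)‖ₑ = ∫⁻ x in A, ‖f x‖ₑ ∂μ ∧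
      ∀ g : Lp ℂ 2 μ, ‖(inner ℂ φ g : ℂ)‖ₑ ≤ ∫⁻ x in A, ‖g x‖ₑ ∂μ := by
  set φ₀ : Ω → ℂ := A.indicator fun x => f x / (‖f x‖ : ℂ) with hφ₀
  have hm : Measurable (f : Ω → ℂ) := (Lp.stronglyMeasurable f).measurable
  have hle : ∀ x, ‖φ₀ x‖ ≤ ‖A.indicator (fun _ => (1 : ℝ)) x‖ := by
    intro x
    by_cases hx : x ∈ A
    · simp only [hφ₀, Set.indicator_of_mem hx, norm_div, Complex.norm_real, norm_norm, norm_one]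
      exact div_self_le_one _
    · simp [hφ₀, hx]
  have hφm : MemLp φ₀ 2 μ :=
    (memLp_indicator_const 2 hA (1 : ℝ) (Or.inr hμA.ne)).mono
      ((hm.div (Complex.measurable_ofReal.comp hm.norm)).indicator hA).aestronglyMeasurable
      (Eventually.of_forall hle)
  have hpt : ∀ (x : Ω) (z : ℂ), ‖(inner ℂ (φ₀ x) z : ℂ)‖ ≤ A.indicator (fun _ => ‖z‖) x := by
    intro x z
    refine (norm_inner_le_norm _ _).trans ?_
    refine (mul_le_mul_of_nonneg_right (hle x) (norm_nonneg z)).trans ?_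
    by_cases hx : x ∈ A <;> simp [hx]
  refine ⟨hφm.toLp φ₀, ?_, fun g => ?_⟩
  · have h1 : (inner ℂ (hφm.toLp φ₀) f : ℂ) = ∫ x in A, ((‖f x‖ : ℝ) : ℂ) ∂μ := by
      rw [L2.inner_def, ← integral_indicator hA]
      refine integral_congr_ae ?_
      filter_upwards [hφm.coeFn_toLp] with x hx
      rw [hx]
      by_cases hxA : x ∈ A
      · simp only [hφ₀, Set.indicator_of_mem hxA, RCLike.inner_apply]
        by_cases h0 : f x = 0
        · simp [h0]
        · have : (‖f x‖ : ℂ) ≠ 0 := by simpa using h0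
          rw [map_div₀, Complex.conj_ofReal, mul_div_assoc', Complex.mul_conj,
            Complex.normSq_eq_norm_sq]
          push_cast
          field_simp
      · simp [hφ₀, hxA]
    rw [h1, integral_complex_ofReal]
    have hint : IntegrableOn (f : Ω → ℂ) A μ := by
      have : IsFiniteMeasure (μ.restrict A) := ⟨by simpa using hμA⟩
      exact ((Lp.memLp f).restrict A).integrable (by norm_num)
    rw [← ofReal_integral_norm_eq_lintegral_enorm hint, ← ofReal_norm, Complex.norm_real,
      Real.norm_of_nonneg (integral_nonneg fun _ => norm_nonneg _)]
  · rw [L2.inner_def]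
    refine (enorm_integral_le_lintegral_enorm _).trans ?_
    rw [← lintegral_indicator hA]
    refine lintegral_mono_ae ?_
    filter_upwards [hφm.coeFn_toLp] with x hx
    rw [hx, ← ofReal_norm]
    refine (ENNReal.ofReal_le_ofReal (hpt x _)).trans ?_
    by_cases hxA : x ∈ A <;> simp [hxA, ofReal_norm]

/-- No jointly measurable version of `(τ, x) ↦ F τ x` is assumed, so Minkowski's inequality cannot
be applied pointwise. Duality replaces it: a test function sees the Bochner integral as a scalar
integral. -/
theorem enorm_integral_le_ae [SigmaFinite μ] {F : ℝ → Lp ℂ 2 μ} {s : Set ℝ} (hF : IntegrableOn F s)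
    {Ψ : Ω → ℝ≥0∞}
    (h : ∀ A, MeasurableSet A → μ A < ∞ →
      ∫⁻ τ in s, ∫⁻ x in A, ‖F τ x‖ₑ ∂μ ≤ ∫⁻ x in A, Ψ x ∂μ) :
    ∀ᵐ x ∂μ, ‖(∫ τ in s, F τ) x‖ₑ ≤ Ψ x := by
  refine ae_le_of_forall_setLIntegral_le_of_sigmaFinite (measurable_enorm_coe _)
    fun A hA hμA => ?_
  obtain ⟨φ, hφ, hφle⟩ := exists_inner_eq_setLIntegral (∫ τ in s, F τ) hA hμA
  rw [← hφ, ← integral_inner hF]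
  refine (enorm_integral_le_lintegral_enorm _).trans ?_
  exact (lintegral_mono fun τ => hφle (F τ)).trans (h A hA hμA)

theorem enorm_intervalIntegral_le_ae [SigmaFinite μ] {F : ℝ → Lp ℂ 2 μ} {a b : ℝ}
    (hF : IntervalIntegrable F volume a b) {Ψ : Ω → ℝ≥0∞}
    (h : ∀ A, MeasurableSet A → μ A < ∞ →
      ∫⁻ τ in Set.uIoc a b, ∫⁻ x in A, ‖F τ x‖ₑ ∂μ ≤ ∫⁻ x in A, Ψ x ∂μ) :
    ∀ᵐ x ∂μ, ‖(∫ τ in a..b, F τ) x‖ₑ ≤ Ψ x := by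
  have h1 := enorm_integral_le_ae hF.def' h
  rcases intervalIntegral.integral_cases F a b with h2 | h2
  · rw [h2]; exact h1
  · rw [h2]
    filter_upwards [h1, Lp.coeFn_neg (∫ τ in Set.uIoc a b, F τ)] with x hx hx2
    rw [hx2, Pi.neg_apply, enorm_neg]
    exact hx

end DominatedIntegral

/-! ### Exponential majorants and their integration in time. -/

section Majorants

variable {Ω : Type*} [MeasurableSpace Ω] {μ : Measure Ω}

/-- The majorant `D` is the integral of `|H₁(τ)|` over the whole interval, computed in real `L²`. It
depends neither on the endpoints `t₀`, `t` nor on `w`. The choice `w = e^{-κρ}` serves for the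
source term, the choice `w = 1` for the a priori majorant of a solution. -/
theorem exists_majorant_integral [SigmaFinite μ] {H₁ : ℝ → Lp ℂ 2 μ} {a b B : ℝ} (hab : a ≤ b)
    (hH : ContinuousOn H₁ (Set.Icc a b)) (hB : ∀ t ∈ Set.Icc a b, ‖H₁ t‖ ≤ B) :
    ∃ D : Ω → ℝ≥0∞, Measurable D ∧ l2 μ D ≤ ENNReal.ofReal (B * (b - a)) ∧
      ∀ (H : ℝ → Lp ℂ 2 μ) (w : Ω → ℝ), Measurable w → (∀ x, 0 ≤ w x) → (∀ x, w x ≤ 1) →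
        ContinuousOn H (Set.Icc a b) →
        (∀ τ ∈ Set.Icc a b, ∀ᵐ x ∂μ, ‖H τ x‖ₑ ≤ ENNReal.ofReal (w x) * ‖H₁ τ x‖ₑ) →
        ∀ t₀ ∈ Set.Icc a b, ∀ t ∈ Set.Icc a b,
          ∀ᵐ x ∂μ, ‖(∫ τ in t₀..t, H τ) x‖ₑ ≤ ENNReal.ofReal (w x) * D x := by
  have hL : LipschitzWith 1 (norm : ℂ → ℝ) := lipschitzWith_one_norm
  -- Taking the modulus is 1-Lipschitz on `L²`, hence `τ ↦ |H₁(τ)|` is again continuous and can be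
  -- integrated.
  set nm : Lp ℂ 2 μ → Lp ℝ 2 μ := hL.compLp norm_zero with hnm
  have hnmc : Continuous nm := hL.continuous_compLp norm_zero
  have hnmae : ∀ f : Lp ℂ 2 μ, ∀ᵐ x ∂μ, nm f x = ‖f x‖ := fun f => hL.coeFn_compLp norm_zero f
  have hnmn : ∀ f : Lp ℂ 2 μ, ‖nm f‖ ≤ ‖f‖ := fun f => by
    simpa using hL.norm_compLp_le norm_zero f
  set K : ℝ → Lp ℝ 2 μ := fun τ => nm (H₁ τ)
  have hKc : ContinuousOn K (Set.Icc a b) := hnmc.comp_continuousOn hH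
  have hKi : IntegrableOn K (Set.Ioc a b) :=
    (hKc.integrableOn_Icc).mono_set Set.Ioc_subset_Icc_self
  set G : Lp ℝ 2 μ := ∫ τ in Set.Ioc a b, K τ with hG
  refine ⟨fun x => ‖G x‖ₑ, (Lp.stronglyMeasurable G).measurable.enorm, ?_, ?_⟩
  · rw [l2_enorm_eq, ← ofReal_norm]
    refine ENNReal.ofReal_le_ofReal ?_
    have := intervalIntegral.norm_integral_le_of_norm_le_const (f := K) (a := a) (b := b) (C := B)
      (fun τ hτ => by
        rw [Set.uIoc_of_le hab] at hτ
        exact (hnmn _).trans (hB τ ⟨hτ.1.le, hτ.2⟩))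
    rwa [intervalIntegral.integral_of_le hab, abs_of_nonneg (sub_nonneg.2 hab)] at this
  · intro H w hw hw0 hw1 hHc hHle t₀ ht₀ t ht
    have hsub : Set.uIcc t₀ t ⊆ Set.Icc a b := Set.uIcc_subset_Icc ht₀ ht
    have hsub' : Set.uIoc t₀ t ⊆ Set.Ioc a b :=
      Set.Ioc_subset_Ioc (le_min ht₀.1 ht.1) (max_le ht₀.2 ht.2)
    refine enorm_intervalIntegral_le_ae (hHc.mono hsub).intervalIntegrable fun A hA hμA => ?_
    have hφm : MemLp (A.indicator w) 2 μ := by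
      refine (memLp_indicator_const 2 hA (1 : ℝ) (Or.inr hμA.ne)).mono
        (hw.indicator hA).aestronglyMeasurable (Eventually.of_forall fun x => ?_)
      by_cases hx : x ∈ A
      · simpa [hx, abs_of_nonneg (hw0 x)] using hw1 x
      · simp [hx]
    set φ : Lp ℝ 2 μ := hφm.toLp _
    have key : ∀ f : Lp ℝ 2 μ, (∀ᵐ x ∂μ, 0 ≤ f x) →
        ENNReal.ofReal (inner ℝ φ f) = ∫⁻ x in A, ENNReal.ofReal (w x) * ‖f x‖ₑ ∂μ := by
      intro f hf
      rw [L2.inner_def, ofReal_integral_eq_lintegral_ofReal (L2.integrable_inner φ f), 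
        ← lintegral_indicator hA]
      · refine lintegral_congr_ae ?_
        filter_upwards [hφm.coeFn_toLp, hf] with x hx hfx
        rw [hx]
        by_cases hxA : x ∈ A
        · simp only [Set.indicator_of_mem hxA, RCLike.inner_apply, conj_trivial]
          rw [mul_comm, ENNReal.ofReal_mul (hw0 x), ← ofReal_norm, Real.norm_of_nonneg hfx]
        · simp [hxA]
      · filter_upwards [hφm.coeFn_toLp, hf] with x hx hfx
        rw [hx]
        by_cases hxA : x ∈ A
        · simp only [Set.indicator_of_mem hxA, RCLike.inner_apply, conj_trivial]
          exact mul_nonneg hfx (hw0 x)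
        · simp [hxA]
    have hpos : ∀ τ, ∀ᵐ x ∂μ, 0 ≤ K τ x := fun τ => by
      filter_upwards [hnmae (H₁ τ)] with x hx
      rw [hx]; exact norm_nonneg _
    have hinner0 : ∀ τ, 0 ≤ (inner ℝ φ (K τ) : ℝ) := fun τ => by
      rw [L2.inner_def]
      refine integral_nonneg_of_ae ?_
      filter_upwards [hφm.coeFn_toLp, hpos τ] with x hx hfx
      rw [hx]
      by_cases hxA : x ∈ A
      · simp only [Set.indicator_of_mem hxA, RCLike.inner_apply, conj_trivial]
        exact mul_nonneg hfx (hw0 x)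
      · simp [hxA]
    calc ∫⁻ τ in Set.uIoc t₀ t, ∫⁻ x in A, ‖H τ x‖ₑ ∂μ
        ≤ ∫⁻ τ in Set.uIoc t₀ t, ENNReal.ofReal (inner ℝ φ (K τ)) := by
          refine setLIntegral_mono' measurableSet_uIoc fun τ hτ => ?_
          rw [key _ (hpos τ)]
          refine lintegral_mono_ae (ae_restrict_of_ae ?_)
          filter_upwards [hnmae (H₁ τ),
            hHle τ (Set.Ioc_subset_Icc_self (hsub' hτ))] with x hx hx2
          change _ ≤ _ * ‖nm (H₁ τ) x‖ₑ
          rw [hx, enorm_norm]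
          exact hx2
      _ ≤ ∫⁻ τ in Set.Ioc a b, ENNReal.ofReal (inner ℝ φ (K τ)) := lintegral_mono_set hsub'
      _ = ENNReal.ofReal (∫ τ in Set.Ioc a b, inner ℝ φ (K τ)) :=
          (ofReal_integral_eq_lintegral_ofReal (hKi.const_inner φ)
            (Eventually.of_forall hinner0)).symm
      _ = ENNReal.ofReal (inner ℝ φ G) := by rw [integral_inner hKi]
      _ ≤ ∫⁻ x in A, ENNReal.ofReal (w x) * ‖G x‖ₑ ∂μ := by
          rw [L2.inner_def]
          refine (ENNReal.ofReal_le_ofReal (Real.le_norm_self _)).trans ?_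
          rw [ofReal_norm]
          refine (enorm_integral_le_lintegral_enorm _).trans ?_
          rw [← lintegral_indicator hA]
          refine lintegral_mono_ae ?_
          filter_upwards [hφm.coeFn_toLp] with x hx
          rw [hx]
          by_cases hxA : x ∈ A
          · simp only [Set.indicator_of_mem hxA, RCLike.inner_apply, conj_trivial]
            rw [enorm_mul, mul_comm, ← ofReal_norm (w x), Real.norm_of_nonneg (hw0 x)]
          · simp [hxA]

/-- `|f| ≤ e^{-κρ} U` almost everywhere. -/
def Dom (ρ : Ω → ℝ) (κ : ℝ) (f : Lp ℂ 2 μ) (U : Ω → ℝ≥0∞) : Prop :=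
  ∀ᵐ x ∂μ, ‖f x‖ₑ ≤ ENNReal.ofReal (Real.exp (-κ * ρ x)) * U x

variable {ρ : Ω → ℝ}

theorem Dom.mono {κ κ' : ℝ} {f : Lp ℂ 2 μ} {U V : Ω → ℝ≥0∞} (hρ : ∀ x, 1 ≤ ρ x)
    (h : Dom ρ κ f U) (hκ : κ' ≤ κ) (hUV : ∀ x, U x ≤ V x) : Dom ρ κ' f V := by
  filter_upwards [h] with x hx
  refine hx.trans (mul_le_mul' (ENNReal.ofReal_le_ofReal (Real.exp_le_exp.2 ?_)) (hUV x))
  nlinarith [hρ x]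

theorem Dom.add {κ : ℝ} {f g : Lp ℂ 2 μ} {U V : Ω → ℝ≥0∞}
    (hf : Dom ρ κ f U) (hg : Dom ρ κ g V) : Dom ρ κ (f + g) (fun x => U x + V x) := by
  filter_upwards [hf, hg, Lp.coeFn_add f g] with x h1 h2 h3
  rw [h3, Pi.add_apply, mul_add]
  exact (enorm_add_le _ _).trans (add_le_add h1 h2)

theorem Dom.sub {κ : ℝ} {f g : Lp ℂ 2 μ} {U V : Ω → ℝ≥0∞}
    (hf : Dom ρ κ f U) (hg : Dom ρ κ g V) : Dom ρ κ (f - g) (fun x => U x + V x) := by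
  filter_upwards [hf, hg, Lp.coeFn_sub f g] with x h1 h2 h3
  rw [h3, Pi.sub_apply, mul_add]
  exact enorm_sub_le.trans (add_le_add h1 h2)

theorem dom_zero {κ : ℝ} {U : Ω → ℝ≥0∞} : Dom ρ κ (0 : Lp ℂ 2 μ) U := by
  filter_upwards [Lp.coeFn_zero ℂ 2 μ] with x hx
  rw [hx, Pi.zero_apply, enorm_zero]
  exact zero_le

theorem Dom.enorm_le {κ : ℝ} {f : Lp ℂ 2 μ} {U : Ω → ℝ≥0∞} (hρ : ∀ x, 1 ≤ ρ x)
    (h : Dom ρ κ f U) (hκ : 0 ≤ κ) : ‖f‖ₑ ≤ l2 μ U := by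
  refine enorm_le_l2 ?_
  filter_upwards [h] with x hx
  refine hx.trans (mul_le_of_le_one_left' ?_)
  rw [← ENNReal.ofReal_one]
  refine ENNReal.ofReal_le_ofReal (Real.exp_le_one_iff.2 ?_)
  nlinarith [hρ x]

/-- A subsequence converges almost everywhere, and the pointwise bound passes to the limit along it.
-/
theorem dom_of_tendsto {κ : ℝ} {f : ℕ → Lp ℂ 2 μ} {g : Lp ℂ 2 μ} {U : Ω → ℝ≥0∞}
    (hf : ∀ n, Dom ρ κ (f n) U) (h : Tendsto f atTop (𝓝 g)) : Dom ρ κ g U := by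
  obtain ⟨ns, -, hns⟩ := (tendstoInMeasure_of_tendsto_Lp h).exists_seq_tendsto_ae
  filter_upwards [hns, ae_all_iff.2 hf] with x hx hx2
  exact le_of_tendsto hx.enorm (Eventually.of_forall fun n => hx2 (ns n))

/-- The integrand is, up to the factor `λ`, the derivative of `e^{-(κ₀ - λ|τ - t₀|)ρ}` with respect
to `|τ - t₀|`. This is how a rate decreasing linearly in time pays for one factor `ρ`. -/
theorem lintegral_exp_weight_le {ρ lam κ₀ t₀ t : ℝ} (hρ : 0 ≤ ρ) (hlam : 0 < lam) :
    ∫⁻ τ in Set.uIoc t₀ t,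
      ENNReal.ofReal (Real.exp (-(κ₀ - lam * |τ - t₀|) * ρ)) * ENNReal.ofReal ρ ≤
    ENNReal.ofReal (Real.exp (-(κ₀ - lam * |t - t₀|) * ρ)) * ENNReal.ofReal lam⁻¹ := by
  have hint : Continuous fun τ : ℝ => Real.exp (-(κ₀ - lam * |τ - t₀|) * ρ) * ρ := by fun_prop
  simp only [← ENNReal.ofReal_mul (Real.exp_pos _).le]
  rw [← ofReal_integral_eq_lintegral_ofReal
    ((hint.integrableOn_uIcc).mono_set Set.uIoc_subset_uIcc)
    (Eventually.of_forall fun τ => mul_nonneg (Real.exp_pos _).le hρ)]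
  refine ENNReal.ofReal_le_ofReal ?_
  rcases le_total t₀ t with h | h
  · rw [Set.uIoc_of_le h, ← intervalIntegral.integral_of_le h]
    have h1 : ∫ τ in t₀..t, Real.exp (-(κ₀ - lam * |τ - t₀|) * ρ) * ρ =
        ∫ τ in t₀..t, Real.exp (-(κ₀ - lam * (τ - t₀)) * ρ) * ρ := by
      refine intervalIntegral.integral_congr fun τ hτ => ?_
      rw [Set.uIcc_of_le h] at hτ
      simp only [abs_of_nonneg (sub_nonneg.2 hτ.1)]
    rw [h1, intervalIntegral.integral_eq_sub_of_hasDerivAt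
      (f := fun τ => Real.exp (-(κ₀ - lam * (τ - t₀)) * ρ) * lam⁻¹)]
    · rw [abs_of_nonneg (sub_nonneg.2 h)]
      have : 0 ≤ Real.exp (-(κ₀ - lam * (t₀ - t₀)) * ρ) * lam⁻¹ := by positivity
      linarith
    · intro τ _
      have : HasDerivAt (fun τ : ℝ => -(κ₀ - lam * (τ - t₀)) * ρ) (lam * ρ) τ := by
        have := (((((hasDerivAt_id τ).sub_const t₀).const_mul lam).const_sub κ₀).neg).mul_const ρ
        simpa using this
      convert! this.exp.mul_const lam⁻¹ using 1
      field_simp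
    · exact (by fun_prop : Continuous _).intervalIntegrable _ _
  · rw [Set.uIoc_of_ge h, ← intervalIntegral.integral_of_le h]
    have h1 : ∫ τ in t..t₀, Real.exp (-(κ₀ - lam * |τ - t₀|) * ρ) * ρ =
        ∫ τ in t..t₀, Real.exp (-(κ₀ + lam * (τ - t₀)) * ρ) * ρ := by
      refine intervalIntegral.integral_congr fun τ hτ => ?_
      rw [Set.uIcc_of_le h] at hτ
      simp only [abs_of_nonpos (sub_nonpos.2 hτ.2)]
      ring_nf
    rw [h1, intervalIntegral.integral_eq_sub_of_hasDerivAt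
      (f := fun τ => -(Real.exp (-(κ₀ + lam * (τ - t₀)) * ρ) * lam⁻¹))]
    · rw [abs_of_nonpos (sub_nonpos.2 h)]
      have : 0 ≤ Real.exp (-(κ₀ + lam * (t₀ - t₀)) * ρ) * lam⁻¹ := by positivity
      have h2 : -(κ₀ - lam * -(t - t₀)) * ρ = -(κ₀ + lam * (t - t₀)) * ρ := by ring
      rw [h2]
      linarith
    · intro τ _
      have : HasDerivAt (fun τ : ℝ => -(κ₀ + lam * (τ - t₀)) * ρ) (-(lam * ρ)) τ := by
        have := (((((hasDerivAt_id τ).sub_const t₀).const_mul lam).const_add κ₀).neg).mul_const ρ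
        simpa using this
      convert! (this.exp.mul_const lam⁻¹).neg using 1
      field_simp
    · exact (by fun_prop : Continuous _).intervalIntegrable _ _

theorem dom_integral [SigmaFinite μ] (hρm : Measurable ρ) (hρ : ∀ x, 1 ≤ ρ x)
    {lam κ₀ t₀ t : ℝ} (hlam : 0 < lam) {F : ℝ → Lp ℂ 2 μ} {M : Ω → ℝ≥0∞} (hM : Measurable M)
    (hF : IntervalIntegrable F volume t₀ t)
    (h : ∀ τ ∈ Set.uIoc t₀ t,
      Dom ρ (κ₀ - lam * |τ - t₀|) (F τ) (fun x => ENNReal.ofReal (ρ x) * M x)) :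
    Dom ρ (κ₀ - lam * |t - t₀|) (∫ τ in t₀..t, F τ) (fun x => ENNReal.ofReal lam⁻¹ * M x) := by
  refine enorm_intervalIntegral_le_ae hF fun A hA hμA => ?_
  calc ∫⁻ τ in Set.uIoc t₀ t, ∫⁻ x in A, ‖F τ x‖ₑ ∂μ
      ≤ ∫⁻ τ in Set.uIoc t₀ t, ∫⁻ x in A,
          ENNReal.ofReal (Real.exp (-(κ₀ - lam * |τ - t₀|) * ρ x)) *
            (ENNReal.ofReal (ρ x) * M x) ∂μ :=
        setLIntegral_mono' measurableSet_uIoc fun τ hτ =>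
          lintegral_mono_ae (ae_restrict_of_ae (h τ hτ))
    _ = ∫⁻ x in A, (∫⁻ τ in Set.uIoc t₀ t,
          ENNReal.ofReal (Real.exp (-(κ₀ - lam * |τ - t₀|) * ρ x)) *
            (ENNReal.ofReal (ρ x) * M x)) ∂μ := by
        -- The exchange concerns only the explicit majorant, which is jointly measurable; `F` no
        -- longer appears.
        refine lintegral_lintegral_swap ?_
        refine Measurable.aemeasurable ?_
        fun_prop
    _ ≤ _ := by
        refine lintegral_mono fun x => ?_
        simp only [← mul_assoc]
        rw [lintegral_mul_const _ (by fun_prop)]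
        exact mul_le_mul' (lintegral_exp_weight_le (zero_le_one.trans (hρ x)) hlam) le_rfl

end Majorants

/-! ### Continuity and local uniqueness for equations with a majorant Lipschitz nonlinearity. -/

section MajorantODE

variable {Ω : Type*} [MeasurableSpace Ω] {μ : Measure Ω} {ρ : Ω → ℝ}

/-- `G` is Lipschitz, up to one factor `ρ`, on functions majorized by `e^{-κρ} U`,
uniformly in `κ`. -/
def MajorantLip (ρ : Ω → ℝ) (C : ℝ≥0∞) (G : Lp ℂ 2 μ → Lp ℂ 2 μ) : Prop :=
  ∀ U V D : Ω → ℝ≥0∞, ∃ M : Ω → ℝ≥0∞,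
    Measurable U → Measurable V → Measurable D → l2 μ U ≠ ∞ → l2 μ V ≠ ∞ → l2 μ D ≠ ∞ →
    Measurable M ∧ l2 μ M ≤ C * (1 + l2 μ U + l2 μ V) * l2 μ D ∧
    ∀ κ : ℝ, 0 < κ → ∀ f g : Lp ℂ 2 μ, Dom ρ κ f U → Dom ρ κ g V → Dom ρ κ (f - g) D →
      Dom ρ κ (G f - G g) (fun x => ENNReal.ofReal (ρ x) * M x)

theorem exp_mul_le_inv {κ r : ℝ} (hκ : 0 < κ) : Real.exp (-κ * r) * r ≤ κ⁻¹ := by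
  have h1 : κ * r ≤ Real.exp (κ * r) := by linarith [Real.add_one_le_exp (κ * r)]
  rw [neg_mul, Real.exp_neg, inv_mul_eq_div, div_le_iff₀ (Real.exp_pos _)]
  rw [inv_mul_eq_div, le_div_iff₀ hκ]
  linarith

theorem Dom.enorm_le_inv {κ : ℝ} (hκ : 0 < κ) {f : Lp ℂ 2 μ} {M : Ω → ℝ≥0∞} (hM : Measurable M)
    (h : Dom ρ κ f (fun x => ENNReal.ofReal (ρ x) * M x)) :
    ‖f‖ₑ ≤ ENNReal.ofReal κ⁻¹ * l2 μ M := by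
  rw [← l2_const_mul _ hM.aemeasurable]
  refine enorm_le_l2 ?_
  filter_upwards [h] with x hx
  refine hx.trans ?_
  rw [← mul_assoc, ← ENNReal.ofReal_mul (Real.exp_pos _).le]
  gcongr
  exact exp_mul_le_inv hκ

theorem lintegral_mul_le_l2 {U V : Ω → ℝ≥0∞} (hU : AEMeasurable U μ) (hV : AEMeasurable V μ) :
    ∫⁻ x, U x * V x ∂μ ≤ l2 μ U * l2 μ V := by
  have := ENNReal.lintegral_mul_le_Lp_mul_Lq μ Real.HolderConjugate.two_two hU hV
  simpa [l2] using this

/-- An interpolation: `f - g` is bounded by `2 e^{-κρ} U`, so `e^{κρ} |f - g|² ≤ 2 U |f - g|`, and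
Cauchy–Schwarz applies. Half of the decay is traded for the square root of the norm. -/
theorem l2_exp_half_le {κ : ℝ} {f g : Lp ℂ 2 μ} {U : Ω → ℝ≥0∞}
    (hU : Measurable U) (hf : Dom ρ κ f U) (hg : Dom ρ κ g U) :
    l2 μ (fun x => ENNReal.ofReal (Real.exp (κ / 2 * ρ x)) * ‖(f - g : Lp ℂ 2 μ) x‖ₑ) ≤
      (2 * l2 μ U * ‖f - g‖ₑ) ^ (1 / 2 : ℝ) := by
  refine ENNReal.rpow_le_rpow ?_ (by norm_num)
  rw [← l2_enorm_eq (f - g), ← l2_const_mul _ hU.aemeasurable]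
  refine le_trans (lintegral_mono_ae ?_)
    (lintegral_mul_le_l2 (hU.const_mul 2).aemeasurable (measurable_enorm_coe _).aemeasurable)
  filter_upwards [hf.sub hg] with x hx
  rw [mul_pow, pow_two ‖_‖ₑ, ← mul_assoc]
  refine mul_le_mul' ?_ le_rfl
  refine (mul_le_mul' le_rfl hx).trans (le_of_eq ?_)
  rw [← mul_assoc, ← ENNReal.ofReal_pow (Real.exp_pos _).le,
    ← ENNReal.ofReal_mul (pow_nonneg (Real.exp_pos _).le 2), ← Real.exp_nat_mul, ← Real.exp_add]
  have : ((2 : ℕ) : ℝ) * (κ / 2 * ρ x) + -κ * ρ x = 0 := by push_cast; ring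
  rw [this, Real.exp_zero, ENNReal.ofReal_one, one_mul, two_mul]

/-- On functions with a common majorant `G` is Hölder continuous of exponent `1/2` in norm. Half of
the rate `κ` makes `D = e^{κρ/2}|f - g|` a small majorant of the difference, and the other half
absorbs the factor `ρ`. -/
theorem MajorantLip.enorm_sub_le {C : ℝ≥0∞} {G : Lp ℂ 2 μ → Lp ℂ 2 μ} (hG : MajorantLip ρ C G)
    (hρm : Measurable ρ) (hρ : ∀ x, 1 ≤ ρ x) {κ : ℝ} (hκ : 0 < κ) {f g : Lp ℂ 2 μ}
    {U : Ω → ℝ≥0∞} (hU : Measurable U) (hUt : l2 μ U ≠ ∞)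
    (hf : Dom ρ κ f U) (hg : Dom ρ κ g U) :
    ‖G f - G g‖ₑ ≤ ENNReal.ofReal (κ / 2)⁻¹ * (C * (1 + l2 μ U + l2 μ U) *
      (2 * l2 μ U * ‖f - g‖ₑ) ^ (1 / 2 : ℝ)) := by
  set D : Ω → ℝ≥0∞ :=
    fun x => ENNReal.ofReal (Real.exp (κ / 2 * ρ x)) * ‖(f - g : Lp ℂ 2 μ) x‖ₑ with hD
  have hDm : Measurable D :=
    (Real.measurable_exp.comp (hρm.const_mul _)).ennreal_ofReal.mul (measurable_enorm_coe _)
  have hDle := l2_exp_half_le hU hf hg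
  have hDt : l2 μ D ≠ ∞ := by
    refine (hDle.trans_lt (ENNReal.rpow_lt_top_of_nonneg (by norm_num) ?_)).ne
    exact ENNReal.mul_ne_top (ENNReal.mul_ne_top (by norm_num) hUt) enorm_ne_top
  obtain ⟨M, hM⟩ := hG U U D
  obtain ⟨hMm, hMle, hM⟩ := hM hU hU hDm hUt hUt hDt
  have hκ2 : 0 < κ / 2 := by positivity
  have h1 := hM (κ / 2) hκ2 f g (hf.mono hρ (by linarith) fun _ => le_rfl)
    (hg.mono hρ (by linarith) fun _ => le_rfl) (Eventually.of_forall fun x => ?_)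
  · refine (h1.enorm_le_inv hκ2 hMm).trans ?_
    gcongr
    exact hMle.trans (by gcongr)
  · rw [hD, ← mul_assoc, ← ENNReal.ofReal_mul (Real.exp_pos _).le, ← Real.exp_add]
    simp

theorem MajorantLip.tendsto {C : ℝ≥0∞} (hC : C ≠ ∞) {G : Lp ℂ 2 μ → Lp ℂ 2 μ}
    (hG : MajorantLip ρ C G) (hρm : Measurable ρ) (hρ : ∀ x, 1 ≤ ρ x) {κ : ℝ} (hκ : 0 < κ)
    {ι : Type*} {l : Filter ι} {f : ι → Lp ℂ 2 μ} {g : Lp ℂ 2 μ} {U : Ω → ℝ≥0∞}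
    (hU : Measurable U) (hUt : l2 μ U ≠ ∞) (hf : ∀ᶠ i in l, Dom ρ κ (f i) U) (hg : Dom ρ κ g U)
    (h : Tendsto f l (𝓝 g)) : Tendsto (fun i => G (f i)) l (𝓝 (G g)) := by
  rw [tendsto_iff_edist_tendsto_0] at h ⊢
  simp only [edist_eq_enorm_sub] at h ⊢
  have hlim : Tendsto (fun i => ENNReal.ofReal (κ / 2)⁻¹ * (C * (1 + l2 μ U + l2 μ U) *
      (2 * l2 μ U * ‖f i - g‖ₑ) ^ (1 / 2 : ℝ))) l (𝓝 0) := by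
    have h1 : Tendsto (fun i => 2 * l2 μ U * ‖f i - g‖ₑ) l (𝓝 0) := by
      simpa using ENNReal.Tendsto.const_mul h
        (Or.inr (ENNReal.mul_ne_top ENNReal.ofNat_ne_top hUt))
    have h2 := h1.ennrpow_const (1 / 2 : ℝ)
    rw [ENNReal.zero_rpow_of_pos (by norm_num)] at h2
    have h3 := ENNReal.Tendsto.const_mul (a := C * (1 + l2 μ U + l2 μ U)) h2
      (Or.inr (ENNReal.mul_ne_top hC (by simp [hUt])))
    have h4 := ENNReal.Tendsto.const_mul (a := ENNReal.ofReal (κ / 2)⁻¹) h3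
      (Or.inr ENNReal.ofReal_ne_top)
    simpa using h4
  refine tendsto_of_tendsto_of_tendsto_of_le_of_le' tendsto_const_nhds hlim
    (Eventually.of_forall fun _ => zero_le) ?_
  filter_upwards [hf] with i hi
  exact hG.enorm_sub_le hρm hρ hκ hU hUt hi hg

theorem MajorantLip.continuousOn {C : ℝ≥0∞} (hC : C ≠ ∞) {G : Lp ℂ 2 μ → Lp ℂ 2 μ}
    (hG : MajorantLip ρ C G) (hρm : Measurable ρ) (hρ : ∀ x, 1 ≤ ρ x) {κ : ℝ → ℝ}
    (hκc : Continuous κ) {s : Set ℝ} (hκ : ∀ t ∈ s, 0 < κ t) {u : ℝ → Lp ℂ 2 μ}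
    (hu : ContinuousOn u s) {U : Ω → ℝ≥0∞} (hU : Measurable U) (hUt : l2 μ U ≠ ∞)
    (h : ∀ t ∈ s, Dom ρ (κ t) (u t) U) : ContinuousOn (fun t => G (u t)) s := by
  intro t ht
  have h2 : κ t / 2 < κ t := by linarith [hκ t ht]
  -- The rate varies with time; near `t` it stays above `κ t / 2`, which serves as a common rate.
  refine hG.tendsto hC hρm hρ (κ := κ t / 2) (by linarith [hκ t ht]) hU hUt ?_
    ((h t ht).mono hρ h2.le fun _ => le_rfl) (hu t ht)
  filter_upwards [self_mem_nhdsWithin,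
    mem_nhdsWithin_of_mem_nhds (hκc.continuousAt.eventually (lt_mem_nhds h2))] with t' ht' ht2
  exact (h t' ht').mono hρ ht2.le fun _ => le_rfl

theorem half_pow_mul_tendsto {a : ℝ≥0∞} (ha : a ≠ ∞) :
    Tendsto (fun n : ℕ => (2⁻¹ : ℝ≥0∞) ^ n * a) atTop (𝓝 0) := by
  have h := ENNReal.tendsto_pow_atTop_nhds_zero_of_lt_one
    (r := (2⁻¹ : ℝ≥0∞)) (by simp [ENNReal.inv_lt_one])
  simpa using ENNReal.Tendsto.mul_const h (Or.inr ha)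

/-- The difference of the solutions is the integral of `G u - G v`, so any majorant of it produces a
new one of half the size. Iterating forces the difference to vanish. -/
theorem MajorantLip.eventually_eq [SigmaFinite μ] {C : ℝ≥0∞} (hC : C ≠ ∞)
    {G : Lp ℂ 2 μ → Lp ℂ 2 μ} (hG : MajorantLip ρ C G) (hρm : Measurable ρ) (hρ : ∀ x, 1 ≤ ρ x)
    {κ₀ : ℝ} (hκ₀ : 0 < κ₀) {s : Set ℝ} (hs : s.OrdConnected) {t₀ : ℝ} (ht₀ : t₀ ∈ s)
    {H u v : ℝ → Lp ℂ 2 μ} {U : Ω → ℝ≥0∞} (hU : Measurable U) (hUt : l2 μ U ≠ ∞)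
    (hu : ∀ t ∈ s, HasDerivAt u (G (u t) + H t) t) (hv : ∀ t ∈ s, HasDerivAt v (G (v t) + H t) t)
    (hud : ∀ t ∈ s, Dom ρ κ₀ (u t) U) (hvd : ∀ t ∈ s, Dom ρ κ₀ (v t) U) (h0 : u t₀ = v t₀) :
    ∃ ε > 0, ∀ t ∈ s, |t - t₀| < ε → u t = v t := by
  -- The slope `λ` is such that one integration in time halves the majorant. The rate `κ₀ - λ|t -
  -- t₀|` stays positive for `|t - t₀| < κ₀/λ`, whence the value of `ε` below.
  obtain ⟨lam, hlam, hlamC⟩ : ∃ lam : ℝ, 0 < lam ∧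
      ENNReal.ofReal lam⁻¹ * (C * (1 + l2 μ U + l2 μ U)) ≤ 2⁻¹ := by
    have hfin : C * (1 + l2 μ U + l2 μ U) ≠ ∞ := ENNReal.mul_ne_top hC (by simp [hUt])
    lift C * (1 + l2 μ U + l2 μ U) to NNReal using hfin with c
    refine ⟨2 * ((c : ℝ) + 1), by positivity, ?_⟩
    rw [← ENNReal.ofReal_coe_nnreal, ← ENNReal.ofReal_mul (by positivity)]
    have : (2⁻¹ : ℝ≥0∞) = ENNReal.ofReal 2⁻¹ := by
      rw [ENNReal.ofReal_inv_of_pos (by norm_num)]; simp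
    rw [this]
    refine ENNReal.ofReal_le_ofReal ?_
    rw [mul_inv, mul_assoc]
    refine mul_le_of_le_one_right (by norm_num) ?_
    rw [inv_mul_le_iff₀ (by positivity)]
    linarith
  refine ⟨κ₀ / lam, by positivity, ?_⟩
  set s' : Set ℝ := s ∩ Set.Ioo (t₀ - κ₀ / lam) (t₀ + κ₀ / lam) with hs'
  have hs'o : s'.OrdConnected := hs.inter Set.ordConnected_Ioo
  have hκ : ∀ t ∈ s', 0 < κ₀ - lam * |t - t₀| := by
    intro t ht
    have h1 : |t - t₀| < κ₀ / lam := abs_sub_lt_iff.2 ⟨by linarith [ht.2.2], by linarith [ht.2.1]⟩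
    rw [lt_div_iff₀ hlam] at h1
    linarith
  have hκle : ∀ t, κ₀ - lam * |t - t₀| ≤ κ₀ := fun t => by
    have := mul_nonneg hlam.le (abs_nonneg (t - t₀)); linarith
  have ht₀' : t₀ ∈ s' := ⟨ht₀, by constructor <;> linarith [div_pos hκ₀ hlam]⟩
  have hGc : ContinuousOn (fun t => G (u t) - G (v t)) s := by
    refine ContinuousOn.sub ?_ ?_
    · exact hG.continuousOn hC hρm hρ continuous_const (fun _ _ => hκ₀)
        (fun t ht => (hu t ht).continuousAt.continuousWithinAt) hU hUt hud
    · exact hG.continuousOn hC hρm hρ continuous_const (fun _ _ => hκ₀)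
        (fun t ht => (hv t ht).continuousAt.continuousWithinAt) hU hUt hvd
  have hint : ∀ t ∈ s, IntervalIntegrable (fun τ => G (u τ) - G (v τ)) volume t₀ t :=
    fun t ht => (hGc.mono (hs.uIcc_subset ht₀ ht)).intervalIntegrable
  have hdiff : ∀ t ∈ s, u t - v t = ∫ τ in t₀..t, (G (u τ) - G (v τ)) := by
    intro t ht
    rw [intervalIntegral.integral_eq_sub_of_hasDerivAt (f := fun τ => u τ - v τ) ?_ (hint t ht)]
    · simp [h0]
    · intro τ hτ
      have hτs := hs.uIcc_subset ht₀ ht hτ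
      convert! (hu τ hτs).sub (hv τ hτs) using 1
      abel
  have hiter : ∀ n : ℕ, ∃ D : Ω → ℝ≥0∞, Measurable D ∧
      l2 μ D ≤ 2⁻¹ ^ n * (l2 μ U + l2 μ U) ∧
      ∀ t ∈ s', Dom ρ (κ₀ - lam * |t - t₀|) (u t - v t) D := by
    intro n
    induction n with
    | zero =>
      refine ⟨fun x => U x + U x, hU.add hU, ?_, fun t ht => ?_⟩
      · simpa using l2_add_le hU.aemeasurable hU.aemeasurable
      · exact ((hud t ht.1).sub (hvd t ht.1)).mono hρ (hκle t) fun _ => le_rfl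
    | succ n ih =>
      obtain ⟨D, hDm, hDle, hD⟩ := ih
      have hDt : l2 μ D ≠ ∞ := by
        refine (hDle.trans_lt (ENNReal.mul_lt_top ?_ ?_)).ne
        · exact ENNReal.pow_lt_top (by simp)
        · exact ENNReal.add_lt_top.2 ⟨hUt.lt_top, hUt.lt_top⟩
      obtain ⟨M, hM⟩ := hG U U D
      obtain ⟨hMm, hMle, hM⟩ := hM hU hU hDm hUt hUt hDt
      refine ⟨fun x => ENNReal.ofReal lam⁻¹ * M x, hMm.const_mul _, ?_, fun t ht => ?_⟩
      · rw [l2_const_mul _ hMm.aemeasurable]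
        calc ENNReal.ofReal lam⁻¹ * l2 μ M
            ≤ ENNReal.ofReal lam⁻¹ * (C * (1 + l2 μ U + l2 μ U) * l2 μ D) := by gcongr
          _ = ENNReal.ofReal lam⁻¹ * (C * (1 + l2 μ U + l2 μ U)) * l2 μ D := by ring
          _ ≤ 2⁻¹ * (2⁻¹ ^ n * (l2 μ U + l2 μ U)) := by gcongr
          _ = _ := by ring
      · rw [hdiff t ht.1]
        refine dom_integral hρm hρ hlam hMm (hint t ht.1) fun τ hτ => ?_
        have hτ' : τ ∈ s' := hs'o.uIcc_subset ht₀' ht (Set.uIoc_subset_uIcc hτ)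
        exact hM _ (hκ τ hτ') _ _ ((hud τ hτ'.1).mono hρ (hκle τ) fun _ => le_rfl)
          ((hvd τ hτ'.1).mono hρ (hκle τ) fun _ => le_rfl) (hD τ hτ')
  intro t ht htε
  have ht' : t ∈ s' := ⟨ht, by
    have := abs_sub_lt_iff.1 htε
    constructor <;> linarith [this.1, this.2]⟩
  have hle : ∀ n : ℕ, ‖u t - v t‖ₑ ≤ 2⁻¹ ^ n * (l2 μ U + l2 μ U) := by
    intro n
    obtain ⟨D, hDm, hDle, hD⟩ := hiter n
    exact ((hD t ht').enorm_le hρ (hκ t ht').le).trans hDle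
  have h00 : ‖u t - v t‖ₑ ≤ 0 :=
    ge_of_tendsto (half_pow_mul_tendsto (ENNReal.add_ne_top.2 ⟨hUt, hUt⟩))
      (Eventually.of_forall hle)
  exact sub_eq_zero.1 (enorm_eq_zero.1 (le_zero_iff.1 h00))

end MajorantODE

/-! ### Picard iteration with majorants. -/

section MajorantExistence

variable {Ω : Type*} [MeasurableSpace Ω] {μ : Measure Ω} {ρ : Ω → ℝ}

theorem hasDerivAt_primitive {E : Type*} [NormedAddCommGroup E] [NormedSpace ℝ E] [CompleteSpace E]
    {f : ℝ → E} {r : ℝ} (hr : 0 < r) (hf : ContinuousOn f (Set.Ioo (-r) r)) {t : ℝ}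
    (ht : t ∈ Set.Ioo (-r) r) : HasDerivAt (fun t => ∫ τ in (0 : ℝ)..t, f τ) (f t) t := by
  have h0 : (0 : ℝ) ∈ Set.Ioo (-r) r := ⟨by linarith, hr⟩
  exact intervalIntegral.integral_hasDerivAt_right
    (hf.mono (Set.ordConnected_Ioo.uIcc_subset h0 ht)).intervalIntegrable
    (hf.stronglyMeasurableAtFilter isOpen_Ioo t ht) (hf.continuousAt (isOpen_Ioo.mem_nhds ht))

/-- Successive Picard increments are dominated by functions `D n` whose norms decrease
geometrically, and the iterates by the partial sums `U n` of the `D n`. The full sum, of norm at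
most `1`, dominates all iterates and the limit. The constant `3` is `1 + ‖U‖ + ‖V‖` for majorants in
the unit ball, and `λ r` is the initial rate, exhausted at `|t| = r`. -/
theorem MajorantLip.exists_solution [SigmaFinite μ] {C : ℝ≥0∞} (hC : C ≠ ∞)
    {G : Lp ℂ 2 μ → Lp ℂ 2 μ} (hG : MajorantLip ρ C G) (hG0 : G 0 = 0) (hρm : Measurable ρ)
    (hρ : ∀ x, 1 ≤ ρ x) {lam r : ℝ} (hlam : 0 < lam) (hr : 0 < r)
    (hlamC : ENNReal.ofReal lam⁻¹ * (C * 3) ≤ 2⁻¹) {H H₁ : ℝ → Lp ℂ 2 μ} {B : ℝ}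
    (hH₁ : ContinuousOn H₁ (Set.Icc (-r) r)) (hB : ∀ t ∈ Set.Icc (-r) r, ‖H₁ t‖ ≤ B)
    (hBr : B * (2 * r) ≤ 1 / 2) (hH : ContinuousOn H (Set.Icc (-r) r))
    (hHH₁ : ∀ t ∈ Set.Icc (-r) r, ∀ᵐ x ∂μ,
      ‖H t x‖ₑ ≤ ENNReal.ofReal (Real.exp (-(lam * r) * ρ x)) * ‖H₁ t x‖ₑ) :
    ∃ u : ℝ → Lp ℂ 2 μ, u 0 = 0 ∧
      (∀ t ∈ Set.Ioo (-r) r, HasDerivAt u (G (u t) + H t) t) ∧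
      ContinuousOn (fun t => G (u t)) (Set.Ioo (-r) r) ∧
      ∃ U : Ω → ℝ≥0∞, Measurable U ∧ l2 μ U ≠ ∞ ∧
        ∀ t ∈ Set.Ioo (-r) r, Dom ρ (lam * (r - |t|)) (u t) U := by
  set I : Set ℝ := Set.Ioo (-r) r with hI
  have h0I : (0 : ℝ) ∈ I := ⟨by linarith, hr⟩
  have hIcc : I ⊆ Set.Icc (-r) r := Set.Ioo_subset_Icc_self
  have hIo : I.OrdConnected := Set.ordConnected_Ioo
  -- The term `t - 0` keeps the shape required by `dom_integral` with base point `0`.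
  set κ : ℝ → ℝ := fun t => lam * r - lam * |t - 0| with hκdef
  have hκc : Continuous κ := by fun_prop
  have hκ : ∀ t ∈ I, 0 < κ t := by
    intro t ht
    have : |t| < r := abs_lt.2 ht
    simp only [hκdef, sub_zero]
    nlinarith
  have hκr : ∀ t, κ t ≤ lam * r := fun t => by
    have := mul_nonneg hlam.le (abs_nonneg (t - 0))
    simp only [hκdef]; linarith
  obtain ⟨D₀, hD₀m, hD₀le, hD₀⟩ := exists_majorant_integral (by linarith : -r ≤ r) hH₁ hB
  have hD₀l : l2 μ D₀ ≤ 2⁻¹ := by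
    refine hD₀le.trans ?_
    have : (2⁻¹ : ℝ≥0∞) = ENNReal.ofReal 2⁻¹ := by
      rw [ENNReal.ofReal_inv_of_pos (by norm_num)]; simp
    rw [this]
    refine ENNReal.ofReal_le_ofReal ?_
    linarith
  have hD₀d : ∀ t ∈ I, Dom ρ (κ t) (∫ τ in (0 : ℝ)..t, H τ) D₀ := by
    intro t ht
    have h1 : Dom ρ (lam * r) (∫ τ in (0 : ℝ)..t, H τ) D₀ := by
      refine hD₀ H (fun x => Real.exp (-(lam * r) * ρ x))
        (Real.measurable_exp.comp (hρm.const_mul _)) (fun x => (Real.exp_pos _).le)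
        (fun x => Real.exp_le_one_iff.2 ?_) hH hHH₁ 0 (hIcc h0I) t (hIcc ht)
      have := mul_nonneg (mul_pos hlam hr).le (zero_le_one.trans (hρ x))
      linarith
    exact h1.mono hρ (hκr t) fun _ => le_rfl
  -- In `MajorantLip` the function `M` comes before the hypotheses on `U`, `V`, `D`, so the choice
  -- is a plain function of the three and can be used in a recursion.
  choose Mf hMf using hG
  let P : ℕ → (Ω → ℝ≥0∞) × (Ω → ℝ≥0∞) := fun n => Nat.rec (fun _ => 0, D₀)
    (fun _ p => (fun x => p.1 x + p.2 x,
      fun x => ENNReal.ofReal lam⁻¹ * Mf (fun x => p.1 x + p.2 x) p.1 p.2 x)) n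
  set U : ℕ → Ω → ℝ≥0∞ := fun n => (P n).1 with hUdef
  set D : ℕ → Ω → ℝ≥0∞ := fun n => (P n).2 with hDdef
  have hU0 : U 0 = fun _ => 0 := rfl
  have hD0 : D 0 = D₀ := rfl
  have hUs : ∀ n, U (n + 1) = fun x => U n x + D n x := fun n => rfl
  have hDs : ∀ n, D (n + 1) = fun x => ENNReal.ofReal lam⁻¹ * Mf (U (n + 1)) (U n) (D n) x :=
    fun n => rfl
  let u : ℕ → ℝ → Lp ℂ 2 μ := fun n => Nat.rec (fun _ => 0)
    (fun _ v t => ∫ τ in (0 : ℝ)..t, (G (v τ) + H τ)) n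
  have hu0 : ∀ t, u 0 t = 0 := fun t => rfl
  have hus : ∀ n t, u (n + 1) t = ∫ τ in (0 : ℝ)..t, (G (u n τ) + H τ) := fun n t => rfl
  have hGU : MajorantLip ρ C G := fun U V D => ⟨Mf U V D, hMf U V D⟩
  -- The bound on `‖U n‖ + 2‖D n‖` is stable because `U (n + 1)` is `U n + D n` and `‖D (n + 1)‖ ≤
  -- ‖D n‖ / 2`. It keeps `‖U n‖ ≤ 1`, hence the Lipschitz constant below `3 C`.
  have inv : ∀ n, (Measurable (U n) ∧ Measurable (D n) ∧ l2 μ (U n) + 2 * l2 μ (D n) ≤ 1 ∧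
      l2 μ (D n) ≤ 2⁻¹ * 2⁻¹ ^ n) ∧ ContinuousOn (u n) I ∧ ContinuousOn (u (n + 1)) I ∧
      (∀ t ∈ I, Dom ρ (κ t) (u n t) (U n)) ∧
      ∀ t ∈ I, Dom ρ (κ t) (u (n + 1) t - u n t) (D n) := by
    intro n
    induction n with
    | zero =>
      have hu1 : ∀ t, u 1 t = ∫ τ in (0 : ℝ)..t, H τ := fun t => by
        refine (hus 0 t).trans ?_
        simp only [hu0, hG0, zero_add]
      refine ⟨⟨?_, hD₀m, ?_, ?_⟩, ?_, ?_, ?_, ?_⟩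
      · rw [hU0]; exact measurable_const
      · rw [hU0, hD0]
        have : l2 μ (fun _ : Ω => (0 : ℝ≥0∞)) = 0 := by simp [l2]
        rw [this, zero_add]
        refine (mul_le_mul' le_rfl hD₀l).trans ?_
        rw [ENNReal.mul_inv_cancel (by norm_num) (by norm_num)]
      · simpa [hD0] using hD₀l
      · exact continuousOn_const
      · intro t ht
        have := (hasDerivAt_primitive hr (hH.mono hIcc) ht).continuousAt
        refine ContinuousAt.continuousWithinAt ?_
        have h2 : u (0 + 1) = fun t => ∫ τ in (0 : ℝ)..t, H τ := funext hu1
        rw [h2]; exact this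
      · exact fun t _ => dom_zero
      · intro t ht
        rw [hu0, sub_zero, zero_add, hu1]
        exact hD₀d t ht
    | succ n ih =>
      obtain ⟨⟨hUm, hDm, hUD, hDl⟩, huc, huc', hud, hudd⟩ := ih
      have hUl : l2 μ (U n) ≤ 1 := le_self_add.trans hUD
      have hDl1 : l2 μ (D n) ≤ 1 := by
        refine le_trans ?_ (le_add_self.trans hUD)
        rw [two_mul]; exact le_self_add
      have hUm' : Measurable (U (n + 1)) := by rw [hUs]; exact hUm.add hDm
      have hUl' : l2 μ (U (n + 1)) ≤ l2 μ (U n) + l2 μ (D n) := by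
        rw [hUs]; exact l2_add_le hUm.aemeasurable hDm.aemeasurable
      have hUl1' : l2 μ (U (n + 1)) ≤ 1 := by
        refine hUl'.trans (le_trans ?_ hUD)
        rw [two_mul]; gcongr; exact le_self_add
      have hUt : l2 μ (U n) ≠ ∞ := (hUl.trans_lt ENNReal.one_lt_top).ne
      have hUt' : l2 μ (U (n + 1)) ≠ ∞ := (hUl1'.trans_lt ENNReal.one_lt_top).ne
      have hDt : l2 μ (D n) ≠ ∞ := (hDl1.trans_lt ENNReal.one_lt_top).ne
      obtain ⟨hMm, hMl, hM⟩ := hMf (U (n + 1)) (U n) (D n) hUm' hUm hDm hUt' hUt hDt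
      have hud' : ∀ t ∈ I, Dom ρ (κ t) (u (n + 1) t) (U (n + 1)) := by
        intro t ht
        have := (hud t ht).add (hudd t ht)
        rwa [add_sub_cancel] at this
      have hGc : ContinuousOn (fun t => G (u n t)) I :=
        hGU.continuousOn hC hρm hρ hκc hκ huc hUm hUt hud
      have hGc' : ContinuousOn (fun t => G (u (n + 1) t)) I :=
        hGU.continuousOn hC hρm hρ hκc hκ huc' hUm' hUt' hud'
      have hDle : l2 μ (D (n + 1)) ≤ 2⁻¹ * l2 μ (D n) := by
        rw [hDs, l2_const_mul _ hMm.aemeasurable]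
        have h3 : 1 + l2 μ (U (n + 1)) + l2 μ (U n) ≤ 3 := by
          calc _ ≤ (1 : ℝ≥0∞) + 1 + 1 := by gcongr
            _ = 3 := by norm_num
        calc ENNReal.ofReal lam⁻¹ * l2 μ (Mf (U (n + 1)) (U n) (D n))
            ≤ ENNReal.ofReal lam⁻¹ * (C * 3 * l2 μ (D n)) := by
              gcongr
              exact hMl.trans (by gcongr)
          _ = ENNReal.ofReal lam⁻¹ * (C * 3) * l2 μ (D n) := by ring
          _ ≤ _ := by gcongr
      refine ⟨⟨hUm', ?_, ?_, ?_⟩, huc', ?_, hud', ?_⟩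
      · rw [hDs]; exact hMm.const_mul _
      · refine le_trans (add_le_add hUl' (mul_le_mul' le_rfl hDle)) (le_trans (le_of_eq ?_) hUD)
        rw [← mul_assoc, ENNReal.mul_inv_cancel (by norm_num) (by norm_num)]
        ring
      · refine hDle.trans ((mul_le_mul' le_rfl hDl).trans (le_of_eq ?_))
        rw [pow_succ]; ring
      · intro t ht
        exact (hasDerivAt_primitive hr (hGc'.add (hH.mono hIcc)) ht).continuousAt.continuousWithinAt
      · intro t ht
        have hsub := hIo.uIcc_subset h0I ht
        have hi := ((hGc.add (hH.mono hIcc)).mono hsub).intervalIntegrable (μ := volume)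
        have hi' := ((hGc'.add (hH.mono hIcc)).mono hsub).intervalIntegrable (μ := volume)
        have hEq : u (n + 1 + 1) t - u (n + 1) t =
            ∫ τ in (0 : ℝ)..t, (G (u (n + 1) τ) - G (u n τ)) := by
          rw [hus (n + 1), hus n]
          refine (intervalIntegral.integral_sub hi' hi).symm.trans ?_
          refine intervalIntegral.integral_congr fun τ _ => ?_
          simp
        rw [hEq, hDs]
        refine dom_integral hρm hρ hlam hMm
          ((hGc'.sub hGc).mono hsub).intervalIntegrable fun τ hτ => ?_
        have hτI : τ ∈ I := hsub (Set.uIoc_subset_uIcc hτ)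
        exact hM _ (hκ τ hτI) _ _ (hud' τ hτI) (hud τ hτI) (hudd τ hτI)
  set V : Ω → ℝ≥0∞ := fun x => ∑' n, D n x with hV
  have hVm : Measurable V := Measurable.tsum fun n => (inv n).1.2.1
  have hVl : l2 μ V ≤ 1 := by
    refine (l2_tsum_le fun n => (inv n).1.2.1).trans ?_
    refine (ENNReal.tsum_le_tsum fun n => (inv n).1.2.2.2).trans ?_
    rw [ENNReal.tsum_mul_left, ENNReal.tsum_geometric, ENNReal.one_sub_inv_two, inv_inv,
      ENNReal.inv_mul_cancel (by norm_num) (by norm_num)]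
  have hVt : l2 μ V ≠ ∞ := (hVl.trans_lt ENNReal.one_lt_top).ne
  have hUsum : ∀ n, U n = fun x => ∑ j ∈ Finset.range n, D j x := by
    intro n
    induction n with
    | zero => rw [hU0]; simp
    | succ n ih => rw [hUs, ih]; simp [Finset.sum_range_succ]
  have hUV : ∀ n x, U n x ≤ V x := fun n x => by
    rw [hUsum]; exact ENNReal.sum_le_tsum _
  have hdom : ∀ n, ∀ t ∈ I, Dom ρ (κ t) (u n t) V := fun n t ht =>
    ((inv n).2.2.2.1 t ht).mono hρ le_rfl (hUV n)
  have hed : ∀ t ∈ I, ∀ n, edist (u n t) (u (n + 1) t) ≤ 1 * 2⁻¹ ^ n := by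
    intro t ht n
    rw [edist_comm, edist_eq_enorm_sub, one_mul]
    refine (((inv n).2.2.2.2 t ht).enorm_le hρ (hκ t ht).le).trans ((inv n).1.2.2.2.trans ?_)
    exact mul_le_of_le_one_left' (by norm_num)
  have hhalf : (2⁻¹ : ℝ≥0∞) < 1 := by simp [ENNReal.inv_lt_one]
  have hlim : ∀ t, ∃ v : Lp ℂ 2 μ, t ∈ I → Tendsto (fun n => u n t) atTop (𝓝 v) := by
    intro t
    by_cases ht : t ∈ I
    · obtain ⟨v, hv⟩ := cauchySeq_tendsto_of_complete
        (cauchySeq_of_edist_le_geometric _ _ hhalf (by simp) (hed t ht))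
      exact ⟨v, fun _ => hv⟩
    · exact ⟨0, fun h => absurd h ht⟩
  choose w hw using hlim
  have hwc : ContinuousOn w I := by
    have hunif : TendstoUniformlyOn u w atTop I := by
      rw [EMetric.tendstoUniformlyOn_iff]
      intro ε hε
      have h1 : Tendsto (fun n : ℕ => (2⁻¹ : ℝ≥0∞) ^ n * 2) atTop (𝓝 0) :=
        half_pow_mul_tendsto (by norm_num)
      filter_upwards [h1.eventually (gt_mem_nhds hε)] with n hn t ht
      rw [edist_comm]
      refine (edist_le_of_edist_le_geometric_of_tendsto 2⁻¹ 1 (hed t ht) (hw t ht) n).trans_lt ?_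
      refine lt_of_le_of_lt (le_of_eq ?_) hn
      rw [ENNReal.one_sub_inv_two, ENNReal.div_eq_inv_mul, inv_inv]; ring
    exact hunif.continuousOn (Frequently.of_forall fun n => (inv n).2.1)
  have hwd : ∀ t ∈ I, Dom ρ (κ t) (w t) V := fun t ht =>
    dom_of_tendsto (fun n => hdom n t ht) (hw t ht)
  have hGw : ContinuousOn (fun t => G (w t)) I :=
    hGU.continuousOn hC hρm hρ hκc hκ hwc hVm hVt hwd
  have heq : ∀ t ∈ I, w t = ∫ τ in (0 : ℝ)..t, (G (w τ) + H τ) := by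
    intro t ht
    have hsub := hIo.uIcc_subset h0I ht
    refine tendsto_nhds_unique ((tendsto_add_atTop_iff_nat 1).2 (hw t ht)) ?_
    simp only [hus]
    -- On the compact interval between `0` and `t` the rate is bounded below. This makes `G (u n τ)`
    -- bounded uniformly in `n` and `τ`, as dominated convergence requires.
    obtain ⟨κ₁, hκ₁, hκ₁le⟩ : ∃ κ₁ > 0, ∀ τ ∈ Set.uIcc 0 t, κ₁ ≤ κ τ := by
      obtain ⟨τ₁, hτ₁, hmin⟩ := isCompact_uIcc.exists_isMinOn (Set.nonempty_uIcc (a := 0) (b := t))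
        hκc.continuousOn
      exact ⟨κ τ₁, hκ τ₁ (hsub hτ₁), fun τ hτ => hmin hτ⟩
    have hbd : ∃ K : ℝ, ∀ n, ∀ τ ∈ Set.uIcc 0 t, ‖G (u n τ)‖ ≤ K := by
      set K : ℝ≥0∞ := ENNReal.ofReal (κ₁ / 2)⁻¹ * (C * (1 + l2 μ V + l2 μ V) *
        (2 * l2 μ V * l2 μ V) ^ (1 / 2 : ℝ)) with hK
      have hKt : K ≠ ∞ := by
        refine ENNReal.mul_ne_top ENNReal.ofReal_ne_top (ENNReal.mul_ne_top
          (ENNReal.mul_ne_top hC (by simp [hVt])) ?_)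
        exact ENNReal.rpow_ne_top_of_nonneg (by norm_num)
          (ENNReal.mul_ne_top (ENNReal.mul_ne_top (by norm_num) hVt) hVt)
      refine ⟨K.toReal, fun n τ hτ => ?_⟩
      have hd := (hdom n τ (hsub hτ)).mono hρ (hκ₁le τ hτ) fun _ => le_rfl
      have h1 := hGU.enorm_sub_le hρm hρ hκ₁ hVm hVt hd dom_zero
      rw [hG0, sub_zero, sub_zero] at h1
      have h2 : ‖G (u n τ)‖ₑ ≤ K := h1.trans (by
        rw [hK]; gcongr; exact hd.enorm_le hρ hκ₁.le)
      rw [← toReal_enorm]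
      exact ENNReal.toReal_mono hKt h2
    obtain ⟨K, hK⟩ := hbd
    have hHb : ∃ K' : ℝ, ∀ τ ∈ Set.uIcc 0 t, ‖H τ‖ ≤ K' :=
      isCompact_uIcc.exists_bound_of_continuousOn (hH.mono (hsub.trans hIcc))
    obtain ⟨K', hK'⟩ := hHb
    refine intervalIntegral.tendsto_integral_filter_of_dominated_convergence (fun _ => K + K')
      ?_ ?_ intervalIntegrable_const ?_
    · refine Eventually.of_forall fun n => ?_
      have hGc : ContinuousOn (fun t => G (u n t)) I :=
        hGU.continuousOn hC hρm hρ hκc hκ (inv n).2.1 hVm hVt (hdom n)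
      exact ((hGc.add (hH.mono hIcc)).mono
        (Set.uIoc_subset_uIcc.trans hsub)).aestronglyMeasurable measurableSet_uIoc
    · refine Eventually.of_forall fun n => Eventually.of_forall fun τ hτ => ?_
      have := Set.uIoc_subset_uIcc hτ
      exact (norm_add_le _ _).trans (add_le_add (hK n τ this) (hK' τ this))
    · refine Eventually.of_forall fun τ hτ => ?_
      have hτI := hsub (Set.uIoc_subset_uIcc hτ)
      exact (hGU.tendsto hC hρm hρ (hκ τ hτI) hVm hVt (Eventually.of_forall fun n => hdom n τ hτI)
        (hwd τ hτI) (hw τ hτI)).add_const _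
  refine ⟨w, ?_, ?_, hGw, V, hVm, hVt, ?_⟩
  · rw [heq 0 h0I, intervalIntegral.integral_same]
  · intro t ht
    have h1 := hasDerivAt_primitive hr (hGw.add (hH.mono hIcc)) ht
    refine h1.congr_of_eventuallyEq ?_
    filter_upwards [isOpen_Ioo.mem_nhds ht] with τ hτ
    exact heq τ hτ
  · intro t ht
    have : lam * (r - |t|) = κ t := by simp only [hκdef, sub_zero]; ring
    rw [this]
    exact hwd t ht

end MajorantExistence

/-! ### Fourier series in `Θ` with coefficients in `L²(ℝ^{d-1})`. -/

section Modes

variable {d : ℕ}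

theorem memLp_tensor (l : ℤ) (f : Lp ℂ 2 (volume : Measure (Tan d))) :
    MemLp (fun z : Tan d × Torus => f z.1 * fourier l z.2) 2 (domMeasure d) := by
  have h := (Lp.memLp f).comp_measurePreserving
    (measurePreserving_fst (μ := (volume : Measure (Tan d))) (ν := AddCircle.haarAddCircle
      (T := 2 * Real.pi)))
  refine MemLp.of_le h ?_ (Eventually.of_forall fun z => ?_)
  · exact h.1.mul ((fourier l).continuous.comp continuous_snd).aestronglyMeasurable
  · rw [norm_mul, fourier_apply, Circle.norm_coe, mul_one]; rfl

theorem norm_tensor (l : ℤ) (f : Lp ℂ 2 (volume : Measure (Tan d))) :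
    ‖(memLp_tensor l f).toLp _‖ = ‖f‖ := by
  have h := measurePreserving_fst (μ := (volume : Measure (Tan d))) (ν := AddCircle.haarAddCircle
      (T := 2 * Real.pi))
  rw [Lp.norm_toLp, Lp.norm_def, ← eLpNorm_comp_measurePreserving (Lp.aestronglyMeasurable f) h]
  congr 1
  refine eLpNorm_congr_norm_ae (Eventually.of_forall fun z => ?_)
  rw [norm_mul, fourier_apply, Circle.norm_coe, mul_one]; rfl

/-- The isometry `f ↦ f(y) e^{ilΘ}`. -/
def tensor (l : ℤ) : Lp ℂ 2 (volume : Measure (Tan d)) →ₗᵢ[ℂ] L2 d where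
  toFun f := (memLp_tensor l f).toLp _
  map_add' f g := by
    rw [← MemLp.toLp_add]
    refine MemLp.toLp_congr _ _ ?_
    have h := (measurePreserving_fst (μ := (volume : Measure (Tan d))) (ν := AddCircle.haarAddCircle
      (T := 2 * Real.pi))).quasiMeasurePreserving.ae (Lp.coeFn_add f g)
    filter_upwards [h] with z hz
    rw [hz]; simp [add_mul]
  map_smul' c f := by
    rw [RingHom.id_apply, ← MemLp.toLp_const_smul]
    refine MemLp.toLp_congr _ _ ?_
    have h := (measurePreserving_fst (μ := (volume : Measure (Tan d))) (ν := AddCircle.haarAddCircle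
      (T := 2 * Real.pi))).quasiMeasurePreserving.ae (Lp.coeFn_smul c f)
    filter_upwards [h] with z hz
    rw [hz]; simp [mul_assoc]
  norm_map' f := norm_tensor l f

theorem coeFn_tensor (l : ℤ) (f : Lp ℂ 2 (volume : Measure (Tan d))) :
    ∀ᵐ z ∂domMeasure d, tensor l f z = f z.1 * fourier l z.2 :=
  (memLp_tensor l f).coeFn_toLp

/-- Fubini. Extraction of a mode is thus the adjoint of the isometry `tensor l`, from which its
linearity and continuity follow. -/
theorem inner_mode (u : L2 d) (l : ℤ) (f : Lp ℂ 2 (volume : Measure (Tan d))) :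
    (inner ℂ f (mode u l) : ℂ) = inner ℂ (tensor l f) u := by
  rw [L2.inner_def, L2.inner_def]
  have h1 : ∀ᵐ z ∂domMeasure d, (inner ℂ (tensor l f z) (u z) : ℂ) =
      fourier (-l) z.2 • u z * (starRingEnd ℂ) (f z.1) := by
    filter_upwards [coeFn_tensor l f] with z hz
    rw [hz, RCLike.inner_apply, map_mul, fourier_neg, smul_eq_mul]
    ring
  rw [integral_congr_ae h1, integral_prod _ ((integrable_congr h1).1 (L2.integrable_inner _ _))]
  refine integral_congr_ae ?_
  filter_upwards [(memLp_modeFun u l).coeFn_toLp] with y hy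
  rw [integral_mul_const, RCLike.inner_apply, mode, hy]
  rfl

/-- The map `u ↦ u_l` as a continuous linear map. -/
def modeL (l : ℤ) : L2 d →L[ℂ] Lp ℂ 2 (volume : Measure (Tan d)) :=
  ContinuousLinearMap.adjoint (tensor l).toContinuousLinearMap

theorem modeL_apply (l : ℤ) (u : L2 d) : modeL l u = mode u l := by
  refine ext_inner_left ℂ fun f => ?_
  rw [inner_mode, modeL, ContinuousLinearMap.adjoint_inner_right]
  rfl

theorem mode_tensor (l l' : ℤ) (f : Lp ℂ 2 (volume : Measure (Tan d))) :
    mode (tensor l' f) l = if l = l' then f else 0 := by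
  have h1 : ∀ᵐ y : Tan d, modeFun (tensor l' f) l y = if l = l' then f y else 0 := by
    filter_upwards [Measure.ae_ae_of_ae_prod (coeFn_tensor l' f)] with y hy
    have h2 : (fun θ : Torus => tensor l' f (y, θ)) =ᵐ[AddCircle.haarAddCircle]
        fun θ => f y * fourier l' θ := hy
    rw [modeFun, fourierCoeff_congr_ae h2, fourierCoeff.const_mul]
    have h3 := congrFun (fourierCoeff_fourier (T := 2 * Real.pi) l') l
    rw [h3, Pi.single_apply]
    split_ifs <;> simp
  refine Lp.ext ?_
  filter_upwards [h1, (memLp_modeFun (tensor l' f) l).coeFn_toLp, Lp.coeFn_zero ℂ 2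
    (volume : Measure (Tan d))] with y hy hy2 hy3
  rw [mode, hy2, hy]
  split_ifs
  · rfl
  · rw [hy3]; rfl

/-- For almost every `y`, completeness of the Fourier basis applies to the slice of `u` at `y`. -/
theorem eq_zero_of_mode {u : L2 d} (h : ∀ l, mode u l = 0) : u = 0 := by
  have hu : MemLp (u : Tan d × Torus → ℂ) 2 (domMeasure d) := Lp.memLp u
  have hsq : Integrable (fun z => ‖u z‖ ^ 2) (domMeasure d) :=
    (memLp_two_iff_integrable_sq_norm hu.1).1 hu
  have h1 : ∀ᵐ y : Tan d, ∀ l : ℤ, modeFun u l y = 0 := by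
    refine ae_all_iff.2 fun l => ?_
    filter_upwards [(memLp_modeFun u l).coeFn_toLp, Lp.coeFn_zero ℂ 2
      (volume : Measure (Tan d))] with y hy hy0
    rw [← hy]
    change mode u l y = 0
    rw [h l, hy0]; rfl
  have h2 : ∀ᵐ y : Tan d, ∀ᵐ θ ∂(AddCircle.haarAddCircle (T := 2 * Real.pi)), u (y, θ) = 0 := by
    filter_upwards [h1, hsq.prod_right_ae, hu.1.prodMk_left] with y hy hy2 hym
    have hL2 : MemLp (fun θ : Torus => u (y, θ)) 2 AddCircle.haarAddCircle :=
      (memLp_two_iff_integrable_sq_norm hym).2 hy2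
    have h3 : hL2.toLp _ = 0 := by
      refine (fourierBasis (T := 2 * Real.pi)).repr.injective ?_
      ext l
      rw [fourierBasis_repr, fourierCoeff_congr_ae hL2.coeFn_toLp, map_zero]
      exact hy l
    have h4 := hL2.coeFn_toLp
    rw [h3] at h4
    filter_upwards [h4, Lp.coeFn_zero ℂ 2 (AddCircle.haarAddCircle (T := 2 * Real.pi))]
      with θ hθ hθ0
    rw [← hθ, hθ0]; rfl
  refine Lp.ext ?_
  have h5 : ∫⁻ z, ‖u z‖ₑ ∂domMeasure d = 0 := by
    rw [lintegral_prod _ (measurable_enorm_coe u).aemeasurable]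
    refine (lintegral_congr_ae ?_).trans lintegral_zero
    filter_upwards [h2] with y hy
    refine (lintegral_congr_ae ?_).trans lintegral_zero
    filter_upwards [hy] with θ hθ
    rw [hθ, enorm_zero]
  rw [lintegral_eq_zero_iff (measurable_enorm_coe u)] at h5
  filter_upwards [h5, Lp.coeFn_zero ℂ 2 (domMeasure d)] with z hz hz0
  rw [hz0]
  simpa using hz

theorem eq_of_mode {u v : L2 d} (h : ∀ l, mode u l = mode v l) : u = v := by
  refine sub_eq_zero.1 (eq_zero_of_mode fun l => ?_)
  rw [← modeL_apply, map_sub, modeL_apply, modeL_apply, h, sub_self]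

/-- The ranges of the isometries `tensor l` are pairwise orthogonal, so the series of the `tensor l
(g l)` converges as soon as the squared norms are summable. -/
theorem exists_mode_eq (g : ℤ → Lp ℂ 2 (volume : Measure (Tan d)))
    (hg : Summable fun l => ‖g l‖ ^ 2) : ∃ u : L2 d, ∀ l, mode u l = g l := by
  have horth : OrthogonalFamily ℂ (fun _ : ℤ => Lp ℂ 2 (volume : Measure (Tan d)))
      (fun l => tensor l) := by
    intro l l' hl f f'
    rw [← inner_mode, mode_tensor, if_neg hl, inner_zero_right]
  have hs := (horth.summable_iff_norm_sq_summable g).2 hg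
  refine ⟨∑' l, tensor l (g l), fun l => ?_⟩
  rw [← modeL_apply, ContinuousLinearMap.map_tsum _ hs, tsum_eq_single l]
  · rw [modeL_apply, mode_tensor, if_pos rfl]
  · intro l' hl'
    rw [modeL_apply, mode_tensor, if_neg (Ne.symm hl')]

end Modes

/-! ### Dilations of the frequency variable. -/

section Scaling

variable {V : Type*} [NormedAddCommGroup V] [InnerProductSpace ℝ V] [FiniteDimensional ℝ V]
  [MeasurableSpace V] [BorelSpace V]

theorem lintegral_comp_smul {r : ℝ} (hr : r ≠ 0) {f : V → ℝ≥0∞} (hf : Measurable f) :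
    ∫⁻ x, f (r • x) = ENNReal.ofReal |(r ^ Module.finrank ℝ V)⁻¹| * ∫⁻ x, f x := by
  rw [← lintegral_map hf (measurable_const_smul r), Measure.map_addHaar_smul _ hr,
    lintegral_smul_measure, smul_eq_mul]

theorem ae_comp_smul {r : ℝ} (hr : r ≠ 0) {p : V → Prop} (h : ∀ᵐ x : V, p x) :
    ∀ᵐ x : V, p (r • x) :=
  (Measure.quasiMeasurePreserving_smul volume hr).ae h

end Scaling

/-! ### The partial Fourier transform: linearity, injectivity, surjectivity. -/

section Hat

variable {d : ℕ}

theorem two_pi_inv_ne_zero : (2 * Real.pi)⁻¹ ≠ 0 := inv_ne_zero Real.two_pi_pos.ne'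

theorem measurable_hat (u : L2 d) (l : ℤ) : Measurable (hat u l) :=
  (Lp.stronglyMeasurable (𝓕 (mode u l) : Lp ℂ 2 (volume : Measure (Tan d)))).measurable.comp
    (measurable_const_smul _)

theorem hat_add (u v : L2 d) (l : ℤ) : ∀ᵐ ξ : Tan d, hat (u + v) l ξ = hat u l ξ + hat v l ξ := by
  have h1 : mode (u + v) l = mode u l + mode v l := by
    simp only [← modeL_apply, map_add]
  have h2 : ∀ᵐ x : Tan d, (𝓕 (mode (u + v) l) : Lp ℂ 2 (volume : Measure (Tan d))) x =
      (𝓕 (mode u l) : Lp ℂ 2 (volume : Measure (Tan d))) x +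
      (𝓕 (mode v l) : Lp ℂ 2 (volume : Measure (Tan d))) x := by
    rw [h1, FourierTransform.fourier_add]
    exact Lp.coeFn_add _ _
  exact ae_comp_smul two_pi_inv_ne_zero h2

theorem hat_smul (c : ℂ) (u : L2 d) (l : ℤ) : ∀ᵐ ξ : Tan d, hat (c • u) l ξ = c * hat u l ξ := by
  have h1 : mode (c • u) l = c • mode u l := by
    simp only [← modeL_apply, map_smul]
  have h2 : ∀ᵐ x : Tan d, (𝓕 (mode (c • u) l) : Lp ℂ 2 (volume : Measure (Tan d))) x =
      c * (𝓕 (mode u l) : Lp ℂ 2 (volume : Measure (Tan d))) x := by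
    rw [h1, FourierTransform.fourier_smul]
    exact Lp.coeFn_smul _ _
  exact ae_comp_smul two_pi_inv_ne_zero h2

theorem hat_neg (u : L2 d) (l : ℤ) : ∀ᵐ ξ : Tan d, hat (-u) l ξ = -hat u l ξ := by
  have := hat_smul (-1) u l
  simpa using this

theorem hat_sub (u v : L2 d) (l : ℤ) : ∀ᵐ ξ : Tan d, hat (u - v) l ξ = hat u l ξ - hat v l ξ := by
  filter_upwards [hat_add u (-v) l, hat_neg v l] with ξ h1 h2
  rw [sub_eq_add_neg, h1, h2, sub_eq_add_neg]

theorem hat_zero (l : ℤ) : ∀ᵐ ξ : Tan d, hat (0 : L2 d) l ξ = 0 := by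
  have := hat_smul 0 (0 : L2 d) l
  simpa using this

theorem hat_sum {ι : Type*} (s : Finset ι) (u : ι → L2 d) (l : ℤ) :
    ∀ᵐ ξ : Tan d, hat (∑ i ∈ s, u i) l ξ = ∑ i ∈ s, hat (u i) l ξ := by
  classical
  induction s using Finset.induction_on with
  | empty => simpa using hat_zero l
  | insert i s hi ih =>
    filter_upwards [ih, hat_add (u i) (∑ j ∈ s, u j) l] with ξ h1 h2
    rw [Finset.sum_insert hi, Finset.sum_insert hi, h2, h1]

theorem mode_eq_of_hat {u v : L2 d} {l : ℤ} (h : ∀ᵐ ξ : Tan d, hat u l ξ = hat v l ξ) :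
    mode u l = mode v l := by
  have h1 := ae_comp_smul (V := Tan d) (r := 2 * Real.pi) Real.two_pi_pos.ne' h
  refine (Lp.fourierTransformₗᵢ (Tan d) ℂ).injective (Lp.ext ?_)
  filter_upwards [h1] with x hx
  rw [hat, hat, smul_smul, inv_mul_cancel₀ Real.two_pi_pos.ne', one_smul] at hx
  exact hx

theorem eq_of_hat {u v : L2 d} (h : ∀ l, ∀ᵐ ξ : Tan d, hat u l ξ = hat v l ξ) : u = v :=
  eq_of_mode fun l => mode_eq_of_hat (h l)

/-- Plancherel in `y` and Riesz–Fischer in `Θ`; the dilation by `2π` matches the two conventions for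
the Fourier transform. -/
theorem exists_hat_eq {h : ℤ → Tan d → ℂ} (hm : ∀ l, Measurable (h l))
    (hfin : ∫⁻ ξ, ∑' l, ‖h l ξ‖ₑ ^ 2 ≠ ∞) :
    ∃ u : L2 d, ∀ l, ∀ᵐ ξ : Tan d, hat u l ξ = h l ξ := by
  rw [lintegral_tsum fun l => ((hm l).enorm.pow_const 2).aemeasurable] at hfin
  set c : ℝ≥0∞ := ENNReal.ofReal |((2 * Real.pi) ^ Module.finrank ℝ (Tan d))⁻¹| with hc
  have hsc : ∀ l, ∫⁻ x, ‖h l ((2 * Real.pi) • x)‖ₑ ^ 2 = c * ∫⁻ ξ, ‖h l ξ‖ₑ ^ 2 := fun l =>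
    lintegral_comp_smul (V := Tan d) Real.two_pi_pos.ne' ((hm l).enorm.pow_const 2)
  have hcm : ∀ l, Measurable fun x : Tan d => h l ((2 * Real.pi) • x) := fun l =>
    (hm l).comp (measurable_const_smul _)
  have htot : ∑' l, ∫⁻ x, ‖h l ((2 * Real.pi) • x)‖ₑ ^ 2 ≠ ∞ := by
    simp only [hsc, ENNReal.tsum_mul_left]
    exact ENNReal.mul_ne_top ENNReal.ofReal_ne_top hfin
  have hL : ∀ l, MemLp (fun x : Tan d => h l ((2 * Real.pi) • x)) 2 := fun l => by
    refine memLp_of_l2 (hcm l).aestronglyMeasurable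
      (U := fun x => ‖h l ((2 * Real.pi) • x)‖ₑ) (Eventually.of_forall fun _ => le_rfl) ?_
    refine ENNReal.rpow_ne_top_of_nonneg (by norm_num) ?_
    exact ne_top_of_le_ne_top htot (ENNReal.le_tsum l)
  set g : ℤ → Lp ℂ 2 (volume : Measure (Tan d)) := fun l => (hL l).toLp _ with hg
  have hgn : ∀ l, ‖g l‖ₑ ^ 2 = ∫⁻ x, ‖h l ((2 * Real.pi) • x)‖ₑ ^ 2 := fun l => by
    rw [← l2_enorm_eq, l2_sq]
    refine lintegral_congr_ae ?_
    filter_upwards [(hL l).coeFn_toLp] with x hx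
    rw [hx]
  have hs : Summable fun l => ‖(𝓕⁻ (g l) : Lp ℂ 2 (volume : Measure (Tan d)))‖ ^ 2 := by
    have h1 : ∀ l, ‖(𝓕⁻ (g l) : Lp ℂ 2 (volume : Measure (Tan d)))‖ ^ 2 =
        (∫⁻ x, ‖h l ((2 * Real.pi) • x)‖ₑ ^ 2).toReal := fun l => by
      rw [← hgn, ENNReal.toReal_pow, toReal_enorm]
      congr 1
      exact (Lp.fourierTransformₗᵢ (Tan d) ℂ).symm.norm_map (g l)
    simp only [h1]
    exact ENNReal.summable_toReal htot
  obtain ⟨u, hu⟩ := exists_mode_eq (fun l => 𝓕⁻ (g l)) hs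
  refine ⟨u, fun l => ?_⟩
  have h2 : ∀ᵐ x : Tan d, (𝓕 (mode u l) : Lp ℂ 2 (volume : Measure (Tan d))) x =
      h l ((2 * Real.pi) • x) := by
    rw [hu l, FourierTransform.fourier_fourierInv_eq]
    exact (hL l).coeFn_toLp
  filter_upwards [ae_comp_smul two_pi_inv_ne_zero h2] with ξ hξ
  rw [hat, hξ, smul_smul, mul_inv_cancel₀ Real.two_pi_pos.ne', one_smul]

/-- The operator picks some function with the right transform when there is one, so it suffices to
exhibit one. -/
theorem hat_multiplier {m : ℤ → Tan d → ℂ} (hm : ∀ l, Measurable (m l)) {u : L2 d}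
    (hfin : ∫⁻ ξ, ∑' l, ‖m l ξ * hat u l ξ‖ₑ ^ 2 ≠ ∞) (l : ℤ) :
    ∀ᵐ ξ : Tan d, hat (multiplier m u) l ξ = m l ξ * hat u l ξ := by
  have h := exists_hat_eq (h := fun l ξ => m l ξ * hat u l ξ)
    (fun l => (hm l).mul (measurable_hat u l)) hfin
  rw [multiplier, dif_pos h]
  exact h.choose_spec l

end Hat

/-! ### Fourier inversion and convolution. -/

section FourierInversion

variable {V : Type*} [NormedAddCommGroup V] [InnerProductSpace ℝ V] [FiniteDimensional ℝ V]
  [MeasurableSpace V] [BorelSpace V]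

theorem continuous_fourierInv {g : V → ℂ} (hg : Integrable g) : Continuous (𝓕⁻ g) :=
  VectorFourier.fourierIntegral_continuous (L := -innerₗ V) Real.continuous_fourierChar
    (show Continuous fun p : V × V => -(inner ℝ p.1 p.2 : ℝ) from continuous_inner.neg) hg

theorem integral_fourierInv_smul_eq {f g : V → ℂ} (hf : Integrable f) (hg : Integrable g) :
    ∫ x, 𝓕⁻ f x • g x = ∫ x, f x • 𝓕⁻ g x := by
  have h : (-innerₗ V).flip = -innerₗ V := by
    ext x y
    simp [real_inner_comm]
  have h2 := VectorFourier.integral_fourierIntegral_smul_eq_flip (L := -innerₗ V) (μ := volume)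
    (ν := volume) Real.continuous_fourierChar
    (show Continuous fun p : V × V => -(inner ℝ p.1 p.2 : ℝ) from continuous_inner.neg) hf hg
  rw [h] at h2
  exact h2

/-- The `L²` transform and the integral transform agree as tempered distributions. Testing against
smooth compactly supported functions identifies `f` with the continuous function given by the
inversion integral. -/
theorem coeFn_eq_fourierInv (f : Lp ℂ 2 (volume : Measure V))
    (hf : Integrable (𝓕 f : Lp ℂ 2 (volume : Measure V))) :
    ∀ᵐ x : V, f x = 𝓕⁻ ((𝓕 f : Lp ℂ 2 (volume : Measure V)) : V → ℂ) x := by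
  refine ae_eq_of_integral_contDiff_smul_eq ((Lp.memLp f).locallyIntegrable (by norm_num))
    (continuous_fourierInv hf).locallyIntegrable fun g g_smooth g_cpt => ?_
  have hg₁ : HasCompactSupport (Complex.ofRealCLM ∘ g) := g_cpt.comp_left rfl
  have hg₂ : ContDiff ℝ (↑(⊤ : ℕ∞)) (Complex.ofRealCLM ∘ g) := by fun_prop
  set φ : SchwartzMap V ℂ := hg₁.toSchwartzMap hg₂ with hφ
  have hφx : ∀ x, φ x = (g x : ℂ) := fun x => rfl
  have h1 := Lp.fourierInv_toTemperedDistribution_eq (𝓕 f : Lp ℂ 2 (volume : Measure V))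
  rw [FourierTransform.fourierInv_fourier_eq] at h1
  have h2 := congrArg (fun T => T φ) h1
  simp only [TemperedDistribution.fourierInv_apply, Lp.toTemperedDistribution_apply] at h2
  simp only [SchwartzMap.fourierInv_coe] at h2
  rw [integral_fourierInv_smul_eq φ.integrable hf] at h2
  simpa only [hφx, Complex.coe_smul] using h2.symm

theorem fourierInv_convolution {f g : V → ℂ} (hf : Integrable f) (hg : Integrable g) (x : V) :
    𝓕⁻ (fun y => ∫ t, f t * g (y - t)) x = 𝓕⁻ f x * 𝓕⁻ g x := by
  rw [Real.fourierInv_eq_fourier_neg, Real.fourierInv_eq_fourier_neg,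
    Real.fourierInv_eq_fourier_neg, ← Real.fourier_mul_convolution_eq hf hg]
  rfl

theorem enorm_fourierInv_le (g : V → ℂ) (x : V) : ‖𝓕⁻ g x‖ₑ ≤ ∫⁻ y, ‖g y‖ₑ := by
  rw [Real.fourierInv_eq]
  refine (enorm_integral_le_lintegral_enorm _).trans (le_of_eq ?_)
  refine lintegral_congr fun y => ?_
  rw [← ofReal_norm, Circle.norm_smul, ofReal_norm]

theorem lintegral_enorm_convolution_le {f g : V → ℂ} (hf : Measurable f) (hg : Measurable g) :
    ∫⁻ x, ‖∫ t, f t * g (x - t)‖ₑ ≤ (∫⁻ x, ‖f x‖ₑ) * ∫⁻ x, ‖g x‖ₑ := by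
  calc ∫⁻ x, ‖∫ t, f t * g (x - t)‖ₑ
      ≤ ∫⁻ x, ∫⁻ t, ‖f t‖ₑ * ‖g (x - t)‖ₑ := by
        refine lintegral_mono fun x => ?_
        refine (enorm_integral_le_lintegral_enorm _).trans (le_of_eq ?_)
        simp only [enorm_mul]
    _ = ∫⁻ t, ∫⁻ x, ‖f t‖ₑ * ‖g (x - t)‖ₑ := by
        refine lintegral_lintegral_swap (Measurable.aemeasurable ?_)
        exact (hf.enorm.comp measurable_snd).mul
          (hg.enorm.comp (measurable_fst.sub measurable_snd))
    _ = ∫⁻ t, ‖f t‖ₑ * ∫⁻ x, ‖g x‖ₑ := by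
        refine lintegral_congr fun t => ?_
        rw [lintegral_const_mul' _ _ enorm_ne_top,
          lintegral_sub_right_eq_self (fun x => ‖g x‖ₑ) t]
    _ = _ := lintegral_mul_const _ hf.enorm

end FourierInversion

/-! ### Bilinear Fourier multipliers acting on modes. -/

section Bilinear

variable {d : ℕ}

/-- The Fourier side of the bilinear operator with coefficients `β`. -/
def conv (β : ℤ → ℤ → ℂ) (P R : ℤ → Tan d → ℂ) (l : ℤ) (ξ : Tan d) : ℂ :=
  ∑' l₁ : ℤ, β l₁ (l - l₁) * ∫ η : Tan d, P l₁ η * R (l - l₁) (ξ - η)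

theorem measurable_conv {β : ℤ → ℤ → ℂ} {P R : ℤ → Tan d → ℂ} (hP : ∀ l, Measurable (P l))
    (hR : ∀ l, Measurable (R l)) (l : ℤ) : Measurable (conv β P R l) := by
  refine Measurable.tsum fun l₁ => Measurable.const_mul ?_ _
  refine (StronglyMeasurable.integral_prod_right' (f := fun p : Tan d × Tan d =>
    P l₁ p.2 * R (l - l₁) (p.1 - p.2)) ?_).measurable
  exact (((hP l₁).comp measurable_snd).mul
    ((hR (l - l₁)).comp (measurable_fst.sub measurable_snd))).stronglyMeasurable

/-- The normalization constant of the Fourier transform of a product. -/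
def fourierConst (d : ℕ) : ℝ := |(((2 * Real.pi)⁻¹) ^ Module.finrank ℝ (Tan d))⁻¹|⁻¹

/-- The Fourier transform of `u_l` in the normalization of Mathlib. -/
def hat₀ (u : L2 d) (l : ℤ) : Tan d → ℂ := (𝓕 (mode u l) : Lp ℂ 2 (volume : Measure (Tan d)))

theorem hat_eq (u : L2 d) (l : ℤ) (ξ : Tan d) : hat u l ξ = hat₀ u l ((2 * Real.pi)⁻¹ • ξ) := rfl

theorem measurable_hat₀ (u : L2 d) (l : ℤ) : Measurable (hat₀ u l) :=
  (Lp.stronglyMeasurable _).measurable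

/-- The substitution `η = 2π y` in each integral; `fourierConst` is the resulting Jacobian. -/
theorem fourierConst_mul_conv_hat (β : ℤ → ℤ → ℂ) (u v : L2 d) (l : ℤ) (ξ : Tan d) :
    (fourierConst d : ℂ) * conv β (hat u) (hat v) l ξ =
      conv β (hat₀ u) (hat₀ v) l ((2 * Real.pi)⁻¹ • ξ) := by
  rw [conv, conv, ← tsum_mul_left]
  refine tsum_congr fun l₁ => ?_
  have h := Measure.integral_comp_smul (volume : Measure (Tan d))
    (fun y => hat₀ u l₁ y * hat₀ v (l - l₁) ((2 * Real.pi)⁻¹ • ξ - y)) (2 * Real.pi)⁻¹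
  have h2 : ∫ η : Tan d, hat u l₁ η * hat v (l - l₁) (ξ - η) =
      ((fourierConst d)⁻¹ : ℝ) •
        ∫ y : Tan d, hat₀ u l₁ y * hat₀ v (l - l₁) ((2 * Real.pi)⁻¹ • ξ - y) := by
    rw [fourierConst, inv_inv, ← h]
    simp only [hat_eq, smul_sub]
  have h0 : (fourierConst d : ℂ) ≠ 0 := by
    rw [fourierConst, Complex.ofReal_ne_zero]
    exact inv_ne_zero (abs_ne_zero.2 (inv_ne_zero (pow_ne_zero _ two_pi_inv_ne_zero)))
  rw [h2, Complex.real_smul]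
  push_cast
  field_simp

theorem lintegral_hat (u : L2 d) (l : ℤ) :
    ∫⁻ x, ‖hat₀ u l x‖ₑ = ENNReal.ofReal (fourierConst d) * ∫⁻ ξ, ‖hat u l ξ‖ₑ := by
  have h := lintegral_comp_smul (V := Tan d) two_pi_inv_ne_zero (measurable_hat₀ u l).enorm
  simp only [← hat_eq] at h
  rw [h, ← mul_assoc, fourierConst, ← ENNReal.ofReal_mul (by positivity), inv_mul_cancel₀,
    ENNReal.ofReal_one, one_mul]
  exact abs_ne_zero.2 (inv_ne_zero (pow_ne_zero _ two_pi_inv_ne_zero))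

theorem mode_eq_fourierInv {u : L2 d} {l : ℤ} (hu : ∫⁻ ξ, ‖hat u l ξ‖ₑ ≠ ∞) :
    ∀ᵐ y : Tan d, mode u l y = 𝓕⁻ (hat₀ u l) y := by
  refine coeFn_eq_fourierInv (mode u l) ⟨(measurable_hat₀ u l).aestronglyMeasurable, ?_⟩
  have h := lintegral_hat u l
  exact (h.trans_lt (ENNReal.mul_lt_top ENNReal.ofReal_lt_top hu.lt_top))

theorem integrable_hat₀ {u : L2 d} {l : ℤ} (hu : ∫⁻ ξ, ‖hat u l ξ‖ₑ ≠ ∞) :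
    Integrable (hat₀ u l) :=
  ⟨(measurable_hat₀ u l).aestronglyMeasurable,
    (lintegral_hat u l).trans_lt (ENNReal.mul_lt_top ENNReal.ofReal_lt_top hu.lt_top)⟩

/-- The function `w` is built on the Fourier side, where `hB` places it in `L²`. The `L¹` bound `hA`
then allows inversion term by term, turning each convolution into a product of modes at almost every
`y`. -/
theorem exists_bilinear {β : ℤ → ℤ → ℂ} {u v : L2 d} (hu : ∀ l, ∫⁻ ξ, ‖hat u l ξ‖ₑ ≠ ∞)
    (hv : ∀ l, ∫⁻ ξ, ‖hat v l ξ‖ₑ ≠ ∞)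
    (hA : ∀ l, ∑' l₁, ‖β l₁ (l - l₁)‖ₑ *
      ((∫⁻ ξ, ‖hat u l₁ ξ‖ₑ) * ∫⁻ ξ, ‖hat v (l - l₁) ξ‖ₑ) ≠ ∞)
    (hB : ∫⁻ ξ, ∑' l, ‖conv β (hat u) (hat v) l ξ‖ₑ ^ 2 ≠ ∞) :
    ∃ w : L2 d, (∀ l, ∀ᵐ ξ : Tan d, hat w l ξ = fourierConst d * conv β (hat u) (hat v) l ξ) ∧
      ∀ l, ∀ᵐ y : Tan d,
        HasSum (fun l₁ => β l₁ (l - l₁) * (mode u l₁ y * mode v (l - l₁) y)) (mode w l y) := by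
  obtain ⟨w, hw⟩ := exists_hat_eq
    (h := fun l ξ => (fourierConst d : ℂ) * conv β (hat u) (hat v) l ξ)
    (fun l => (measurable_conv (measurable_hat u) (measurable_hat v) l).const_mul _) (by
      simp only [enorm_mul, mul_pow, ENNReal.tsum_mul_left]
      rw [lintegral_const_mul]
      · exact ENNReal.mul_ne_top (ENNReal.pow_ne_top enorm_ne_top) hB
      · exact Measurable.tsum fun l =>
          (measurable_conv (measurable_hat u) (measurable_hat v) l).enorm.pow_const 2)
  refine ⟨w, hw, fun l => ?_⟩
  set F : ℤ → Tan d → ℂ := fun l₁ x =>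
    β l₁ (l - l₁) * ∫ y, hat₀ u l₁ y * hat₀ v (l - l₁) (x - y) with hF
  have hconv : conv β (hat₀ u) (hat₀ v) l = fun x => ∑' l₁, F l₁ x := rfl
  have hw₀ : ∀ᵐ x : Tan d, hat₀ w l x = ∑' l₁, F l₁ x := by
    filter_upwards [ae_comp_smul (V := Tan d) Real.two_pi_pos.ne' (hw l)] with x hx
    rw [fourierConst_mul_conv_hat, hat_eq, smul_smul, inv_mul_cancel₀ Real.two_pi_pos.ne',
      one_smul] at hx
    exact hx
  have hFi : ∀ l₁, Integrable (F l₁) := fun l₁ =>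
    ((integrable_hat₀ (hu l₁)).integrable_convolution (ContinuousLinearMap.mul ℂ ℂ)
      (integrable_hat₀ (hv (l - l₁)))).const_mul _
  -- Summability in `L¹`, by `L¹ * L¹ ⊂ L¹`. It gives both the integrability of the transform of `w`
  -- and the exchange of the sum over `l₁` with the inversion integral.
  have hFs : ∑' l₁, ∫⁻ x, ‖F l₁ x‖ₑ ≠ ∞ := by
    set K : ℝ≥0∞ := ENNReal.ofReal (fourierConst d)
    refine ne_top_of_le_ne_top (b := K ^ 2 * ∑' l₁, ‖β l₁ (l - l₁)‖ₑ *
      ((∫⁻ ξ, ‖hat u l₁ ξ‖ₑ) * ∫⁻ ξ, ‖hat v (l - l₁) ξ‖ₑ))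
      (ENNReal.mul_ne_top (ENNReal.pow_ne_top ENNReal.ofReal_ne_top) (hA l)) ?_
    rw [← ENNReal.tsum_mul_left]
    refine ENNReal.tsum_le_tsum fun l₁ => ?_
    simp only [hF, enorm_mul]
    rw [lintegral_const_mul' _ _ enorm_ne_top]
    have h1 := lintegral_enorm_convolution_le (measurable_hat₀ u l₁) (measurable_hat₀ v (l - l₁))
    rw [lintegral_hat, lintegral_hat] at h1
    refine (mul_le_mul' le_rfl h1).trans (le_of_eq ?_)
    ring
  have hFsum : Summable fun l₁ => ∫ x, ‖F l₁ x‖ := by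
    refine (ENNReal.summable_toReal hFs).congr fun l₁ => ?_
    rw [integral_norm_eq_lintegral_enorm (hFi l₁).1]
  have hint : ∫⁻ ξ, ‖hat w l ξ‖ₑ ≠ ∞ := by
    have h1 : ∫⁻ x, ‖hat₀ w l x‖ₑ ≠ ∞ := by
      refine ne_top_of_le_ne_top hFs ?_
      rw [← lintegral_tsum fun l₁ => (hFi l₁).1.enorm]
      refine lintegral_mono_ae ?_
      filter_upwards [hw₀] with x hx
      rw [hx]
      exact enorm_tsum_le_tsum_enorm
    rw [lintegral_hat] at h1
    refine fun h2 => h1 ?_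
    rw [h2, ENNReal.mul_top]
    rw [fourierConst]
    simp only [ne_eq, ENNReal.ofReal_eq_zero, not_le]
    exact inv_pos.2 (abs_pos.2 (inv_ne_zero (pow_ne_zero _ two_pi_inv_ne_zero)))
  filter_upwards [mode_eq_fourierInv hint, ae_all_iff.2 fun l₁ => mode_eq_fourierInv (hu l₁),
    ae_all_iff.2 fun l₁ => mode_eq_fourierInv (hv l₁)] with y h1 h2 h3
  have h4 : mode w l y = ∫ x, Real.fourierChar (inner ℝ x y) • ∑' l₁, F l₁ x := by
    rw [h1, Real.fourierInv_eq]
    refine integral_congr_ae ?_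
    filter_upwards [hw₀] with x hx
    rw [hx]
  have h5 := hasSum_integral_of_summable_integral_norm (μ := (volume : Measure (Tan d)))
    (F := fun l₁ x => Real.fourierChar (inner ℝ x y) • F l₁ x) (fun l₁ => by
      have := (Real.fourierIntegral_convergent_iff (-y)).2 (hFi l₁)
      simpa using this) (by simpa only [Circle.norm_smul] using hFsum)
  have h6 : ∀ x, ∑' l₁, Real.fourierChar (inner ℝ x y) • F l₁ x =
      Real.fourierChar (inner ℝ x y) • ∑' l₁, F l₁ x := fun x => by
    simp only [Circle.smul_def, smul_eq_mul, tsum_mul_left]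
  simp only [h6] at h5
  rw [← h4] at h5
  convert! h5 using 1
  ext l₁
  rw [← Real.fourierInv_eq, h2, h3, ← fourierInv_convolution (integrable_hat₀ (hu l₁))
    (integrable_hat₀ (hv (l - l₁)))]
  rw [Real.fourierInv_eq, Real.fourierInv_eq, ← integral_const_mul]
  refine integral_congr_ae (Eventually.of_forall fun x => ?_)
  simp only [hF, Circle.smul_def, smul_eq_mul]
  ring

end Bilinear

/-! ### Products of absolutely convergent Fourier series. -/

section TorusProduct

local notation "haarT" => AddCircle.haarAddCircle (T := 2 * Real.pi)

theorem ae_eq_of_fourierCoeff {f g : Torus → ℂ} (hf : MemLp f 2 haarT) (hg : MemLp g 2 haarT)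
    (h : ∀ l, fourierCoeff f l = fourierCoeff g l) : f =ᵐ[haarT] g := by
  have h1 : hf.toLp f = hg.toLp g := by
    refine (fourierBasis (T := 2 * Real.pi)).repr.injective ?_
    ext l
    rw [fourierBasis_repr, fourierBasis_repr, fourierCoeff_congr_ae hf.coeFn_toLp,
      fourierCoeff_congr_ae hg.coeFn_toLp, h]
  filter_upwards [hf.coeFn_toLp, hg.coeFn_toLp] with θ h2 h3
  rw [← h2, ← h3, h1]

theorem exists_continuous_of_summable {f : Torus → ℂ} (hf : MemLp f 2 haarT)
    (hs : Summable fun l => ‖fourierCoeff f l‖) :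
    ∃ F : C(Torus, ℂ), f =ᵐ[haarT] F ∧ fourierCoeff F = fourierCoeff f ∧
      ∀ θ, HasSum (fun l => fourierCoeff f l * fourier l θ) (F θ) := by
  have hsum : Summable fun l => fourierCoeff f l • (fourier l : C(Torus, ℂ)) := by
    refine Summable.of_norm ?_
    simpa only [norm_smul, fourier_norm, mul_one] using hs
  set F : C(Torus, ℂ) := ∑' l, fourierCoeff f l • (fourier l : C(Torus, ℂ)) with hF
  have hFs : HasSum (fun l => fourierCoeff f l • (fourier l : C(Torus, ℂ))) F := hsum.hasSum
  have h1 := (ContinuousMap.toLp (E := ℂ) 2 haarT ℂ).hasSum hFs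
  have h2 := hasSum_fourier_series_L2 (hf.toLp f)
  have h3 : ContinuousMap.toLp (E := ℂ) 2 haarT ℂ F = hf.toLp f := by
    refine h1.unique ?_
    convert! h2 using 2 with l
    rw [map_smul, fourierCoeff_congr_ae hf.coeFn_toLp]
  have h4 : f =ᵐ[haarT] F := by
    have h5 := ContinuousMap.coeFn_toLp (p := 2) (𝕜 := ℂ) haarT F
    rw [h3] at h5
    filter_upwards [h5, hf.coeFn_toLp] with θ h6 h7
    rw [← h7, h6]
  refine ⟨F, h4, (fourierCoeff_congr_ae h4).symm, fun θ => ?_⟩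
  exact (ContinuousMap.evalCLM ℂ θ).hasSum hFs

/-- Absolutely summable coefficients give continuous representatives `F` and `G`. Expanding `F`
under the integral shows that `F G` has the convolved coefficients, and uniqueness of the
coefficients identifies it with `h`. -/
theorem ae_eq_mul_of_fourierCoeff {f g h : Torus → ℂ} (hf : MemLp f 2 haarT)
    (hg : MemLp g 2 haarT) (hh : MemLp h 2 haarT) (hfs : Summable fun l => ‖fourierCoeff f l‖)
    (hgs : Summable fun l => ‖fourierCoeff g l‖)
    (hc : ∀ l, HasSum (fun l₁ => fourierCoeff f l₁ * fourierCoeff g (l - l₁)) (fourierCoeff h l)) :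
    h =ᵐ[haarT] fun θ => f θ * g θ := by
  obtain ⟨F, hF, hFc, hFs⟩ := exists_continuous_of_summable hf hfs
  obtain ⟨G, hG, hGc, -⟩ := exists_continuous_of_summable hg hgs
  have hint : Integrable (fun θ => F θ * G θ) haarT :=
    (F * G).continuous.integrable_of_hasCompactSupport (HasCompactSupport.of_compactSpace _)
  have hFG : MemLp (fun θ => F θ * G θ) 2 haarT := by
    refine (memLp_top_of_bound (F * G).continuous.aestronglyMeasurable ‖F * G‖
      (Eventually.of_forall fun θ => (F * G).norm_coe_le_norm θ)).mono_exponent le_top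
  have h1 : h =ᵐ[haarT] fun θ => F θ * G θ := by
    refine ae_eq_of_fourierCoeff hh hFG fun l => ?_
    refine (hc l).unique ?_
    have hGi : Integrable (fun θ => ‖G θ‖) haarT :=
      G.continuous.norm.integrable_of_hasCompactSupport (HasCompactSupport.of_compactSpace _)
    have h2 := hasSum_integral_of_summable_integral_norm (μ := haarT)
      (F := fun l₁ θ => fourier (-l) θ * (fourierCoeff f l₁ * fourier l₁ θ * G θ))
      (fun l₁ => ((by fun_prop : Continuous fun θ : Torus =>
        fourier (-l) θ * (fourierCoeff f l₁ * fourier l₁ θ *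
          G θ)).integrable_of_hasCompactSupport (HasCompactSupport.of_compactSpace _))) ?_
    · have h3 : ∀ θ, ∑' l₁, fourier (-l) θ * (fourierCoeff f l₁ * fourier l₁ θ * G θ) =
          fourier (-l) θ • (F θ * G θ) := fun θ => by
        rw [tsum_mul_left, tsum_mul_right, (hFs θ).tsum_eq, smul_eq_mul]
      simp only [h3] at h2
      convert! h2 using 1
      ext l₁
      have h6 : fourierCoeff (G : Torus → ℂ) (l - l₁) =
        ∫ θ, fourier (-(l - l₁)) θ • G θ ∂haarT := rfl
      rw [← hGc, h6, ← integral_const_mul]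
      congr 1
      ext θ
      have h4 : -(l - l₁) = -l + l₁ := by ring
      rw [h4, fourier_add, smul_eq_mul]
      ring
    · have h5 : ∀ (l₁ : ℤ) (θ : Torus),
          ‖fourier (-l) θ * (fourierCoeff f l₁ * fourier l₁ θ * G θ)‖ =
            ‖fourierCoeff f l₁‖ * ‖G θ‖ := fun l₁ θ => by
        simp only [norm_mul, fourier_apply, Circle.norm_coe, one_mul, mul_one]
      simp only [h5, integral_const_mul]
      exact hfs.mul_right _
  filter_upwards [h1, hF, hG] with θ h2 h3 h4
  rw [h2, h3, h4]

end TorusProduct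

/-! ### Fourier transforms of the product and of `𝔽^per`. -/

section Products

variable {d : ℕ}

theorem mode_apply (u : L2 d) : ∀ᵐ y : Tan d, ∀ l, mode u l y = fourierCoeff (fun θ => u (y, θ)) l :=
  ae_all_iff.2 fun l => (memLp_modeFun u l).coeFn_toLp

theorem memLp_slice (u : L2 d) : ∀ᵐ y : Tan d,
    MemLp (fun θ : Torus => u (y, θ)) 2 AddCircle.haarAddCircle := by
  have hu : MemLp (u : Tan d × Torus → ℂ) 2 (domMeasure d) := Lp.memLp u
  have hsq : Integrable (fun z => ‖u z‖ ^ 2) (domMeasure d) :=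
    (memLp_two_iff_integrable_sq_norm hu.1).1 hu
  filter_upwards [hsq.prod_right_ae, hu.1.prodMk_left] with y hy hym
  exact (memLp_two_iff_integrable_sq_norm hym).2 hy

/-- By inversion, a mode is bounded at almost every `y` by the `L¹` norm of its transform, up to a
constant independent of the mode. -/
theorem summable_mode {u : L2 d} (hu : ∑' l, ∫⁻ ξ, ‖hat u l ξ‖ₑ ≠ ∞) :
    ∀ᵐ y : Tan d, Summable fun l => ‖mode u l y‖ := by
  have hl : ∀ l, ∫⁻ ξ, ‖hat u l ξ‖ₑ ≠ ∞ := fun l => ne_top_of_le_ne_top hu (ENNReal.le_tsum l)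
  filter_upwards [ae_all_iff.2 fun l => mode_eq_fourierInv (hl l)] with y hy
  rw [← tsum_enorm_ne_top_iff_summable_norm]
  refine ne_top_of_le_ne_top (b := ∑' l, ∫⁻ x, ‖hat₀ u l x‖ₑ) ?_
    (ENNReal.tsum_le_tsum fun l => ?_)
  · simp only [lintegral_hat, ENNReal.tsum_mul_left]
    exact ENNReal.mul_ne_top ENNReal.ofReal_ne_top hu
  · rw [hy]
    exact enorm_fourierInv_le _ _

/-- The candidate is built on the Fourier side and compared with `u v` slice by slice. The
comparison also shows that `u v` is square integrable, so `mul` does not take its default value. -/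
theorem hat_mul {u v : L2 d} (hu : ∑' l, ∫⁻ ξ, ‖hat u l ξ‖ₑ ≠ ∞)
    (hv : ∑' l, ∫⁻ ξ, ‖hat v l ξ‖ₑ ≠ ∞)
    (hB : ∫⁻ ξ, ∑' l, ‖conv (fun _ _ => 1) (hat u) (hat v) l ξ‖ₑ ^ 2 ≠ ∞) (l : ℤ) :
    ∀ᵐ ξ : Tan d, hat (mul u v) l ξ =
      fourierConst d * conv (fun _ _ => 1) (hat u) (hat v) l ξ := by
  have hul : ∀ l, ∫⁻ ξ, ‖hat u l ξ‖ₑ ≠ ∞ := fun l => ne_top_of_le_ne_top hu (ENNReal.le_tsum l)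
  have hvl : ∀ l, ∫⁻ ξ, ‖hat v l ξ‖ₑ ≠ ∞ := fun l => ne_top_of_le_ne_top hv (ENNReal.le_tsum l)
  obtain ⟨w, hw, hwm⟩ := exists_bilinear (β := fun _ _ => 1) hul hvl (fun l => by
    refine ne_top_of_le_ne_top (b := (∑' l₁, ∫⁻ ξ, ‖hat u l₁ ξ‖ₑ) * ∑' l₁, ∫⁻ ξ, ‖hat v l₁ ξ‖ₑ)
      (ENNReal.mul_ne_top hu hv) ?_
    rw [← ENNReal.tsum_mul_right]
    refine ENNReal.tsum_le_tsum fun l₁ => ?_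
    rw [enorm_one, one_mul]
    gcongr
    exact ENNReal.le_tsum _) hB
  have hprod : ∀ᵐ z ∂domMeasure d, w z = u z * v z := by
    have hm : MeasurableSet {z : Tan d × Torus | w z = u z * v z} :=
      measurableSet_eq_fun (Lp.stronglyMeasurable w).measurable
        ((Lp.stronglyMeasurable u).measurable.mul (Lp.stronglyMeasurable v).measurable)
    refine (Measure.ae_prod_mem_iff_ae_ae_mem hm).2 ?_
    filter_upwards [memLp_slice u, memLp_slice v, memLp_slice w, mode_apply u, mode_apply v,
      mode_apply w, summable_mode hu, summable_mode hv, ae_all_iff.2 hwm]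
      with y h1 h2 h3 h4 h5 h6 h7 h8 h9
    refine ae_eq_mul_of_fourierCoeff h1 h2 h3 ?_ ?_ fun l => ?_
    · simpa only [h4] using h7
    · simpa only [h5] using h8
    · simpa only [h4, h5, h6, one_mul] using h9 l
  have hmem : MemLp (fun z => u z * v z) 2 (domMeasure d) := (memLp_congr_ae hprod).1 (Lp.memLp w)
  have hmw : mul u v = w := by
    rw [mul, dif_pos hmem]
    refine Lp.ext ?_
    filter_upwards [hmem.coeFn_toLp, hprod] with z h1 h2
    rw [h1, h2]
  rw [hmw]
  exact hw l

/-- The coefficients of `𝔽^per`. -/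
def perCoeff (δ₁ δ₃ : ℝ) (l₁ l₃ : ℤ) : ℂ :=
  if l₁ ≠ 0 ∧ l₃ ≠ 0 ∧ l₁ + l₃ ≠ 0 then
    Complex.I / ((l₁ : ℂ) * (δ₁ : ℂ) + (l₃ : ℂ) * (δ₃ : ℂ)) else 0

theorem IsFper.unique {δ₁ δ₃ : ℝ} {u v w w' : L2 d} (h : IsFper δ₁ δ₃ u v w)
    (h' : IsFper δ₁ δ₃ u v w') : w = w' := by
  refine eq_of_mode fun l => Lp.ext ?_
  filter_upwards [h l, h' l] with y h1 h2
  split_ifs at h1 h2 with hl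
  · rw [h1, h2]
  · exact h1.unique h2

/-- `Fper` is a chosen solution of `IsFper`. Uniqueness of such solutions identifies it with the
function constructed on the Fourier side. -/
theorem hat_Fper {δ₁ δ₃ : ℝ} {u v : L2 d} (hu : ∀ l, ∫⁻ ξ, ‖hat u l ξ‖ₑ ≠ ∞)
    (hv : ∀ l, ∫⁻ ξ, ‖hat v l ξ‖ₑ ≠ ∞)
    (hA : ∀ l, ∑' l₁, ‖perCoeff δ₁ δ₃ l₁ (l - l₁)‖ₑ *
      ((∫⁻ ξ, ‖hat u l₁ ξ‖ₑ) * ∫⁻ ξ, ‖hat v (l - l₁) ξ‖ₑ) ≠ ∞)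
    (hB : ∫⁻ ξ, ∑' l, ‖conv (perCoeff δ₁ δ₃) (hat u) (hat v) l ξ‖ₑ ^ 2 ≠ ∞) (l : ℤ) :
    ∀ᵐ ξ : Tan d, hat (Fper δ₁ δ₃ u v) l ξ =
      fourierConst d * conv (perCoeff δ₁ δ₃) (hat u) (hat v) l ξ := by
  obtain ⟨w, hw, hwm⟩ := exists_bilinear hu hv hA hB
  have hF : IsFper δ₁ δ₃ u v w := by
    intro l
    filter_upwards [hwm l] with y hy
    split_ifs with hl
    -- At `l = 0` every term vanishes, since `perCoeff` excludes `l₁ + l₃ = 0`; this is the required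
    -- zero mean.
    · subst hl
      refine hy.unique ?_
      convert! hasSum_zero using 2 with l₁
      simp [perCoeff]
    · rw [← hasSum_subtype_iff_of_support_subset (s := {k : ℤ | k ≠ 0 ∧ l - k ≠ 0})] at hy
      · convert! hy using 1
        ext l₁
        simp only [Function.comp_apply, perCoeff]
        rw [if_pos ⟨l₁.2.1, l₁.2.2, by rwa [add_sub_cancel]⟩]
        ring
      · intro k hk
        by_contra hk'
        refine hk ?_
        have : ¬ (k ≠ 0 ∧ l - k ≠ 0 ∧ k + (l - k) ≠ 0) := fun h => hk' ⟨h.1, h.2.1⟩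
        simp only [perCoeff, if_neg this, zero_mul]
  have hex : ∃ w : L2 d, IsFper δ₁ δ₃ u v w := ⟨w, hF⟩
  have hFw : Fper δ₁ δ₃ u v = w := by
    rw [Fper, dif_pos hex]
    exact hex.choose_spec.unique hF
  rw [hFw]
  exact hw l

end Products

/-! ### Young's inequality and weighted convolutions. -/

section Young

variable {Q : Type*} [MeasurableSpace Q] [AddCommGroup Q] [MeasurableAdd₂ Q] [MeasurableNeg Q]
  {μ : Measure Q}

theorem measurable_lintegral_mul_sub [SFinite μ] {f R : Q → ℝ≥0∞} (hf : Measurable f)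
    (hR : Measurable R) : Measurable fun q => ∫⁻ p, f p * R (q - p) ∂μ := by
  have : Measurable fun z : Q × Q => f z.2 * R (z.1 - z.2) :=
    (hf.comp measurable_snd).mul (hR.comp (measurable_fst.sub measurable_snd))
  exact this.lintegral_prod_right'

/-- Young's inequality `L¹ * L² ⊂ L²`. -/
theorem l2_lintegral_mul_sub_le [SFinite μ] [μ.IsAddRightInvariant] {f R : Q → ℝ≥0∞}
    (hf : Measurable f) (hR : Measurable R) :
    l2 μ (fun q => ∫⁻ p, f p * R (q - p) ∂μ) ≤ (∫⁻ p, f p ∂μ) * l2 μ R := by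
  have hRq : ∀ q : Q, Measurable fun p => R (q - p) := fun q =>
    hR.comp (measurable_const.sub measurable_id)
  -- Cauchy–Schwarz for the measure of density `f`, obtained by splitting `f` into two square roots.
  have h1 : ∀ q, (∫⁻ p, f p * R (q - p) ∂μ) ^ 2 ≤
      (∫⁻ p, f p ∂μ) * ∫⁻ p, f p * R (q - p) ^ 2 ∂μ := by
    intro q
    have h2 := lintegral_mul_le_l2 (μ := μ) (U := fun p => f p ^ (1 / 2 : ℝ))
      (V := fun p => f p ^ (1 / 2 : ℝ) * R (q - p)) (hf.pow_const _).aemeasurable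
      ((hf.pow_const _).mul (hRq q)).aemeasurable
    have hsq : ∀ x : ℝ≥0∞, x ^ (1 / 2 : ℝ) * x ^ (1 / 2 : ℝ) = x := fun x => by
      rw [← ENNReal.rpow_add_of_nonneg _ _ (by norm_num) (by norm_num)]
      norm_num
    have hsq' : ∀ x : ℝ≥0∞, (x ^ (1 / 2 : ℝ)) ^ 2 = x := fun x => by rw [sq, hsq]
    simp only [← mul_assoc, hsq] at h2
    calc (∫⁻ p, f p * R (q - p) ∂μ) ^ 2 ≤ _ := pow_le_pow_left' h2 2
      _ = _ := by
        rw [mul_pow, l2_sq, l2_sq]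
        simp only [mul_pow, hsq']
  have h3 : l2 μ (fun q => ∫⁻ p, f p * R (q - p) ∂μ) ^ 2 ≤ ((∫⁻ p, f p ∂μ) * l2 μ R) ^ 2 := by
    rw [l2_sq, mul_pow, l2_sq]
    calc ∫⁻ q, (∫⁻ p, f p * R (q - p) ∂μ) ^ 2 ∂μ
        ≤ ∫⁻ q, (∫⁻ p, f p ∂μ) * ∫⁻ p, f p * R (q - p) ^ 2 ∂μ ∂μ := lintegral_mono h1
      _ = (∫⁻ p, f p ∂μ) * ∫⁻ q, ∫⁻ p, f p * R (q - p) ^ 2 ∂μ ∂μ :=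
        lintegral_const_mul _ (measurable_lintegral_mul_sub hf (hR.pow_const 2))
      _ = (∫⁻ p, f p ∂μ) * ∫⁻ p, ∫⁻ q, f p * R (q - p) ^ 2 ∂μ ∂μ := by
        rw [lintegral_lintegral_swap]
        exact ((hf.comp measurable_snd).mul
          ((hR.pow_const 2).comp (measurable_fst.sub measurable_snd))).aemeasurable
      _ = (∫⁻ p, f p ∂μ) * ∫⁻ p, f p * ∫⁻ q, R q ^ 2 ∂μ ∂μ := by
        congr 1
        refine lintegral_congr fun p => ?_
        have hm : Measurable fun q => R (q - p) ^ 2 :=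
          (hR.pow_const 2).comp (measurable_id.sub measurable_const)
        rw [lintegral_const_mul _ hm, lintegral_sub_right_eq_self (fun q => R q ^ 2) p]
      _ = (∫⁻ p, f p ∂μ) ^ 2 * ∫⁻ q, R q ^ 2 ∂μ := by
        rw [lintegral_mul_const _ hf, sq, mul_assoc]
  exact (ENNReal.pow_le_pow_left_iff (by norm_num)).1 h3

/-- The convolution of `U` and `V` with the weight `g p + g (q - p)`. -/
def wconv (μ : Measure Q) (g U V : Q → ℝ≥0∞) (q : Q) : ℝ≥0∞ :=
  ∫⁻ p, (g p + g (q - p)) * (U p * V (q - p)) ∂μ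

theorem wconv_eq [μ.IsAddLeftInvariant] [μ.IsNegInvariant] {g U V : Q → ℝ≥0∞}
    (hg : Measurable g) (hU : Measurable U) (hV : Measurable V) (q : Q) :
    wconv μ g U V q = (∫⁻ p, g p * U p * V (q - p) ∂μ) + ∫⁻ p, g p * V p * U (q - p) ∂μ := by
  have hs : Measurable fun p : Q => q - p := measurable_const.sub measurable_id
  have h1 : ∫⁻ p, g p * V p * U (q - p) ∂μ = ∫⁻ p, g (q - p) * V (q - p) * U p ∂μ := by
    rw [← lintegral_sub_left_eq_self _ q]
    simp
  have hm : Measurable fun p => g p * U p * V (q - p) := (hg.mul hU).mul (hV.comp hs)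
  rw [h1, ← lintegral_add_left hm]
  refine lintegral_congr fun p => ?_
  ring

theorem measurable_wconv [SFinite μ] {g U V : Q → ℝ≥0∞}
    (hg : Measurable g) (hU : Measurable U) (hV : Measurable V) : Measurable (wconv μ g U V) := by
  have : Measurable fun z : Q × Q => (g z.2 + g (z.1 - z.2)) * (U z.2 * V (z.1 - z.2)) := by
    have h := measurable_fst.sub (measurable_snd (α := Q) (β := Q))
    exact ((hg.comp measurable_snd).add (hg.comp h)).mul
      ((hU.comp measurable_snd).mul (hV.comp h))
  exact this.lintegral_prod_right'

/-- Each half of the weight multiplies one factor. The weighted factor lies in `L¹` by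
Cauchy–Schwarz, as `g` is in `L²`, and its convolution with the other factor is in `L²` by Young's
inequality. -/
theorem l2_wconv_le [SFinite μ] [μ.IsAddLeftInvariant] [μ.IsNegInvariant]
    {g U V : Q → ℝ≥0∞} (hg : Measurable g) (hU : Measurable U) (hV : Measurable V) :
    l2 μ (wconv μ g U V) ≤ 2 * l2 μ g * (l2 μ U * l2 μ V) := by
  have : μ.IsAddRightInvariant := inferInstance
  have key : ∀ {X Y : Q → ℝ≥0∞}, Measurable X → Measurable Y →
      l2 μ (fun q => ∫⁻ p, g p * X p * Y (q - p) ∂μ) ≤ l2 μ g * (l2 μ X * l2 μ Y) := by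
    intro X Y hX hY
    refine (l2_lintegral_mul_sub_le (hg.mul hX) hY).trans ?_
    rw [← mul_assoc]
    gcongr
    exact lintegral_mul_le_l2 hg.aemeasurable hX.aemeasurable
  calc l2 μ (wconv μ g U V)
      = l2 μ (fun q => (∫⁻ p, g p * U p * V (q - p) ∂μ) + ∫⁻ p, g p * V p * U (q - p) ∂μ) := by
        congr 1
        funext q
        exact wconv_eq hg hU hV q
    _ ≤ _ := l2_add_le (measurable_lintegral_mul_sub (hg.mul hU) hV).aemeasurable
        (measurable_lintegral_mul_sub (hg.mul hV) hU).aemeasurable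
    _ ≤ l2 μ g * (l2 μ U * l2 μ V) + l2 μ g * (l2 μ V * l2 μ U) :=
        add_le_add (key hU hV) (key hV hU)
    _ = _ := by ring

end Young

/-! ### The measure on the frequencies `(l, ξ)`. -/

section Frequencies

variable {d : ℕ}

/-- Counting measure times Lebesgue measure on the dual space `ℤ × ℝ^{d-1}`. -/
abbrev freqMeasure (d : ℕ) : Measure (ℤ × Tan d) := Measure.count.prod volume

instance : (freqMeasure d).IsNegInvariant where
  neg_eq_self := by
    change Measure.map (Prod.map Neg.neg Neg.neg) _ = _
    rw [← Measure.map_prod_map _ _ measurable_neg measurable_neg]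
    change (Measure.count : Measure ℤ).neg.prod (volume : Measure (Tan d)).neg = _
    rw [Measure.neg_eq_self, Measure.neg_eq_self]

theorem lintegral_freq {f : ℤ × Tan d → ℝ≥0∞} (hf : Measurable f) :
    ∫⁻ q, f q ∂freqMeasure d = ∑' l : ℤ, ∫⁻ ξ, f (l, ξ) := by
  rw [lintegral_prod _ hf.aemeasurable, lintegral_count]

theorem ae_freq_iff {p : ℤ × Tan d → Prop} (hp : MeasurableSet {q | p q}) :
    (∀ᵐ q ∂freqMeasure d, p q) ↔ ∀ l : ℤ, ∀ᵐ ξ : Tan d, p (l, ξ) := by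
  rw [Measure.ae_prod_iff_ae_ae hp, Measure.ae_count_iff]

end Frequencies

/-! ### The length and the Japanese bracket. -/

section Bracket

variable {d : ℕ}

theorem one_le_jap (x : ℝ) : 1 ≤ jap x := Real.one_le_sqrt.2 (by nlinarith [sq_nonneg x])

theorem jap_pos (x : ℝ) : 0 < jap x := one_pos.trans_le (one_le_jap x)

theorem jap_sq (x : ℝ) : jap x ^ 2 = 1 + x ^ 2 := Real.sq_sqrt (by positivity)

theorem jap_le_jap {x y : ℝ} (h : |x| ≤ |y|) : jap x ≤ jap y :=
  Real.sqrt_le_sqrt (by linarith [sq_le_sq.2 h])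

theorem abs_le_jap (x : ℝ) : |x| ≤ jap x :=
  Real.le_sqrt_of_sq_le (by rw [sq_abs]; linarith)

theorem jap_add_le (x y : ℝ) : jap (x + y) ≤ 2 * max (jap x) (jap y) := by
  have key : ∀ a b : ℝ, |a| ≤ |b| → jap (a + b) ≤ 2 * jap b := by
    intro a b h
    refine Real.sqrt_le_iff.2 ⟨by linarith [jap_pos b], ?_⟩
    rw [mul_pow, jap_sq]
    nlinarith [sq_le_sq.2 h, sq_nonneg (a - b)]
  rcases le_total |x| |y| with h | h
  · exact (key x y h).trans (by gcongr; exact le_max_right _ _)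
  · rw [add_comm]
    exact (key y x h).trans (by gcongr; exact le_max_left _ _)

theorem len_nonneg (l : ℤ) (ξ : Tan d) : 0 ≤ len l ξ := Real.sqrt_nonneg _

theorem len_sq (l : ℤ) (ξ : Tan d) : len l ξ ^ 2 = (l : ℝ) ^ 2 + ‖ξ‖ ^ 2 :=
  Real.sq_sqrt (by positivity)

theorem abs_le_len (l : ℤ) (ξ : Tan d) : |(l : ℝ)| ≤ len l ξ :=
  Real.le_sqrt_of_sq_le (by rw [sq_abs]; nlinarith [sq_nonneg ‖ξ‖])

theorem norm_le_len (l : ℤ) (ξ : Tan d) : ‖ξ‖ ≤ len l ξ :=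
  Real.le_sqrt_of_sq_le (by nlinarith [sq_nonneg (l : ℝ)])

theorem len_add_le (l k : ℤ) (ξ η : Tan d) : len (l + k) (ξ + η) ≤ len l ξ + len k η := by
  have h1 := norm_add_le ξ η
  have h2 : (l : ℝ) * k + ‖ξ‖ * ‖η‖ ≤ len l ξ * len k η := by
    refine le_trans (le_abs_self _) (abs_le_of_sq_le_sq ?_
      (mul_nonneg (len_nonneg _ _) (len_nonneg _ _)))
    rw [mul_pow, len_sq, len_sq]
    nlinarith [sq_nonneg ((l : ℝ) * ‖η‖ - k * ‖ξ‖)]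
  refine Real.sqrt_le_iff.2 ⟨add_nonneg (len_nonneg _ _) (len_nonneg _ _), ?_⟩
  have h3 : ‖ξ + η‖ ^ 2 ≤ (‖ξ‖ + ‖η‖) ^ 2 := pow_le_pow_left₀ (norm_nonneg _) h1 2
  push_cast
  nlinarith [len_sq l ξ, len_sq k η]

theorem continuous_jap : Continuous jap := by
  unfold jap
  fun_prop

theorem measurable_len : Measurable fun q : ℤ × Tan d => len q.1 q.2 := by
  unfold len
  have : Measurable fun q : ℤ × Tan d => (q.1 : ℝ) :=
    (measurable_from_top (f := fun l : ℤ => (l : ℝ))).comp measurable_fst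
  fun_prop

theorem measurable_jap_len : Measurable fun q : ℤ × Tan d => jap (len q.1 q.2) :=
  continuous_jap.measurable.comp measurable_len

end Bracket

/-! ### Weights and the basic bilinear estimate. -/

section Weights

variable {d : ℕ}

/-- The square integrable weight absorbing the loss in the bilinear estimates. -/
def freqWeight (d : ℕ) (b : ℝ) (q : ℤ × Tan d) : ℝ≥0∞ := ENNReal.ofReal (jap (len q.1 q.2) ^ (-b))

theorem measurable_freqWeight (b : ℝ) : Measurable (freqWeight d b) :=
  (measurable_jap_len.pow_const _).ennreal_ofReal

/-- Of the power `(1 + l² + |ξ|²)^{-b}`, one factor gives `(1 + l²)⁻¹`, summable over `ℤ`, and the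
rest `(1 + |ξ|²)^{-(b-1)}`, integrable over `ℝ^{d-1}` when `2(b - 1) > d - 1`. This is the threshold
`(d + 1)/2`. -/
theorem l2_freqWeight_ne_top (hd : 2 ≤ d) {b : ℝ} (hb : ((d : ℝ) + 1) / 2 < b) :
    l2 (freqMeasure d) (freqWeight d b) ≠ ∞ := by
  have hd' : (2 : ℝ) ≤ d := by exact_mod_cast hd
  have h0 : ∫⁻ q, freqWeight d b q ^ 2 ∂freqMeasure d ≠ ∞ := by
    rw [lintegral_freq ((measurable_freqWeight b).pow_const 2)]
    have hle : ∀ (l : ℤ) (ξ : Tan d), freqWeight d b (l, ξ) ^ 2 ≤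
        ENNReal.ofReal ((1 + (l : ℝ) ^ 2)⁻¹) *
          ENNReal.ofReal ((1 + ‖ξ‖ ^ 2) ^ (-(2 * (b - 1)) / 2)) := by
      intro l ξ
      rw [freqWeight, ← ENNReal.ofReal_pow (by have := jap_pos (len l ξ); positivity),
        ← ENNReal.ofReal_mul (by positivity)]
      refine ENNReal.ofReal_le_ofReal ?_
      have hj : jap (len l ξ) ^ 2 = 1 + ((l : ℝ) ^ 2 + ‖ξ‖ ^ 2) := by rw [jap_sq, len_sq]
      have h1 : (jap (len l ξ) ^ (-b)) ^ 2 = (1 + ((l : ℝ) ^ 2 + ‖ξ‖ ^ 2)) ^ (-b) := by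
        rw [← hj, ← Real.rpow_natCast, ← Real.rpow_natCast, ← Real.rpow_mul (jap_pos _).le,
          ← Real.rpow_mul (jap_pos _).le, mul_comm]
      have h2 : (1 + ((l : ℝ) ^ 2 + ‖ξ‖ ^ 2)) ^ (-b) =
          (1 + ((l : ℝ) ^ 2 + ‖ξ‖ ^ 2))⁻¹ * (1 + ((l : ℝ) ^ 2 + ‖ξ‖ ^ 2)) ^ (-(b - 1)) := by
        rw [← Real.rpow_neg_one, ← Real.rpow_add (by positivity)]
        congr 1
        ring
      rw [h1, h2, show -(2 * (b - 1)) / 2 = -(b - 1) by ring]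
      refine mul_le_mul ?_ ?_ (by positivity) (by positivity)
      · exact inv_anti₀ (by positivity) (by nlinarith [sq_nonneg ‖ξ‖])
      · exact Real.rpow_le_rpow_of_nonpos (by positivity) (by nlinarith [sq_nonneg (l : ℝ)])
          (by linarith)
    have hfin : ∫⁻ ξ : Tan d, ENNReal.ofReal ((1 + ‖ξ‖ ^ 2) ^ (-(2 * (b - 1)) / 2)) ≠ ∞ := by
      refine ((integrable_rpow_neg_one_add_norm_sq (μ := (volume : Measure (Tan d)))
        (r := 2 * (b - 1)) ?_).lintegral_lt_top).ne
      rw [finrank_euclideanSpace_fin, Nat.cast_sub (by omega)]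
      push_cast
      linarith
    have hsum : ∑' l : ℤ, ENNReal.ofReal ((1 + (l : ℝ) ^ 2)⁻¹) ≠ ∞ := by
      refine Summable.tsum_ofReal_ne_top ?_
      have h2 : Summable fun l : ℤ => 1 / (l : ℝ) ^ 2 := Real.summable_one_div_int_pow.2 (by norm_num)
      refine Summable.of_norm_bounded_eventually (g := fun l : ℤ => 1 / (l : ℝ) ^ 2) h2 ?_
      filter_upwards [(Set.finite_singleton (0 : ℤ)).compl_mem_cofinite] with l hl
      have hl' : (l : ℝ) ≠ 0 := by exact_mod_cast hl
      rw [Real.norm_of_nonneg (by positivity), ← one_div]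
      gcongr
      linarith
    refine ne_top_of_le_ne_top (ENNReal.mul_ne_top hsum hfin) ?_
    rw [← ENNReal.tsum_mul_right]
    refine ENNReal.tsum_le_tsum fun l => ?_
    rw [← lintegral_const_mul' _ _ ENNReal.ofReal_ne_top]
    exact lintegral_mono fun ξ => hle l ξ
  rw [l2]
  exact (ENNReal.rpow_lt_top_of_nonneg (by norm_num) h0).ne

/-- The inverse of the weight of `Y_σ`. -/
def decay (N : ℕ) (σ : ℝ) (q : ℤ × Tan d) : ℝ≥0∞ :=
  ENNReal.ofReal (Real.exp (-σ * len q.1 q.2) * (jap (len q.1 q.2) ^ N)⁻¹)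

theorem measurable_decay (N : ℕ) (σ : ℝ) : Measurable (decay (d := d) N σ) :=
  (((measurable_len.const_mul (-σ)).exp).mul (measurable_jap_len.pow_const N).inv).ennreal_ofReal

/-- The coefficients of the bilinear operators of the model after one derivative in `Θ`. -/
def CoeffBound (β : ℤ → ℤ → ℂ) (m C : ℝ) : Prop :=
  ∀ l₁ l₃ : ℤ, ‖β l₁ l₃‖ ≤ C * (1 + |((l₁ + l₃ : ℤ) : ℝ)|) * min (jap l₁) (jap l₃) ^ m

/-- The exponentials are handled by the triangle inequality. The larger of the two brackets is at
least half that of `p + p'`, which yields `2 ^ N` and the output weight. The smaller one absorbs the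
power `m` and leaves `⟨·⟩^{-(N-m)}`. Since either may be the smaller, the two weights are added. -/
theorem CoeffBound.mul_decay_le {β : ℤ → ℤ → ℂ} {m C : ℝ} (hβ : CoeffBound β m C) (hC : 0 ≤ C)
    (hm : 0 ≤ m) {N : ℕ} {σ : ℝ} (hσ : 0 ≤ σ) (p p' : ℤ × Tan d) :
    ‖β p.1 p'.1‖ₑ * (decay N σ p * decay N σ p') ≤
      ENNReal.ofReal (C * 2 ^ N * (1 + |((p + p').1 : ℝ)|)) * decay N σ (p + p') *
        (freqWeight d (N - m) p + freqWeight d (N - m) p') := by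
  obtain ⟨l, ξ⟩ := p
  obtain ⟨k, η⟩ := p'
  -- Both orders of the arguments of `β` are treated at once, since `β` is not assumed symmetric
  -- while its bound is.
  have key : ∀ (l k : ℤ) (ξ η : Tan d), jap (len l ξ) ≤ jap (len k η) →
      ‖β l k‖ * (Real.exp (-σ * len l ξ) * (jap (len l ξ) ^ N)⁻¹ *
        (Real.exp (-σ * len k η) * (jap (len k η) ^ N)⁻¹)) ≤
      (C * 2 ^ N * (1 + |((l + k : ℤ) : ℝ)|)) * (Real.exp (-σ * len (l + k) (ξ + η)) *
        (jap (len (l + k) (ξ + η)) ^ N)⁻¹) * jap (len l ξ) ^ (-((N : ℝ) - m)) ∧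
      ‖β k l‖ * (Real.exp (-σ * len k η) * (jap (len k η) ^ N)⁻¹ *
        (Real.exp (-σ * len l ξ) * (jap (len l ξ) ^ N)⁻¹)) ≤
      (C * 2 ^ N * (1 + |((l + k : ℤ) : ℝ)|)) * (Real.exp (-σ * len (l + k) (ξ + η)) *
        (jap (len (l + k) (ξ + η)) ^ N)⁻¹) * jap (len l ξ) ^ (-((N : ℝ) - m)) := by
    intro l k ξ η hle
    have hJ := jap_pos (len l ξ)
    have hJ' := jap_pos (len k η)
    have hJs := jap_pos (len (l + k) (ξ + η))
    have hmin : min (jap l) (jap k) ^ m ≤ jap (len l ξ) ^ m := by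
      refine Real.rpow_le_rpow (le_min (jap_pos _).le (jap_pos _).le) ?_ hm
      refine (min_le_left _ _).trans (jap_le_jap ?_)
      rw [abs_of_nonneg (len_nonneg l ξ)]
      exact abs_le_len l ξ
    have hB1 : ‖β l k‖ ≤ C * (1 + |((l + k : ℤ) : ℝ)|) * jap (len l ξ) ^ m :=
      (hβ l k).trans (by gcongr)
    have hB2 : ‖β k l‖ ≤ C * (1 + |((l + k : ℤ) : ℝ)|) * jap (len l ξ) ^ m := by
      have := hβ k l
      rw [add_comm k l, min_comm] at this
      exact this.trans (by gcongr)
    have hexp : Real.exp (-σ * len l ξ) * Real.exp (-σ * len k η) ≤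
        Real.exp (-σ * len (l + k) (ξ + η)) := by
      rw [← Real.exp_add]
      refine Real.exp_le_exp.2 ?_
      nlinarith [len_add_le l k ξ η]
    have hjap : (jap (len k η) ^ N)⁻¹ ≤ 2 ^ N * (jap (len (l + k) (ξ + η)) ^ N)⁻¹ := by
      rw [← div_eq_mul_inv, le_div_iff₀ (by positivity), inv_mul_le_iff₀ (by positivity),
        mul_comm, ← mul_pow]
      gcongr
      have h1 : jap (len (l + k) (ξ + η)) ≤ jap (len l ξ + len k η) := by
        refine jap_le_jap ?_
        rw [abs_of_nonneg (len_nonneg _ _),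
          abs_of_nonneg (add_nonneg (len_nonneg _ _) (len_nonneg _ _))]
        exact len_add_le l k ξ η
      refine h1.trans ((jap_add_le _ _).trans ?_)
      rw [max_eq_right hle]
    have hpow : jap (len l ξ) ^ m * (jap (len l ξ) ^ N)⁻¹ = jap (len l ξ) ^ (-((N : ℝ) - m)) := by
      rw [← Real.rpow_natCast, ← Real.rpow_neg hJ.le, ← Real.rpow_add hJ]
      congr 1
      ring
    have main : C * (1 + |((l + k : ℤ) : ℝ)|) * jap (len l ξ) ^ m *
        (Real.exp (-σ * len l ξ) * (jap (len l ξ) ^ N)⁻¹ *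
        (Real.exp (-σ * len k η) * (jap (len k η) ^ N)⁻¹)) ≤
        (C * 2 ^ N * (1 + |((l + k : ℤ) : ℝ)|)) * (Real.exp (-σ * len (l + k) (ξ + η)) *
        (jap (len (l + k) (ξ + η)) ^ N)⁻¹) * jap (len l ξ) ^ (-((N : ℝ) - m)) := by
      calc _ = C * (1 + |((l + k : ℤ) : ℝ)|) * ((Real.exp (-σ * len l ξ) *
            Real.exp (-σ * len k η)) * (jap (len k η) ^ N)⁻¹) *
            (jap (len l ξ) ^ m * (jap (len l ξ) ^ N)⁻¹) := by ring
        _ ≤ C * (1 + |((l + k : ℤ) : ℝ)|) * (Real.exp (-σ * len (l + k) (ξ + η)) *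
            (2 ^ N * (jap (len (l + k) (ξ + η)) ^ N)⁻¹)) *
            (jap (len l ξ) ^ m * (jap (len l ξ) ^ N)⁻¹) := by gcongr
        _ = _ := by rw [hpow]; ring
    refine ⟨le_trans (by gcongr) main, le_trans ?_ main⟩
    calc _ = ‖β k l‖ * (Real.exp (-σ * len l ξ) * (jap (len l ξ) ^ N)⁻¹ *
        (Real.exp (-σ * len k η) * (jap (len k η) ^ N)⁻¹)) := by ring
      _ ≤ _ := by gcongr
  have hA : 0 ≤ C * 2 ^ N * (1 + |((l + k : ℤ) : ℝ)|) := by positivity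
  have hJ := jap_pos (len l ξ)
  have hJ' := jap_pos (len k η)
  have hJs := jap_pos (len (l + k) (ξ + η))
  simp only [Prod.mk_add_mk]
  rw [← ofReal_norm (β l k)]
  simp only [decay, freqWeight]
  rw [← ENNReal.ofReal_mul (by positivity), ← ENNReal.ofReal_mul (by positivity),
    ← ENNReal.ofReal_mul hA]
  rcases le_total (jap (len l ξ)) (jap (len k η)) with h | h
  · refine (ENNReal.ofReal_le_ofReal (key l k ξ η h).1).trans ?_
    rw [ENNReal.ofReal_mul (by positivity)]
    gcongr
    exact le_self_add
  · have h2 := (key k l η ξ h).2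
    rw [add_comm k l, add_comm η ξ] at h2
    refine (ENNReal.ofReal_le_ofReal h2).trans ?_
    rw [ENNReal.ofReal_mul (by positivity)]
    gcongr
    exact le_add_self

theorem measurePreserving_freq_sub_left (q : ℤ × Tan d) :
    MeasurePreserving (fun p => q - p) (freqMeasure d) (freqMeasure d) :=
  Measure.measurePreserving_sub_left _ q

/-- The bilinear estimate. -/
theorem CoeffBound.lintegral_le {β : ℤ → ℤ → ℂ} {m C : ℝ} (hβ : CoeffBound β m C) (hC : 0 ≤ C)
    (hm : 0 ≤ m) {N : ℕ} {σ : ℝ} (hσ : 0 ≤ σ) {A B U V : ℤ × Tan d → ℝ≥0∞}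
    (hA : ∀ᵐ p ∂freqMeasure d, A p ≤ decay N σ p * U p)
    (hB : ∀ᵐ p ∂freqMeasure d, B p ≤ decay N σ p * V p) (q : ℤ × Tan d) :
    ∫⁻ p, ‖β p.1 (q.1 - p.1)‖ₑ * (A p * B (q - p)) ∂freqMeasure d ≤
      ENNReal.ofReal (C * 2 ^ N * (1 + |(q.1 : ℝ)|)) * decay N σ q *
        wconv (freqMeasure d) (freqWeight d (N - m)) U V q := by
  have hB' := (measurePreserving_freq_sub_left q).quasiMeasurePreserving.ae hB
  rw [wconv, ← lintegral_const_mul' _ _ (ENNReal.mul_ne_top ENNReal.ofReal_ne_top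
    (by exact ENNReal.ofReal_ne_top))]
  refine lintegral_mono_ae ?_
  filter_upwards [hA, hB'] with p h1 h2
  have h3 := hβ.mul_decay_le hC hm (N := N) hσ p (q - p)
  rw [add_sub_cancel] at h3
  calc ‖β p.1 (q.1 - p.1)‖ₑ * (A p * B (q - p))
      ≤ ‖β p.1 (q.1 - p.1)‖ₑ * ((decay N σ p * U p) * (decay N σ (q - p) * V (q - p))) := by
        gcongr
    _ = ‖β p.1 (q.1 - p.1)‖ₑ * (decay N σ p * decay N σ (q - p)) * (U p * V (q - p)) := by ring
    _ ≤ _ := by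
        rw [← mul_assoc (_ * decay N σ q)]
        exact mul_le_mul_left h3 _

end Weights

/-! ### Convolutions as integrals over all frequencies. -/

section ConvEstimates

variable {d : ℕ}

theorem measurable_uncurry_freq {P : ℤ → Tan d → ℂ} (hP : ∀ l, Measurable (P l)) :
    Measurable fun q : ℤ × Tan d => P q.1 q.2 :=
  measurable_from_prod_countable_right hP

theorem measurable_conv_integrand (β : ℤ → ℤ → ℂ) {P R : ℤ → Tan d → ℂ}
    (hP : ∀ l, Measurable (P l)) (hR : ∀ l, Measurable (R l)) (q : ℤ × Tan d) :
    Measurable fun p : ℤ × Tan d =>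
      β p.1 (q.1 - p.1) * (P p.1 p.2 * R (q.1 - p.1) (q.2 - p.2)) := by
  refine Measurable.mul ?_ ((measurable_uncurry_freq hP).mul ?_)
  · exact (measurable_from_top (f := fun l : ℤ => β l (q.1 - l))).comp measurable_fst
  · exact (measurable_uncurry_freq hR).comp (measurable_const.sub measurable_id (f := fun _ => q))

theorem enorm_conv_integrand (β : ℤ → ℤ → ℂ) (P R : ℤ → Tan d → ℂ) (q p : ℤ × Tan d) :
    ‖β p.1 (q.1 - p.1) * (P p.1 p.2 * R (q.1 - p.1) (q.2 - p.2))‖ₑ =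
      ‖β p.1 (q.1 - p.1)‖ₑ * (‖P p.1 p.2‖ₑ * ‖R (q - p).1 (q - p).2‖ₑ) := by
  rw [enorm_mul, enorm_mul]
  rfl

theorem conv_eq_integral (β : ℤ → ℤ → ℂ) {P R : ℤ → Tan d → ℂ} {q : ℤ × Tan d}
    (h : Integrable (fun p : ℤ × Tan d =>
      β p.1 (q.1 - p.1) * (P p.1 p.2 * R (q.1 - p.1) (q.2 - p.2))) (freqMeasure d)) :
    conv β P R q.1 q.2 = ∫ p : ℤ × Tan d,
      β p.1 (q.1 - p.1) * (P p.1 p.2 * R (q.1 - p.1) (q.2 - p.2)) ∂freqMeasure d := by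
  rw [integral_prod _ h, integral_countable h.integral_prod_left, conv]
  refine tsum_congr fun l => ?_
  rw [measureReal_def, Measure.count_singleton, ENNReal.toReal_one, one_smul]
  exact (integral_const_mul _ _).symm

theorem integrable_conv_integrand (β : ℤ → ℤ → ℂ) {P R : ℤ → Tan d → ℂ}
    (hP : ∀ l, Measurable (P l)) (hR : ∀ l, Measurable (R l)) {q : ℤ × Tan d}
    (h : ∫⁻ p, ‖β p.1 (q.1 - p.1)‖ₑ * (‖P p.1 p.2‖ₑ * ‖R (q - p).1 (q - p).2‖ₑ)
      ∂freqMeasure d ≠ ∞) :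
    Integrable (fun p : ℤ × Tan d =>
      β p.1 (q.1 - p.1) * (P p.1 p.2 * R (q.1 - p.1) (q.2 - p.2))) (freqMeasure d) := by
  refine ⟨(measurable_conv_integrand β hP hR q).aestronglyMeasurable, ?_⟩
  rw [hasFiniteIntegral_iff_enorm]
  simp only [enorm_conv_integrand]
  exact h.lt_top

theorem enorm_conv_le (β : ℤ → ℤ → ℂ) {P R : ℤ → Tan d → ℂ}
    (hP : ∀ l, Measurable (P l)) (hR : ∀ l, Measurable (R l)) (q : ℤ × Tan d) :
    ‖conv β P R q.1 q.2‖ₑ ≤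
      ∫⁻ p, ‖β p.1 (q.1 - p.1)‖ₑ * (‖P p.1 p.2‖ₑ * ‖R (q - p).1 (q - p).2‖ₑ) ∂freqMeasure d := by
  by_cases h : ∫⁻ p, ‖β p.1 (q.1 - p.1)‖ₑ * (‖P p.1 p.2‖ₑ * ‖R (q - p).1 (q - p).2‖ₑ)
      ∂freqMeasure d = ∞
  · rw [h]
    exact le_top
  · rw [conv_eq_integral β (integrable_conv_integrand β hP hR h)]
    refine (enorm_integral_le_lintegral_enorm _).trans ?_
    simp only [enorm_conv_integrand]
    exact le_rfl

/-- The telescoping `P R - P' R' = (P - P') R + P' (R - R')`. Finiteness of both integrals is needed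
to subtract them. -/
theorem enorm_conv_sub_le (β : ℤ → ℤ → ℂ) {P R P' R' : ℤ → Tan d → ℂ}
    (hP : ∀ l, Measurable (P l)) (hR : ∀ l, Measurable (R l))
    (hP' : ∀ l, Measurable (P' l)) (hR' : ∀ l, Measurable (R' l)) {q : ℤ × Tan d}
    (h : ∫⁻ p, ‖β p.1 (q.1 - p.1)‖ₑ * (‖P p.1 p.2‖ₑ * ‖R (q - p).1 (q - p).2‖ₑ)
      ∂freqMeasure d ≠ ∞)
    (h' : ∫⁻ p, ‖β p.1 (q.1 - p.1)‖ₑ * (‖P' p.1 p.2‖ₑ * ‖R' (q - p).1 (q - p).2‖ₑ)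
      ∂freqMeasure d ≠ ∞) :
    ‖conv β P R q.1 q.2 - conv β P' R' q.1 q.2‖ₑ ≤
      (∫⁻ p, ‖β p.1 (q.1 - p.1)‖ₑ * (‖P p.1 p.2 - P' p.1 p.2‖ₑ * ‖R (q - p).1 (q - p).2‖ₑ)
        ∂freqMeasure d) +
      ∫⁻ p, ‖β p.1 (q.1 - p.1)‖ₑ * (‖P' p.1 p.2‖ₑ *
        ‖R (q - p).1 (q - p).2 - R' (q - p).1 (q - p).2‖ₑ) ∂freqMeasure d := by
  have hi := integrable_conv_integrand β hP hR h
  have hi' := integrable_conv_integrand β hP' hR' h'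
  rw [conv_eq_integral β hi, conv_eq_integral β hi', ← integral_sub hi hi',
    ← lintegral_add_left]
  · refine (enorm_integral_le_lintegral_enorm _).trans (lintegral_mono fun p => ?_)
    rw [← mul_add, ← enorm_mul, ← enorm_mul]
    refine le_trans ?_ (mul_le_mul_right (enorm_add_le _ _) _)
    rw [← enorm_mul]
    refine le_of_eq (congrArg _ ?_)
    simp only [Prod.fst_sub, Prod.snd_sub]
    ring
  · have h1 := (measurable_conv_integrand β (fun l => (hP l).sub (hP' l)) hR q).enorm
    have h2 : (fun p : ℤ × Tan d => ‖β p.1 (q.1 - p.1) * ((P p.1 - P' p.1) p.2 *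
        R (q.1 - p.1) (q.2 - p.2))‖ₑ) = fun p => ‖β p.1 (q.1 - p.1)‖ₑ *
        (‖P p.1 p.2 - P' p.1 p.2‖ₑ * ‖R (q - p).1 (q - p).2‖ₑ) := by
      funext p
      exact enorm_conv_integrand β (fun l => P l - P' l) R q p
    rw [← h2]
    exact h1

theorem conv_congr_ae (β : ℤ → ℤ → ℂ) {P R P' R' : ℤ → Tan d → ℂ}
    (hP : ∀ l, ∀ᵐ ξ : Tan d, P l ξ = P' l ξ) (hR : ∀ l, ∀ᵐ ξ : Tan d, R l ξ = R' l ξ)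
    (l : ℤ) (ξ : Tan d) : conv β P R l ξ = conv β P' R' l ξ := by
  refine tsum_congr fun l₁ => congrArg _ (integral_congr_ae ?_)
  have h2 := (Measure.measurePreserving_sub_left (volume : Measure (Tan d))
    ξ).quasiMeasurePreserving.ae (hR (l - l₁))
  filter_upwards [hP l₁, h2] with η h3 h4
  rw [h3, h4]

theorem conv_mul_mul (β : ℤ → ℤ → ℂ) (P R : ℤ → Tan d → ℂ) (c e : ℤ → ℂ) (l : ℤ) (ξ : Tan d) :
    conv β (fun k η => c k * P k η) (fun k η => e k * R k η) l ξ =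
      conv (fun l₁ l₃ => β l₁ l₃ * (c l₁ * e l₃)) P R l ξ := by
  refine tsum_congr fun l₁ => ?_
  have h : ∫ η : Tan d, c l₁ * P l₁ η * (e (l - l₁) * R (l - l₁) (ξ - η)) =
      c l₁ * e (l - l₁) * ∫ η : Tan d, P l₁ η * R (l - l₁) (ξ - η) := by
    rw [← integral_const_mul]
    congr 1
    funext η
    ring
  exact (congrArg (β l₁ (l - l₁) * ·) h).trans (mul_assoc _ _ _).symm

theorem mul_conv (c : ℤ → ℂ) (β : ℤ → ℤ → ℂ) (P R : ℤ → Tan d → ℂ) (l : ℤ) (ξ : Tan d) :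
    c l * conv β P R l ξ = conv (fun l₁ l₃ => c (l₁ + l₃) * β l₁ l₃) P R l ξ := by
  rw [conv, ← tsum_mul_left]
  refine tsum_congr fun l₁ => ?_
  simp only [add_sub_cancel, mul_assoc]

end ConvEstimates

/-! ### Operators applied to functions with exponentially decaying transforms. -/

section FourierSide

variable {d : ℕ}

theorem norm_derivative_le (l : ℤ) (ξ : Tan d) :
    ‖Complex.I * (l : ℂ)‖ ≤ 1 * (1 + len l ξ) := by
  rw [norm_mul, Complex.norm_I, one_mul, one_mul, Complex.norm_intCast]
  linarith [abs_le_len l ξ]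

theorem enorm_derivative_le (l : ℤ) : ‖Complex.I * (l : ℂ)‖ₑ = ENNReal.ofReal |(l : ℝ)| := by
  rw [← ofReal_norm, norm_mul, Complex.norm_I, one_mul, Complex.norm_intCast]

/-- Any `σ > 0` pays for two powers of the length: one for a derivative applied from outside, one
for the factor `1 + |l|` of the bilinear estimate. -/
theorem exists_one_add_len_sq_mul_decay_le {σ : ℝ} (hσ : 0 < σ) (N : ℕ) :
    ∃ K : ℝ≥0∞, K ≠ ∞ ∧ ∀ q : ℤ × Tan d,
      ENNReal.ofReal ((1 + len q.1 q.2) ^ 2) * decay N σ q ≤ K := by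
  -- The constant comes from `(1 + x)² ≤ 2 + 2x²` and `e^{σx} ≥ 1 + (σx)²/2`.
  refine ⟨ENNReal.ofReal (2 + 4 / σ ^ 2), ENNReal.ofReal_ne_top, fun q => ?_⟩
  rw [decay, ← ENNReal.ofReal_mul (by positivity)]
  refine ENNReal.ofReal_le_ofReal ?_
  set x := len q.1 q.2 with hx
  have hx0 : 0 ≤ x := len_nonneg _ _
  have h1 : (jap x ^ N)⁻¹ ≤ 1 := inv_le_one_of_one_le₀ (one_le_pow₀ (one_le_jap x))
  have h2 : (1 + x) ^ 2 ≤ (2 + 4 / σ ^ 2) * Real.exp (σ * x) := by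
    have h3 := Real.quadratic_le_exp_of_nonneg (mul_nonneg hσ.le hx0)
    have h4 : 2 + 2 * x ^ 2 ≤ (2 + 4 / σ ^ 2) * (1 + (σ * x) ^ 2 / 2) := by
      have : 4 / σ ^ 2 * ((σ * x) ^ 2 / 2) = 2 * x ^ 2 := by
        field_simp
        ring
      have h5 : 0 ≤ 4 / σ ^ 2 := by positivity
      nlinarith [sq_nonneg (σ * x)]
    have h6 : (2 + 4 / σ ^ 2) * (1 + (σ * x) ^ 2 / 2) ≤ (2 + 4 / σ ^ 2) * Real.exp (σ * x) := by
      gcongr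
      nlinarith [mul_nonneg hσ.le hx0]
    nlinarith [sq_nonneg (1 - x)]
  have h7 : Real.exp (σ * x) * Real.exp (-σ * x) = 1 := by
    rw [← Real.exp_add]
    simp
  have hj := jap_pos x
  calc (1 + x) ^ 2 * (Real.exp (-σ * x) * (jap x ^ N)⁻¹)
      ≤ (2 + 4 / σ ^ 2) * Real.exp (σ * x) * (Real.exp (-σ * x) * 1) := by gcongr
    _ = 2 + 4 / σ ^ 2 := by rw [mul_one, mul_assoc, h7, mul_one]

/-- The Fourier transform of `u` is dominated by the weight of `Y_σ` times `V`. -/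
def HatDom (N : ℕ) (σ : ℝ) (u : L2 d) (V : ℤ × Tan d → ℝ≥0∞) : Prop :=
  ∀ᵐ q ∂freqMeasure d, ‖hat u q.1 q.2‖ₑ ≤ decay N σ q * V q

theorem lintegral_tsum_sq_ne_top {f : ℤ → Tan d → ℂ} (hf : ∀ l, Measurable (f l))
    {V : ℤ × Tan d → ℝ≥0∞} (hV : l2 (freqMeasure d) V ≠ ∞)
    (h : ∀ᵐ q ∂freqMeasure d, ‖f q.1 q.2‖ₑ ≤ V q) :
    ∫⁻ ξ, ∑' l, ‖f l ξ‖ₑ ^ 2 ≠ ∞ := by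
  rw [lintegral_tsum fun l => ((hf l).enorm.pow_const 2).aemeasurable]
  have h1 := lintegral_freq (d := d) (f := fun q => ‖f q.1 q.2‖ₑ ^ 2)
    ((measurable_uncurry_freq hf).enorm.pow_const 2)
  rw [← h1, ← l2_sq]
  exact ENNReal.pow_ne_top (ne_top_of_le_ne_top hV (l2_mono_ae h))

theorem hat_multiplier_of_le {m : ℤ → Tan d → ℂ} (hm : ∀ l, Measurable (m l)) {B : ℝ}
    (hB : 0 ≤ B) (hmB : ∀ l ξ, ‖m l ξ‖ ≤ B * (1 + len l ξ)) {u : L2 d} {V : ℤ × Tan d → ℝ≥0∞}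
    (hVm : Measurable V) (hV : l2 (freqMeasure d) V ≠ ∞)
    (hu : ∀ᵐ q ∂freqMeasure d, ENNReal.ofReal (1 + len q.1 q.2) * ‖hat u q.1 q.2‖ₑ ≤ V q)
    (l : ℤ) : ∀ᵐ ξ : Tan d, hat (multiplier m u) l ξ = m l ξ * hat u l ξ := by
  refine hat_multiplier hm (lintegral_tsum_sq_ne_top (V := fun q => ENNReal.ofReal B * V q)
    (fun l => (hm l).mul (measurable_hat u l)) ?_ ?_) l
  · rw [l2_const_mul _ hVm.aemeasurable]
    exact ENNReal.mul_ne_top ENNReal.ofReal_ne_top hV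
  · filter_upwards [hu] with q hq
    rw [enorm_mul]
    calc ‖m q.1 q.2‖ₑ * ‖hat u q.1 q.2‖ₑ
        ≤ (ENNReal.ofReal B * ENNReal.ofReal (1 + len q.1 q.2)) * ‖hat u q.1 q.2‖ₑ := by
          rw [← ENNReal.ofReal_mul hB, ← ofReal_norm]
          gcongr
          exact hmB _ _
      _ ≤ ENNReal.ofReal B * V q := by
          rw [mul_assoc]
          gcongr

theorem ofReal_one_add_len_le_sq (q : ℤ × Tan d) :
    ENNReal.ofReal (1 + len q.1 q.2) ≤ ENNReal.ofReal ((1 + len q.1 q.2) ^ 2) :=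
  ENNReal.ofReal_le_ofReal (by nlinarith [len_nonneg q.1 q.2])

theorem HatDom.exists_one_add_len_mul_le {N : ℕ} {σ : ℝ} (hσ : 0 < σ) {u : L2 d}
    {V : ℤ × Tan d → ℝ≥0∞} (hu : HatDom N σ u V) (hVm : Measurable V)
    (hV : l2 (freqMeasure d) V ≠ ∞) : ∃ V', Measurable V' ∧ l2 (freqMeasure d) V' ≠ ∞ ∧
      ∀ᵐ q ∂freqMeasure d, ENNReal.ofReal (1 + len q.1 q.2) * ‖hat u q.1 q.2‖ₑ ≤ V' q := by
  obtain ⟨K, hK, hK'⟩ := exists_one_add_len_sq_mul_decay_le (d := d) hσ N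
  refine ⟨fun q => K * V q, hVm.const_mul K, ?_, ?_⟩
  · rw [l2_const_mul _ hVm.aemeasurable]
    exact ENNReal.mul_ne_top hK hV
  · filter_upwards [hu] with q hq
    calc _ ≤ ENNReal.ofReal ((1 + len q.1 q.2) ^ 2) * (decay N σ q * V q) :=
          mul_le_mul' (ofReal_one_add_len_le_sq q) hq
      _ ≤ K * V q := by
          rw [← mul_assoc]
          gcongr
          exact hK' q

theorem HatDom.hat_dTheta {N : ℕ} {σ : ℝ} (hσ : 0 < σ) {u : L2 d}
    {V : ℤ × Tan d → ℝ≥0∞} (hu : HatDom N σ u V) (hVm : Measurable V)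
    (hV : l2 (freqMeasure d) V ≠ ∞) (l : ℤ) :
    ∀ᵐ ξ : Tan d, hat (dTheta u) l ξ = Complex.I * (l : ℂ) * hat u l ξ := by
  obtain ⟨V', h1, h2, h3⟩ := hu.exists_one_add_len_mul_le hσ hVm hV
  exact hat_multiplier_of_le (m := fun l _ => Complex.I * (l : ℂ))
    (fun l => measurable_const) zero_le_one norm_derivative_le h1 h2 h3 l

theorem norm_dirDeriv_symbol_le (v : Tan d) (l : ℤ) (ξ : Tan d) :
    ‖Complex.I * ((inner ℝ v ξ : ℝ) : ℂ)‖ ≤ ‖v‖ * len l ξ := by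
  rw [norm_mul, Complex.norm_I, one_mul, Complex.norm_real]
  exact (norm_inner_le_norm v ξ).trans (by gcongr; exact norm_le_len l ξ)

theorem HatDom.hat_dirDeriv {N : ℕ} {σ : ℝ} (hσ : 0 < σ) {u : L2 d}
    {V : ℤ × Tan d → ℝ≥0∞} (hu : HatDom N σ u V) (hVm : Measurable V)
    (hV : l2 (freqMeasure d) V ≠ ∞) (v : Tan d) (l : ℤ) :
    ∀ᵐ ξ : Tan d, hat (dirDeriv v u) l ξ = Complex.I * ((inner ℝ v ξ : ℝ) : ℂ) * hat u l ξ := by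
  obtain ⟨V', h1, h2, h3⟩ := hu.exists_one_add_len_mul_le hσ hVm hV
  refine hat_multiplier_of_le (m := fun _ ξ => Complex.I * ((inner ℝ v ξ : ℝ) : ℂ))
    (fun l => by fun_prop) (norm_nonneg v) (fun l ξ => ?_) h1 h2 h3 l
  exact (norm_dirDeriv_symbol_le v l ξ).trans (by gcongr; linarith)

/-- Cauchy–Schwarz: `e` powers of the bracket are taken from the `N` available, and the remaining
weight must be square integrable. -/
theorem HatDom.lintegral_jap_mul_le {N : ℕ} {σ e : ℝ} (hσ : 0 ≤ σ) {u : L2 d}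
    {V : ℤ × Tan d → ℝ≥0∞} (hu : HatDom N σ u V) (hVm : Measurable V) :
    ∫⁻ q, ENNReal.ofReal (jap (len q.1 q.2) ^ e) * ‖hat u q.1 q.2‖ₑ ∂freqMeasure d ≤
      l2 (freqMeasure d) (freqWeight d (N - e)) * l2 (freqMeasure d) V := by
  refine le_trans (lintegral_mono_ae ?_)
    (lintegral_mul_le_l2 (measurable_freqWeight _).aemeasurable hVm.aemeasurable)
  filter_upwards [hu] with q hq
  refine (mul_le_mul_right hq _).trans ?_
  rw [← mul_assoc]
  gcongr
  have hj := jap_pos (len q.1 q.2)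
  rw [decay, freqWeight, ← ENNReal.ofReal_mul (by positivity)]
  refine ENNReal.ofReal_le_ofReal ?_
  have h1 : Real.exp (-σ * len q.1 q.2) ≤ 1 := by
    rw [Real.exp_le_one_iff]
    nlinarith [len_nonneg q.1 q.2]
  have h2 : jap (len q.1 q.2) ^ (-((N : ℝ) - e)) =
      jap (len q.1 q.2) ^ e * (jap (len q.1 q.2) ^ N)⁻¹ := by
    rw [← Real.rpow_natCast, ← Real.rpow_neg hj.le, ← Real.rpow_add hj]
    congr 1
    ring
  rw [h2]
  calc _ ≤ jap (len q.1 q.2) ^ e * (1 * (jap (len q.1 q.2) ^ N)⁻¹) := by gcongr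
    _ = _ := by rw [one_mul]

theorem HatDom.tsum_jap_mul_lintegral_ne_top {N : ℕ} {σ e : ℝ} (hσ : 0 ≤ σ) (he : 0 ≤ e)
    (hN : l2 (freqMeasure d) (freqWeight d (N - e)) ≠ ∞) {u : L2 d}
    {V : ℤ × Tan d → ℝ≥0∞} (hu : HatDom N σ u V) (hVm : Measurable V)
    (hV : l2 (freqMeasure d) V ≠ ∞) :
    ∑' l : ℤ, ENNReal.ofReal (jap l ^ e) * ∫⁻ ξ, ‖hat u l ξ‖ₑ ≠ ∞ := by
  have h1 := hu.lintegral_jap_mul_le (e := e) hσ hVm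
  have hm : Measurable fun q : ℤ × Tan d =>
      ENNReal.ofReal (jap (len q.1 q.2) ^ e) * ‖hat u q.1 q.2‖ₑ :=
    (measurable_jap_len.pow_const _).ennreal_ofReal.mul
      (measurable_uncurry_freq (measurable_hat u)).enorm
  rw [lintegral_freq hm] at h1
  refine ne_top_of_le_ne_top (ENNReal.mul_ne_top hN hV) (le_trans ?_ h1)
  refine ENNReal.tsum_le_tsum fun l => ?_
  rw [← lintegral_const_mul _ (measurable_hat u l).enorm]
  refine lintegral_mono fun ξ => ?_
  gcongr
  · exact (jap_pos _).le
  · refine jap_le_jap ?_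
    rw [abs_of_nonneg (len_nonneg l ξ)]
    exact abs_le_len l ξ

theorem HatDom.tsum_lintegral_ne_top {N : ℕ} {σ e : ℝ} (hσ : 0 ≤ σ) (he : 0 ≤ e)
    (hN : l2 (freqMeasure d) (freqWeight d (N - e)) ≠ ∞) {u : L2 d}
    {V : ℤ × Tan d → ℝ≥0∞} (hu : HatDom N σ u V) (hVm : Measurable V)
    (hV : l2 (freqMeasure d) V ≠ ∞) : ∑' l : ℤ, ∫⁻ ξ, ‖hat u l ξ‖ₑ ≠ ∞ := by
  refine ne_top_of_le_ne_top (hu.tsum_jap_mul_lintegral_ne_top hσ he hN hVm hV)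
    (ENNReal.tsum_le_tsum fun l => ?_)
  refine le_mul_of_one_le_left zero_le ?_
  rw [← ENNReal.ofReal_one]
  exact ENNReal.ofReal_le_ofReal (Real.one_le_rpow (one_le_jap _) he)

theorem HatDom.conv_le {β : ℤ → ℤ → ℂ} {e C : ℝ} (hβ : CoeffBound β e C) (hC : 0 ≤ C)
    (he : 0 ≤ e) {N : ℕ} {σ : ℝ} (hσ : 0 ≤ σ) {u v : L2 d} {U V : ℤ × Tan d → ℝ≥0∞}
    (hu : HatDom N σ u U) (hv : HatDom N σ v V) (q : ℤ × Tan d) :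
    ‖conv β (hat u) (hat v) q.1 q.2‖ₑ ≤
      ENNReal.ofReal (C * 2 ^ N * (1 + |(q.1 : ℝ)|)) * decay N σ q *
        wconv (freqMeasure d) (freqWeight d (N - e)) U V q :=
  (enorm_conv_le β (measurable_hat u) (measurable_hat v) q).trans
    (hβ.lintegral_le hC he hσ hu hv q)

theorem HatDom.exists_one_add_len_mul_conv_le {β : ℤ → ℤ → ℂ} {e C : ℝ} (hβ : CoeffBound β e C)
    (hC : 0 ≤ C) (he : 0 ≤ e) {N : ℕ} (hN : l2 (freqMeasure d) (freqWeight d (N - e)) ≠ ∞)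
    {σ : ℝ} (hσ : 0 < σ) {u v : L2 d} {U V : ℤ × Tan d → ℝ≥0∞}
    (hu : HatDom N σ u U) (hv : HatDom N σ v V) (hUm : Measurable U) (hVm : Measurable V)
    (hU : l2 (freqMeasure d) U ≠ ∞) (hV : l2 (freqMeasure d) V ≠ ∞) :
    ∃ M, Measurable M ∧ l2 (freqMeasure d) M ≠ ∞ ∧ ∀ q : ℤ × Tan d,
      ENNReal.ofReal (1 + len q.1 q.2) * ‖conv β (hat u) (hat v) q.1 q.2‖ₑ ≤ M q := by
  obtain ⟨K, hK, hK'⟩ := exists_one_add_len_sq_mul_decay_le (d := d) hσ N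
  have hm := measurable_wconv (μ := freqMeasure d) (measurable_freqWeight (N - e)) hUm hVm
  refine ⟨fun q => ENNReal.ofReal (C * 2 ^ N) * K *
    wconv (freqMeasure d) (freqWeight d (N - e)) U V q, hm.const_mul _, ?_, fun q => ?_⟩
  · rw [l2_const_mul _ hm.aemeasurable]
    refine ENNReal.mul_ne_top (ENNReal.mul_ne_top ENNReal.ofReal_ne_top hK)
      (ne_top_of_le_ne_top ?_ (l2_wconv_le (measurable_freqWeight _) hUm hVm))
    exact ENNReal.mul_ne_top (ENNReal.mul_ne_top (by norm_num) hN) (ENNReal.mul_ne_top hU hV)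
  · have h1 := hu.conv_le hβ hC he hσ.le hv q
    have hl := len_nonneg q.1 q.2
    calc _ ≤ ENNReal.ofReal (1 + len q.1 q.2) *
          (ENNReal.ofReal (C * 2 ^ N * (1 + |(q.1 : ℝ)|)) * decay N σ q *
          wconv (freqMeasure d) (freqWeight d (N - e)) U V q) := by gcongr
      _ = ENNReal.ofReal (C * 2 ^ N) * (ENNReal.ofReal (1 + len q.1 q.2) *
          ENNReal.ofReal (1 + |(q.1 : ℝ)|) * decay N σ q) *
          wconv (freqMeasure d) (freqWeight d (N - e)) U V q := by
          rw [ENNReal.ofReal_mul (by positivity)]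
          ring
      _ ≤ ENNReal.ofReal (C * 2 ^ N) * K *
          wconv (freqMeasure d) (freqWeight d (N - e)) U V q := by
          gcongr
          refine le_trans ?_ (hK' q)
          rw [← ENNReal.ofReal_mul (by positivity), sq]
          gcongr
          exact abs_le_len _ _

end FourierSide

/-! ### The bilinear terms of the model on the Fourier side. -/

section RhsFourier

variable {d : ℕ}

/-- The coefficients of `∂_Θ(u v)`. -/
def derivCoeff (l₁ l₃ : ℤ) : ℂ := Complex.I * ((l₁ + l₃ : ℤ) : ℂ) * 1

/-- The coefficients of `𝔽^per[∂_Θ u, ∂_Θ v]`. -/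
def perDerivCoeff (δ₁ δ₃ : ℝ) (l₁ l₃ : ℤ) : ℂ :=
  perCoeff δ₁ δ₃ l₁ l₃ * (Complex.I * (l₁ : ℂ) * (Complex.I * (l₃ : ℂ)))

theorem one_le_min_jap_rpow {e : ℝ} (he : 0 ≤ e) (x y : ℝ) : 1 ≤ min (jap x) (jap y) ^ e :=
  Real.one_le_rpow (le_min (one_le_jap x) (one_le_jap y)) he

theorem coeffBound_one {e : ℝ} (he : 0 ≤ e) : CoeffBound (fun _ _ => 1) e 1 := by
  intro l₁ l₃
  rw [norm_one, one_mul]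
  exact one_le_mul_of_one_le_of_one_le (by linarith [abs_nonneg ((l₁ + l₃ : ℤ) : ℝ)])
    (one_le_min_jap_rpow he _ _)

theorem coeffBound_derivCoeff {e : ℝ} (he : 0 ≤ e) : CoeffBound derivCoeff e 1 := by
  intro l₁ l₃
  rw [derivCoeff, mul_one, norm_mul, Complex.norm_I, one_mul, one_mul, Complex.norm_intCast]
  exact (le_add_of_nonneg_left zero_le_one).trans
    (le_mul_of_one_le_right (by positivity) (one_le_min_jap_rpow he _ _))

/-- The two derivatives contribute `|l₁ l₃|`. As the smaller index is at least `1`, the larger one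
is at most the smaller times `1 + |l₁ + l₃|`. Only one derivative then falls on the output, and the
smaller index carries the power `m + 2`. -/
theorem norm_perDerivCoeff_le {δ₁ δ₃ m C : ℝ} (hC : 0 < C)
    (h : ∀ l₁ l₃ : ℤ, l₁ ≠ 0 → l₃ ≠ 0 → (l₁ : ℝ) * δ₁ + (l₃ : ℝ) * δ₃ ≠ 0 ∧
      1 / |(l₁ : ℝ) * δ₁ + (l₃ : ℝ) * δ₃| ≤ C * min (|(l₁ : ℝ)| ^ m) (|(l₃ : ℝ)| ^ m))
    (l₁ l₃ : ℤ) : ‖perDerivCoeff δ₁ δ₃ l₁ l₃‖ ≤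
      C * (1 + |((l₁ + l₃ : ℤ) : ℝ)|) * min |(l₁ : ℝ)| |(l₃ : ℝ)| ^ (m + 2) := by
  have hmin : 0 ≤ min |(l₁ : ℝ)| |(l₃ : ℝ)| := le_min (abs_nonneg _) (abs_nonneg _)
  rw [perDerivCoeff, perCoeff]
  split_ifs with hl
  swap
  · rw [zero_mul, norm_zero]
    positivity
  obtain ⟨h1, h3, -⟩ := hl
  have h4 := (h l₁ l₃ h1 h3).2
  have hcast : ((l₁ : ℂ) * (δ₁ : ℂ) + (l₃ : ℂ) * (δ₃ : ℂ)) =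
      (((l₁ : ℝ) * δ₁ + (l₃ : ℝ) * δ₃ : ℝ) : ℂ) := by push_cast; rfl
  rw [norm_mul, norm_div, Complex.norm_I, hcast, Complex.norm_real, Real.norm_eq_abs, norm_mul,
    norm_mul, norm_mul, Complex.norm_I, one_mul, one_mul, Complex.norm_intCast,
    Complex.norm_intCast]
  have key : ∀ x y : ℝ, 1 ≤ |x| → |x| ≤ |y| →
      min (|x| ^ m) (|y| ^ m) * (|x| * |y|) ≤ (1 + |x + y|) * min |x| |y| ^ (m + 2) := by
    intro x y hx hxy
    have hx0 : 0 < |x| := one_pos.trans_le hx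
    have hy : |y| ≤ |x| * (1 + |x + y|) := by
      have : |y| ≤ |x + y| + |x| := by
        have := abs_sub (x + y) x
        rwa [add_sub_cancel_left] at this
      nlinarith [abs_nonneg (x + y)]
    rw [min_eq_left hxy]
    have hp : |x| ^ (m + 2) = |x| ^ m * (|x| * |x|) := by
      rw [Real.rpow_add hx0, Real.rpow_two, sq]
    rw [hp]
    calc min (|x| ^ m) (|y| ^ m) * (|x| * |y|)
        ≤ |x| ^ m * (|x| * (|x| * (1 + |x + y|))) := by
          gcongr
          exact min_le_left _ _
      _ = _ := by ring
  have habs : ∀ l : ℤ, l ≠ 0 → 1 ≤ |(l : ℝ)| := fun l hl => by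
    exact_mod_cast Int.one_le_abs hl
  have key' : min (|(l₁ : ℝ)| ^ m) (|(l₃ : ℝ)| ^ m) * (|(l₁ : ℝ)| * |(l₃ : ℝ)|) ≤
      (1 + |((l₁ + l₃ : ℤ) : ℝ)|) * min |(l₁ : ℝ)| |(l₃ : ℝ)| ^ (m + 2) := by
    push_cast
    rcases le_total |(l₁ : ℝ)| |(l₃ : ℝ)| with hle | hle
    · exact key _ _ (habs _ h1) hle
    · have := key _ _ (habs _ h3) hle
      rwa [min_comm, mul_comm |(l₃ : ℝ)|, add_comm (l₃ : ℝ), min_comm |(l₃ : ℝ)|] at this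
  calc _ ≤ C * min (|(l₁ : ℝ)| ^ m) (|(l₃ : ℝ)| ^ m) * (|(l₁ : ℝ)| * |(l₃ : ℝ)|) := by gcongr
    _ = C * (min (|(l₁ : ℝ)| ^ m) (|(l₃ : ℝ)| ^ m) * (|(l₁ : ℝ)| * |(l₃ : ℝ)|)) := by ring
    _ ≤ C * ((1 + |((l₁ + l₃ : ℤ) : ℝ)|) * min |(l₁ : ℝ)| |(l₃ : ℝ)| ^ (m + 2)) := by gcongr
    _ = _ := by ring

theorem coeffBound_perDerivCoeff {δ₁ δ₃ m C : ℝ} (hC : 0 < C) (hm : 0 ≤ m)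
    (h : ∀ l₁ l₃ : ℤ, l₁ ≠ 0 → l₃ ≠ 0 → (l₁ : ℝ) * δ₁ + (l₃ : ℝ) * δ₃ ≠ 0 ∧
      1 / |(l₁ : ℝ) * δ₁ + (l₃ : ℝ) * δ₃| ≤ C * min (|(l₁ : ℝ)| ^ m) (|(l₃ : ℝ)| ^ m)) :
    CoeffBound (perDerivCoeff δ₁ δ₃) (m + 2) C := by
  intro l₁ l₃
  refine (norm_perDerivCoeff_le hC h l₁ l₃).trans ?_
  have hmin : 0 ≤ min |(l₁ : ℝ)| |(l₃ : ℝ)| := le_min (abs_nonneg _) (abs_nonneg _)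
  gcongr <;> exact abs_le_jap _

variable {N : ℕ} {σ e : ℝ} {u v : L2 d} {U V : ℤ × Tan d → ℝ≥0∞}

/-- Exponential decay guarantees that the product and its derivative both lie in `L²`, so neither
operator takes its default value. -/
theorem HatDom.hat_dTheta_mul (he : 0 ≤ e)
    (hN : l2 (freqMeasure d) (freqWeight d (N - e)) ≠ ∞) (hσ : 0 < σ)
    (hu : HatDom N σ u U) (hv : HatDom N σ v V) (hUm : Measurable U) (hVm : Measurable V)
    (hU : l2 (freqMeasure d) U ≠ ∞) (hV : l2 (freqMeasure d) V ≠ ∞) (D : ℂ) (l : ℤ) :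
    ∀ᵐ ξ : Tan d, hat (dTheta (D • mul u v)) l ξ =
      D * fourierConst d * conv derivCoeff (hat u) (hat v) l ξ := by
  obtain ⟨M, hMm, hM, hconv⟩ := hu.exists_one_add_len_mul_conv_le (coeffBound_one he) zero_le_one
    he hN hσ hv hUm hVm hU hV
  have hB : ∫⁻ ξ, ∑' l, ‖conv (fun _ _ => 1) (hat u) (hat v) l ξ‖ₑ ^ 2 ≠ ∞ := by
    refine lintegral_tsum_sq_ne_top (measurable_conv (measurable_hat u) (measurable_hat v)) hM
      (Eventually.of_forall fun q => le_trans ?_ (hconv q))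
    refine le_mul_of_one_le_left zero_le ?_
    rw [← ENNReal.ofReal_one]
    exact ENNReal.ofReal_le_ofReal (by linarith [len_nonneg q.1 q.2])
  have hmul := hat_mul (hu.tsum_lintegral_ne_top hσ.le he hN hUm hU)
    (hv.tsum_lintegral_ne_top hσ.le he hN hVm hV) hB
  have hDmul : ∀ l, ∀ᵐ ξ : Tan d, hat (D • mul u v) l ξ =
      D * fourierConst d * conv (fun _ _ => 1) (hat u) (hat v) l ξ := by
    intro l
    filter_upwards [hat_smul D (mul u v) l, hmul l] with ξ h1 h2
    rw [h1, h2, mul_assoc]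
  have hae : ∀ᵐ q ∂freqMeasure d, ENNReal.ofReal (1 + len q.1 q.2) *
      ‖hat (D • mul u v) q.1 q.2‖ₑ ≤ ‖D * fourierConst d‖ₑ * M q := by
    have h1 : ∀ᵐ q ∂freqMeasure d, hat (D • mul u v) q.1 q.2 =
        D * fourierConst d * conv (fun _ _ => 1) (hat u) (hat v) q.1 q.2 :=
      (ae_freq_iff (measurableSet_eq_fun (measurable_uncurry_freq (measurable_hat _))
        ((measurable_uncurry_freq (measurable_conv (measurable_hat u)
          (measurable_hat v))).const_mul _))).2 hDmul
    filter_upwards [h1] with q hq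
    rw [hq, enorm_mul, mul_left_comm]
    gcongr
    exact hconv q
  have h2 := hat_multiplier_of_le (m := fun l _ => Complex.I * (l : ℂ))
    (fun l => measurable_const) zero_le_one norm_derivative_le (hMm.const_mul _) (by
      rw [l2_const_mul _ hMm.aemeasurable]
      exact ENNReal.mul_ne_top enorm_ne_top hM) hae l
  filter_upwards [h2, hDmul l] with ξ h3 h4
  rw [dTheta, h3, h4, mul_left_comm, mul_conv (fun k => Complex.I * (k : ℂ))]
  -- The factor `1` kept in `derivCoeff` is the coefficient of the product, which makes both sides
  -- definitionally equal.
  rfl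

theorem HatDom.hat_Fper_dTheta {δ₁ δ₃ m C : ℝ} (hC : 0 < C) (hm : 0 ≤ m)
    (h : ∀ l₁ l₃ : ℤ, l₁ ≠ 0 → l₃ ≠ 0 → (l₁ : ℝ) * δ₁ + (l₃ : ℝ) * δ₃ ≠ 0 ∧
      1 / |(l₁ : ℝ) * δ₁ + (l₃ : ℝ) * δ₃| ≤ C * min (|(l₁ : ℝ)| ^ m) (|(l₃ : ℝ)| ^ m))
    (hN : l2 (freqMeasure d) (freqWeight d (N - (m + 2))) ≠ ∞) (hσ : 0 < σ)
    (hu : HatDom N σ u U) (hv : HatDom N σ v V) (hUm : Measurable U) (hVm : Measurable V)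
    (hU : l2 (freqMeasure d) U ≠ ∞) (hV : l2 (freqMeasure d) V ≠ ∞) (l : ℤ) :
    ∀ᵐ ξ : Tan d, hat (Fper δ₁ δ₃ (dTheta u) (dTheta v)) l ξ =
      fourierConst d * conv (perDerivCoeff δ₁ δ₃) (hat u) (hat v) l ξ := by
  have he : 0 ≤ m + 2 := by linarith
  have hconvd : ∀ l ξ, conv (perCoeff δ₁ δ₃) (hat (dTheta u)) (hat (dTheta v)) l ξ =
      conv (perDerivCoeff δ₁ δ₃) (hat u) (hat v) l ξ := by
    intro l ξ
    rw [conv_congr_ae _ (hu.hat_dTheta hσ hUm hU) (hv.hat_dTheta hσ hVm hV)]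
    exact conv_mul_mul _ _ _ (fun k => Complex.I * (k : ℂ)) (fun k => Complex.I * (k : ℂ)) l ξ
  have hint : ∀ {w : L2 d} {W : ℤ × Tan d → ℝ≥0∞}, HatDom N σ w W → Measurable W →
      l2 (freqMeasure d) W ≠ ∞ → ∀ l, ∫⁻ ξ, ‖hat (dTheta w) l ξ‖ₑ =
        ENNReal.ofReal |(l : ℝ)| * ∫⁻ ξ, ‖hat w l ξ‖ₑ := by
    intro w W hw hWm hW l
    rw [← lintegral_const_mul _ (measurable_hat w l).enorm]
    refine lintegral_congr_ae ?_
    filter_upwards [hw.hat_dTheta hσ hWm hW l] with ξ h1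
    rw [h1, enorm_mul, enorm_derivative_le]
  have hut := hu.tsum_jap_mul_lintegral_ne_top hσ.le he hN hUm hU
  have hvt := hv.tsum_lintegral_ne_top hσ.le he hN hVm hV
  have hut' := hu.tsum_lintegral_ne_top hσ.le he hN hUm hU
  obtain ⟨M, hMm, hM, hconv⟩ := hu.exists_one_add_len_mul_conv_le
    (coeffBound_perDerivCoeff hC hm h) hC.le he hN hσ hv hUm hVm hU hV
  have hmain := hat_Fper (u := dTheta u) (v := dTheta v) (δ₁ := δ₁) (δ₃ := δ₃) ?_ ?_ ?_ ?_ l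
  · filter_upwards [hmain] with ξ h1
    rw [h1, hconvd]
  · intro l
    rw [hint hu hUm hU]
    exact ENNReal.mul_ne_top ENNReal.ofReal_ne_top
      (ne_top_of_le_ne_top hut' (ENNReal.le_tsum l))
  · intro l
    rw [hint hv hVm hV]
    exact ENNReal.mul_ne_top ENNReal.ofReal_ne_top
      (ne_top_of_le_ne_top hvt (ENNReal.le_tsum l))
  · intro l
    refine ne_top_of_le_ne_top (b := ENNReal.ofReal (C * (1 + |(l : ℝ)|)) *
      ((∑' l₁ : ℤ, ENNReal.ofReal (jap l₁ ^ (m + 2)) * ∫⁻ ξ, ‖hat u l₁ ξ‖ₑ) *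
        ∑' l₃ : ℤ, ∫⁻ ξ, ‖hat v l₃ ξ‖ₑ))
      (ENNReal.mul_ne_top ENNReal.ofReal_ne_top (ENNReal.mul_ne_top hut hvt)) ?_
    rw [← ENNReal.tsum_mul_right, ← ENNReal.tsum_mul_left]
    refine ENNReal.tsum_le_tsum fun l₁ => ?_
    rw [hint hu hUm hU, hint hv hVm hV]
    have h1 : ‖perCoeff δ₁ δ₃ l₁ (l - l₁)‖ₑ *
        (ENNReal.ofReal |(l₁ : ℝ)| * ENNReal.ofReal |((l - l₁ : ℤ) : ℝ)|) ≤
        ENNReal.ofReal (C * (1 + |(l : ℝ)|)) * ENNReal.ofReal (jap l₁ ^ (m + 2)) := by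
      have h2 := norm_perDerivCoeff_le hC h l₁ (l - l₁)
      rw [add_sub_cancel] at h2
      rw [← enorm_derivative_le, ← enorm_derivative_le, ← enorm_mul, ← enorm_mul, ← ofReal_norm,
        ← ENNReal.ofReal_mul (by positivity)]
      refine ENNReal.ofReal_le_ofReal (h2.trans ?_)
      have hmin : 0 ≤ min |(l₁ : ℝ)| |((l - l₁ : ℤ) : ℝ)| := le_min (abs_nonneg _) (abs_nonneg _)
      gcongr
      exact (min_le_left _ _).trans (abs_le_jap _)
    calc _ = ‖perCoeff δ₁ δ₃ l₁ (l - l₁)‖ₑ *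
          (ENNReal.ofReal |(l₁ : ℝ)| * ENNReal.ofReal |((l - l₁ : ℤ) : ℝ)|) *
          ((∫⁻ ξ, ‖hat u l₁ ξ‖ₑ) * ∫⁻ ξ, ‖hat v (l - l₁) ξ‖ₑ) := by ring
      _ ≤ ENNReal.ofReal (C * (1 + |(l : ℝ)|)) * ENNReal.ofReal (jap l₁ ^ (m + 2)) *
          ((∫⁻ ξ, ‖hat u l₁ ξ‖ₑ) * ∑' l₃ : ℤ, ∫⁻ ξ, ‖hat v l₃ ξ‖ₑ) := by
          gcongr
          exact ENNReal.le_tsum _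
      _ = _ := by ring
  · refine lintegral_tsum_sq_ne_top (measurable_conv (measurable_hat _) (measurable_hat _)) hM
      (Eventually.of_forall fun q => le_trans ?_ (hconv q))
    rw [hconvd]
    refine le_mul_of_one_le_left zero_le ?_
    rw [← ENNReal.ofReal_one]
    exact ENNReal.ofReal_le_ofReal (by linarith [len_nonneg q.1 q.2])

end RhsFourier

/-! ### The right-hand side on the Fourier side. -/

section RhsDifference

variable {d : ℕ}

/-- The telescoping requires absolutely convergent integrals. The weighted convolutions `wconv` that
bound them are finite only almost everywhere, because they are square integrable. -/
theorem HatDom.ae_conv_sub_le {β : ℤ → ℤ → ℂ} {e C : ℝ} (hβ : CoeffBound β e C) (hC : 0 ≤ C)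
    (he : 0 ≤ e) {N : ℕ} (hN : l2 (freqMeasure d) (freqWeight d (N - e)) ≠ ∞)
    {σ : ℝ} (hσ : 0 ≤ σ) {u v u' v' : L2 d} {U V U' V' DU DV : ℤ × Tan d → ℝ≥0∞}
    (hu : HatDom N σ u U) (hv : HatDom N σ v V) (hu' : HatDom N σ u' U') (hv' : HatDom N σ v' V')
    (hdu : ∀ᵐ q ∂freqMeasure d, ‖hat u q.1 q.2 - hat u' q.1 q.2‖ₑ ≤ decay N σ q * DU q)
    (hdv : ∀ᵐ q ∂freqMeasure d, ‖hat v q.1 q.2 - hat v' q.1 q.2‖ₑ ≤ decay N σ q * DV q)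
    (hUm : Measurable U) (hVm : Measurable V) (hUm' : Measurable U') (hVm' : Measurable V')
    (hU : l2 (freqMeasure d) U ≠ ∞) (hV : l2 (freqMeasure d) V ≠ ∞)
    (hU' : l2 (freqMeasure d) U' ≠ ∞) (hV' : l2 (freqMeasure d) V' ≠ ∞) :
    ∀ᵐ q ∂freqMeasure d,
      ‖conv β (hat u) (hat v) q.1 q.2 - conv β (hat u') (hat v') q.1 q.2‖ₑ ≤
      ENNReal.ofReal (C * 2 ^ N * (1 + |(q.1 : ℝ)|)) * decay N σ q *
        (wconv (freqMeasure d) (freqWeight d (N - e)) DU V q +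
          wconv (freqMeasure d) (freqWeight d (N - e)) U' DV q) := by
  have hg := measurable_freqWeight (d := d) (N - e)
  have hfin : ∀ {X Y : ℤ × Tan d → ℝ≥0∞}, Measurable X → Measurable Y →
      l2 (freqMeasure d) X ≠ ∞ → l2 (freqMeasure d) Y ≠ ∞ →
      ∀ᵐ q ∂freqMeasure d, wconv (freqMeasure d) (freqWeight d (N - e)) X Y q < ∞ := by
    intro X Y hXm hYm hX hY
    refine ae_lt_top_of_l2 (measurable_wconv hg hXm hYm)
      (ne_top_of_le_ne_top ?_ (l2_wconv_le hg hXm hYm))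
    exact ENNReal.mul_ne_top (ENNReal.mul_ne_top (by norm_num) hN) (ENNReal.mul_ne_top hX hY)
  have hdec : ∀ q : ℤ × Tan d, decay N σ q ≠ ∞ := fun q => ENNReal.ofReal_ne_top
  filter_upwards [hfin hUm hVm hU hV, hfin hUm' hVm' hU' hV'] with q h1 h2
  refine (enorm_conv_sub_le β (measurable_hat u) (measurable_hat v) (measurable_hat u')
    (measurable_hat v')
    (ne_top_of_le_ne_top ?_ (hβ.lintegral_le hC he hσ hu hv q))
    (ne_top_of_le_ne_top ?_ (hβ.lintegral_le hC he hσ hu' hv' q))).trans ?_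
  · exact ENNReal.mul_ne_top (ENNReal.mul_ne_top ENNReal.ofReal_ne_top (hdec q)) h1.ne
  · exact ENNReal.mul_ne_top (ENNReal.mul_ne_top ENNReal.ofReal_ne_top (hdec q)) h2.ne
  rw [mul_add]
  exact add_le_add (hβ.lintegral_le hC he hσ hdu hv q) (hβ.lintegral_le hC he hσ hu' hdv q)

/-- The Fourier transform of the right-hand side of the model. -/
def rhsHat (c : Coeffs d) (a : Fin 2 → ℕ+ → ℤ → Tan d → ℂ) (ζ : Fin 2) (n : ℕ+)
    (l : ℤ) (ξ : Tan d) : ℂ :=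
  Complex.I * ((inner ℝ (c.v ζ) ξ : ℝ) : ℂ) * a ζ n l ξ
    - c.D ζ * fourierConst d * conv derivCoeff (a ζ 1) (a ζ n) l ξ
    - c.w ζ * fourierConst d * conv (perDerivCoeff (c.δ₁ ζ) (c.δ₃ ζ)) (a ζ 1) (a ζ n) l ξ
    + c.K ζ * fourierConst d * ∑ k ∈ Finset.Iio n, conv derivCoeff (a 0 k) (a 1 (n - k)) l ξ

/-- The small divisors estimate with the constant `C`. -/
def SmallDivisorBound (c : Coeffs d) (m C : ℝ) : Prop :=
  ∀ ζ : Fin 2, ∀ l₁ l₃ : ℤ, l₁ ≠ 0 → l₃ ≠ 0 →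
    (l₁ : ℝ) * c.δ₁ ζ + (l₃ : ℝ) * c.δ₃ ζ ≠ 0 ∧
    1 / |(l₁ : ℝ) * c.δ₁ ζ + (l₃ : ℝ) * c.δ₃ ζ| ≤ C * min (|(l₁ : ℝ)| ^ m) (|(l₃ : ℝ)| ^ m)

theorem hat_rhs {c : Coeffs d} {m C : ℝ} (hC : 0 < C) (hm : 0 ≤ m) (h : SmallDivisorBound c m C)
    {N : ℕ} (hN : l2 (freqMeasure d) (freqWeight d (N - (m + 2))) ≠ ∞) {σ : ℝ} (hσ : 0 < σ)
    {a : Profiles d} (ha : ∀ ζ n, ∃ V, Measurable V ∧ l2 (freqMeasure d) V ≠ ∞ ∧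
      HatDom N σ (a ζ n) V) (H : Profiles d) (ζ : Fin 2) (n : ℕ+) (l : ℤ) :
    ∀ᵐ ξ : Tan d, hat (rhs c H a ζ n) l ξ =
      rhsHat c (fun ζ n => hat (a ζ n)) ζ n l ξ + hat (H ζ n) l ξ := by
  choose V hVm hV ha using ha
  have he : 0 ≤ m + 2 := by linarith
  have h1 := (ha ζ n).hat_dirDeriv hσ (hVm ζ n) (hV ζ n) (c.v ζ) l
  have h2 := (ha ζ 1).hat_dTheta_mul he hN hσ (ha ζ n) (hVm ζ 1) (hVm ζ n) (hV ζ 1) (hV ζ n)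
    (c.D ζ) l
  have h3 := (ha ζ 1).hat_Fper_dTheta hC hm (h ζ) hN hσ (ha ζ n) (hVm ζ 1) (hVm ζ n)
    (hV ζ 1) (hV ζ n) l
  have h4 : ∀ k : ℕ+, ∀ᵐ ξ : Tan d, hat (dTheta (mul (a 0 k) (a 1 (n - k)))) l ξ =
      fourierConst d * conv derivCoeff (hat (a 0 k)) (hat (a 1 (n - k))) l ξ := by
    intro k
    have := (ha 0 k).hat_dTheta_mul he hN hσ (ha 1 (n - k)) (hVm 0 k) (hVm 1 (n - k))
      (hV 0 k) (hV 1 (n - k)) 1 l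
    simpa only [one_smul, one_mul] using this
  set u₁ := dirDeriv (c.v ζ) (a ζ n)
  set u₂ := dTheta (c.D ζ • mul (a ζ 1) (a ζ n))
  set u₃ := Fper (c.δ₁ ζ) (c.δ₃ ζ) (dTheta (a ζ 1)) (dTheta (a ζ n))
  set u₄ := ∑ k ∈ Finset.Iio n, dTheta (mul (a 0 k) (a 1 (n - k))) with hu₄
  have hr : rhs c H a ζ n = u₁ - u₂ - (c.w ζ : ℂ) • u₃ + H ζ n + (c.K ζ : ℂ) • u₄ := rfl
  rw [hr]
  filter_upwards [h1, h2, h3, ae_all_iff.2 h4,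
    hat_add (u₁ - u₂ - (c.w ζ : ℂ) • u₃ + H ζ n) ((c.K ζ : ℂ) • u₄) l,
    hat_add (u₁ - u₂ - (c.w ζ : ℂ) • u₃) (H ζ n) l, hat_sub (u₁ - u₂) ((c.w ζ : ℂ) • u₃) l,
    hat_sub u₁ u₂ l, hat_smul (c.w ζ : ℂ) u₃ l, hat_smul (c.K ζ : ℂ) u₄ l,
    hat_sum (Finset.Iio n) (fun k => dTheta (mul (a 0 k) (a 1 (n - k)))) l]
    with ξ g1 g2 g3 g4 g5 g6 g7 g8 g9 g10 g11
  rw [← hu₄] at g11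
  rw [g5, g6, g7, g8, g9, g10, g1, g2, g3, g11, Finset.sum_congr rfl fun k _ => g4 k,
    ← Finset.mul_sum, rhsHat]
  ring

end RhsDifference

/-! ### The spaces `𝐘_s²` as weighted `L²` spaces. -/

section Embedding

variable {d : ℕ}

instance : MeasurableSpace ℕ+ := ⊤

instance : DiscreteMeasurableSpace ℕ+ := ⟨fun _ => trivial⟩

/-- The frequency variables `((ζ, n), (l, ξ))`. -/
abbrev Freq (d : ℕ) := (Fin 2 × ℕ+) × (ℤ × Tan d)

/-- The measure on the frequency variables. -/
abbrev modelMeasure (d : ℕ) : Measure (Freq d) := Measure.count.prod (freqMeasure d)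

theorem lintegral_model {f : Freq d → ℝ≥0∞} (hf : Measurable f) :
    ∫⁻ x, f x ∂modelMeasure d = ∑' i : Fin 2 × ℕ+, ∫⁻ q, f (i, q) ∂freqMeasure d := by
  rw [lintegral_prod _ hf.aemeasurable, lintegral_count]

theorem ae_model_iff {p : Freq d → Prop} (hp : MeasurableSet {x | p x}) :
    (∀ᵐ x ∂modelMeasure d, p x) ↔ ∀ i, ∀ᵐ q ∂freqMeasure d, p (i, q) := by
  rw [Measure.ae_prod_iff_ae_ae hp, Measure.ae_count_iff]

theorem ae_of_ae_model {p : Freq d → Prop} (h : ∀ᵐ x ∂modelMeasure d, p x) (i : Fin 2 × ℕ+) :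
    ∀ᵐ q ∂freqMeasure d, p (i, q) := by
  have := Measure.ae_ae_of_ae_prod h
  rw [Measure.ae_count_iff] at this
  exact this i

theorem ae_of_ae_freq {p : ℤ × Tan d → Prop} (h : ∀ᵐ q ∂freqMeasure d, p q) (l : ℤ) :
    ∀ᵐ ξ : Tan d, p (l, ξ) := by
  have := Measure.ae_ae_of_ae_prod h
  rw [Measure.ae_count_iff] at this
  exact this l

/-- The size `n + |(l,ξ)|` of a frequency. -/
def radius (x : Freq d) : ℝ := (x.1.2 : ℝ) + len x.2.1 x.2.2

theorem one_le_radius (x : Freq d) : 1 ≤ radius x := by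
  have h1 : (1 : ℝ) ≤ (x.1.2 : ℝ) := by exact_mod_cast x.1.2.pos
  linarith [len_nonneg x.2.1 x.2.2, show radius x = (x.1.2 : ℝ) + len x.2.1 x.2.2 from rfl]

theorem measurable_radius : Measurable (radius (d := d)) :=
  ((measurable_of_countable (f := fun i : Fin 2 × ℕ+ => ((i.2 : ℕ) : ℝ))).comp measurable_fst).add
    (measurable_len.comp measurable_snd)

/-- The weight of the space `𝐘_s²`. -/
def weight (N : ℕ) (s : ℝ) (x : Freq d) : ℝ :=
  Real.exp (s * radius x) * (jap (x.1.2 : ℝ) ^ N * jap (len x.2.1 x.2.2) ^ N)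

theorem weight_pos (N : ℕ) (s : ℝ) (x : Freq d) : 0 < weight N s x := by
  have h1 := jap_pos (x.1.2 : ℝ)
  have h2 := jap_pos (len x.2.1 x.2.2)
  rw [weight]
  positivity

theorem measurable_weight (N : ℕ) (s : ℝ) : Measurable (weight (d := d) N s) := by
  refine (measurable_radius.const_mul s).exp.mul (Measurable.mul ?_ ?_)
  · exact (measurable_of_countable (f := fun i : Fin 2 × ℕ+ => jap ((i.2 : ℕ) : ℝ) ^ N)).comp
      measurable_fst
  · exact (measurable_jap_len.pow_const N).comp measurable_snd

theorem weight_eq_exp_mul (N : ℕ) (s s' : ℝ) (x : Freq d) :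
    weight N s x = Real.exp ((s - s') * radius x) * weight N s' x := by
  have h : s * radius x = (s - s') * radius x + s' * radius x := by ring
  rw [weight, weight, h, Real.exp_add, mul_assoc]

theorem one_le_weight (N : ℕ) {s : ℝ} (hs : 0 ≤ s) (x : Freq d) : 1 ≤ weight N s x := by
  have h0 : 0 ≤ radius x := zero_le_one.trans (one_le_radius x)
  exact one_le_mul_of_one_le_of_one_le (Real.one_le_exp (by positivity))
    (one_le_mul_of_one_le_of_one_le (one_le_pow₀ (one_le_jap _)) (one_le_pow₀ (one_le_jap _)))

/-- The weighted Fourier transform of a pair of sequences. -/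
def coord (N : ℕ) (s : ℝ) (a : Profiles d) (x : Freq d) : ℂ :=
  (weight N s x : ℂ) * hat (a x.1.1 x.1.2) x.2.1 x.2.2

theorem measurable_hat_profile (a : Profiles d) :
    Measurable fun x : Freq d => hat (a x.1.1 x.1.2) x.2.1 x.2.2 :=
  measurable_from_prod_countable_right fun i => measurable_uncurry_freq (measurable_hat (a i.1 i.2))

theorem measurable_coord (N : ℕ) (s : ℝ) (a : Profiles d) : Measurable (coord N s a) :=
  (Complex.measurable_ofReal.comp (measurable_weight N s)).mul (measurable_hat_profile a)

/-- Plain bookkeeping by Tonelli, but it is what replaces the whole scale of spaces by a single `L²`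
space. -/
theorem normYY_eq (N : ℕ) (s : ℝ) (a : Profiles d) :
    normYY N s a = l2 (modelMeasure d) fun x => ‖coord N s a x‖ₑ := by
  rw [normYY, l2]
  congr 1
  have hm : Measurable fun x => ‖coord N s a x‖ₑ ^ 2 := (measurable_coord N s a).enorm.pow_const 2
  rw [lintegral_model hm, ENNReal.tsum_prod (f := fun ζ n => ∫⁻ q, ‖coord N s a ((ζ, n), q)‖ₑ ^ 2
    ∂freqMeasure d), tsum_fintype]
  refine Finset.sum_congr rfl fun ζ _ => tsum_congr fun n => ?_
  have hY : normY N s (a ζ n) ^ 2 = ∫⁻ ξ : Tan d, ∑' l : ℤ, ENNReal.ofReal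
      (Real.exp (2 * s * len l ξ) * jap (len l ξ) ^ (2 * N) * ‖hat (a ζ n) l ξ‖ ^ 2) := by
    rw [normY, ← ENNReal.rpow_natCast, ← ENNReal.rpow_mul]
    norm_num
  have hmY : ∀ l : ℤ, Measurable fun ξ : Tan d => ENNReal.ofReal
      (Real.exp (2 * s * len l ξ) * jap (len l ξ) ^ (2 * N) * ‖hat (a ζ n) l ξ‖ ^ 2) := by
    intro l
    have h1 : Measurable fun ξ : Tan d => len l ξ := measurable_len.comp measurable_prodMk_left
    have h2 : Measurable fun ξ : Tan d => jap (len l ξ) := continuous_jap.measurable.comp h1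
    exact (((h1.const_mul (2 * s)).exp.mul (h2.pow_const _)).mul
      ((measurable_hat (a ζ n) l).norm.pow_const 2)).ennreal_ofReal
  have hq : Measurable fun q : ℤ × Tan d => ‖coord N s a ((ζ, n), q)‖ₑ ^ 2 :=
    ((measurable_coord N s a).comp measurable_prodMk_left).enorm.pow_const 2
  rw [hY, lintegral_freq hq, lintegral_tsum fun l => (hmY l).aemeasurable,
    ← ENNReal.tsum_mul_left]
  refine tsum_congr fun l => ?_
  rw [← lintegral_const_mul _ (hmY l)]
  refine lintegral_congr fun ξ => ?_
  have h1 := jap_pos (n : ℝ)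
  have h2 := jap_pos (len l ξ)
  rw [← ENNReal.ofReal_mul (by positivity), coord, ← ofReal_norm, ← ENNReal.ofReal_pow
    (norm_nonneg _), norm_mul, Complex.norm_real, Real.norm_of_nonneg (weight_pos N s _).le, weight,
    radius]
  congr 1
  simp only [mul_pow, ← Real.exp_nat_mul, mul_add, Real.exp_add, ← pow_mul]
  push_cast
  ring_nf

/-- The `L²` space on the frequency side. -/
abbrev FreqL2 (d : ℕ) := Lp ℂ 2 (modelMeasure d)

open Classical in
/-- The isometric image in `L²` of an element of `𝐘_s²`. -/
def embed (N : ℕ) (s : ℝ) (a : Profiles d) : FreqL2 d :=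
  if h : MemLp (coord N s a) 2 (modelMeasure d) then h.toLp _ else 0

theorem memLp_coord {N : ℕ} {s : ℝ} {a : Profiles d} (h : normYY N s a ≠ ∞) :
    MemLp (coord N s a) 2 (modelMeasure d) := by
  rw [normYY_eq] at h
  exact memLp_of_l2 (measurable_coord N s a).aestronglyMeasurable
    (Eventually.of_forall fun x => le_rfl) h

theorem coeFn_embed {N : ℕ} {s : ℝ} {a : Profiles d} (h : normYY N s a ≠ ∞) :
    ∀ᵐ x ∂modelMeasure d, embed N s a x = coord N s a x := by
  rw [embed, dif_pos (memLp_coord h)]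
  exact (memLp_coord h).coeFn_toLp

theorem enorm_embed {N : ℕ} {s : ℝ} {a : Profiles d} (h : normYY N s a ≠ ∞) :
    ‖embed N s a‖ₑ = normYY N s a := by
  rw [← l2_enorm_eq, normYY_eq]
  refine l2_congr_ae ?_
  filter_upwards [coeFn_embed h] with x hx
  rw [hx]

theorem ae_profile {p : Freq d → Prop} (hp : MeasurableSet {x | p x})
    (h : ∀ ζ n l, ∀ᵐ ξ : Tan d, p ((ζ, n), (l, ξ))) : ∀ᵐ x ∂modelMeasure d, p x :=
  (ae_model_iff hp).2 fun i => (ae_freq_iff (measurable_prodMk_left hp)).2 (h i.1 i.2)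

theorem coord_sub (N : ℕ) (s : ℝ) (a b : Profiles d) :
    ∀ᵐ x ∂modelMeasure d, coord N s (a - b) x = coord N s a x - coord N s b x := by
  refine ae_profile (measurableSet_eq_fun (measurable_coord N s _)
    ((measurable_coord N s a).sub (measurable_coord N s b))) fun ζ n l => ?_
  filter_upwards [hat_sub (a ζ n) (b ζ n) l] with ξ h
  simp only [coord, ← mul_sub, ← h]
  rfl

theorem coord_smul (N : ℕ) (s : ℝ) (k : ℂ) (a : Profiles d) :
    ∀ᵐ x ∂modelMeasure d, coord N s (k • a) x = k * coord N s a x := by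
  refine ae_profile (measurableSet_eq_fun (measurable_coord N s _)
    ((measurable_coord N s a).const_mul k)) fun ζ n l => ?_
  filter_upwards [hat_smul k (a ζ n) l] with ξ h
  simp only [coord]
  rw [mul_left_comm, ← h]
  rfl

theorem normYY_sub_le (N : ℕ) (s : ℝ) (a b : Profiles d) :
    normYY N s (a - b) ≤ normYY N s a + normYY N s b := by
  simp only [normYY_eq]
  refine le_trans (l2_mono_ae ?_) (l2_add_le (measurable_coord N s a).enorm.aemeasurable
    (measurable_coord N s b).enorm.aemeasurable)
  filter_upwards [coord_sub N s a b] with x hx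
  rw [hx]
  exact enorm_sub_le

theorem normYY_smul (N : ℕ) (s : ℝ) (k : ℂ) (a : Profiles d) :
    normYY N s (k • a) = ‖k‖ₑ * normYY N s a := by
  simp only [normYY_eq]
  rw [← l2_const_mul _ (measurable_coord N s a).enorm.aemeasurable]
  refine l2_congr_ae ?_
  filter_upwards [coord_smul N s k a] with x hx
  rw [hx, enorm_mul]

theorem normYY_sub_ne_top {N : ℕ} {s : ℝ} {a b : Profiles d} (ha : normYY N s a ≠ ∞)
    (hb : normYY N s b ≠ ∞) : normYY N s (a - b) ≠ ∞ :=
  ne_top_of_le_ne_top (ENNReal.add_ne_top.2 ⟨ha, hb⟩) (normYY_sub_le N s a b)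

theorem embed_sub {N : ℕ} {s : ℝ} {a b : Profiles d} (ha : normYY N s a ≠ ∞)
    (hb : normYY N s b ≠ ∞) : embed N s (a - b) = embed N s a - embed N s b := by
  refine Lp.ext ?_
  filter_upwards [coeFn_embed ha, coeFn_embed hb, coeFn_embed (normYY_sub_ne_top ha hb),
    coord_sub N s a b, Lp.coeFn_sub (embed N s a) (embed N s b)] with x h1 h2 h3 h4 h5
  rw [h3, h4, h5, Pi.sub_apply, h1, h2]

theorem embed_smul {N : ℕ} {s : ℝ} {a : Profiles d} (k : ℂ) (ha : normYY N s a ≠ ∞) :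
    embed N s (k • a) = k • embed N s a := by
  have hk : normYY N s (k • a) ≠ ∞ := by
    rw [normYY_smul]
    exact ENNReal.mul_ne_top enorm_ne_top ha
  refine Lp.ext ?_
  filter_upwards [coeFn_embed ha, coeFn_embed hk, coord_smul N s k a,
    Lp.coeFn_smul k (embed N s a)] with x h1 h2 h3 h4
  rw [h2, h3, h4, Pi.smul_apply, h1, smul_eq_mul]

theorem eq_of_coord {N : ℕ} {s : ℝ} {a b : Profiles d}
    (h : ∀ᵐ x ∂modelMeasure d, coord N s a x = coord N s b x) : a = b := by
  funext ζ n
  refine eq_of_hat fun l => ?_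
  filter_upwards [ae_of_ae_freq (ae_of_ae_model h (ζ, n)) l] with ξ hξ
  simp only [coord] at hξ
  exact mul_left_cancel₀ (Complex.ofReal_ne_zero.2 (weight_pos N s _).ne') hξ

theorem eq_of_embed {N : ℕ} {s : ℝ} {a b : Profiles d} (ha : normYY N s a ≠ ∞)
    (hb : normYY N s b ≠ ∞) (h : embed N s a = embed N s b) : a = b := by
  refine eq_of_coord (N := N) (s := s) ?_
  filter_upwards [coeFn_embed ha, coeFn_embed hb] with x h1 h2
  rw [← h1, ← h2, h]

/-- For `s ≥ 0` the weight is at least `1`, so dividing by it keeps each slice square integrable and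
defines genuine profiles. -/
theorem exists_coord_eq (N : ℕ) {s : ℝ} (hs : 0 ≤ s) (f : FreqL2 d) :
    ∃ a : Profiles d, ∀ᵐ x ∂modelMeasure d, coord N s a x = f x := by
  have hfm : Measurable f := (Lp.stronglyMeasurable f).measurable
  have hwm : Measurable fun x : Freq d => (weight N s x : ℂ)⁻¹ :=
    (Complex.measurable_ofReal.comp (measurable_weight N s)).inv
  have hm : Measurable fun x : Freq d => (weight N s x : ℂ)⁻¹ * f x := hwm.mul hfm
  have hf : ∫⁻ x, ‖f x‖ₑ ^ 2 ∂modelMeasure d ≠ ∞ := by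
    rw [← l2_sq, l2_enorm_eq]
    exact ENNReal.pow_ne_top enorm_ne_top
  rw [lintegral_model (hfm.enorm.pow_const 2)] at hf
  have hex : ∀ (ζ : Fin 2) (n : ℕ+), ∃ u : L2 d, ∀ l, ∀ᵐ ξ : Tan d, hat u l ξ =
      (weight N s ((ζ, n), (l, ξ)) : ℂ)⁻¹ * f ((ζ, n), (l, ξ)) := by
    intro ζ n
    have hml : ∀ l, Measurable fun ξ : Tan d =>
        (weight N s ((ζ, n), (l, ξ)) : ℂ)⁻¹ * f ((ζ, n), (l, ξ)) := fun l =>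
      hm.comp (measurable_prodMk_left.comp measurable_prodMk_left)
    refine exists_hat_eq hml (lintegral_tsum_sq_ne_top (V := fun q => ‖f ((ζ, n), q)‖ₑ) hml ?_
      (Eventually.of_forall fun q => ?_))
    · have h1 := ne_top_of_le_ne_top hf (ENNReal.le_tsum (ζ, n))
      rw [← l2_sq] at h1
      exact fun h2 => h1 (by rw [h2]; rfl)
    · rw [enorm_mul]
      refine mul_le_of_le_one_left zero_le ?_
      have h1 := one_le_weight N hs ((ζ, n), q)
      rw [← ofReal_norm, norm_inv, Complex.norm_real, Real.norm_of_nonneg (by linarith),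
        ← ENNReal.ofReal_one]
      exact ENNReal.ofReal_le_ofReal (inv_le_one_of_one_le₀ h1)
  choose a ha using hex
  refine ⟨a, ae_profile (measurableSet_eq_fun (measurable_coord N s _) hfm) fun ζ n l => ?_⟩
  filter_upwards [ha ζ n l] with ξ h
  simp only [coord, h]
  rw [mul_inv_cancel_left₀ (Complex.ofReal_ne_zero.2 (weight_pos N s _).ne')]

/-- The element of `𝐘_s²` with a given image in `L²`. -/
def unembed (N : ℕ) (s : ℝ) (f : FreqL2 d) : Profiles d :=
  if hs : 0 ≤ s then (exists_coord_eq N hs f).choose else 0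

theorem coord_unembed (N : ℕ) {s : ℝ} (hs : 0 ≤ s) (f : FreqL2 d) :
    ∀ᵐ x ∂modelMeasure d, coord N s (unembed N s f) x = f x := by
  rw [unembed, dif_pos hs]
  exact (exists_coord_eq N hs f).choose_spec

theorem normYY_unembed_ne_top (N : ℕ) {s : ℝ} (hs : 0 ≤ s) (f : FreqL2 d) :
    normYY N s (unembed N s f) ≠ ∞ := by
  rw [normYY_eq, l2_congr_ae (V := fun x => ‖f x‖ₑ), l2_enorm_eq]
  · exact enorm_ne_top
  · filter_upwards [coord_unembed N hs f] with x hx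
    rw [hx]

theorem embed_unembed (N : ℕ) {s : ℝ} (hs : 0 ≤ s) (f : FreqL2 d) :
    embed N s (unembed N s f) = f := by
  refine Lp.ext ?_
  filter_upwards [coeFn_embed (normYY_unembed_ne_top N hs f), coord_unembed N hs f] with x h1 h2
  rw [h1, h2]

theorem unembed_embed {N : ℕ} {s : ℝ} (hs : 0 ≤ s) {a : Profiles d} (ha : normYY N s a ≠ ∞) :
    unembed N s (embed N s a) = a :=
  eq_of_embed (normYY_unembed_ne_top N hs _) ha (embed_unembed N hs _)

end Embedding

/-! ### Convolution of sequences indexed by `n ≥ 1`. -/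

section Sequences

theorem sum_Iio_reflect {M : Type*} [AddCommMonoid M] (n : ℕ+) (F : ℕ+ → ℕ+ → M) :
    ∑ k ∈ Finset.Iio n, F k (n - k) = ∑ k ∈ Finset.Iio n, F (n - k) k := by
  have h : ∀ k ∈ Finset.Iio n, n - k ∈ Finset.Iio n ∧ n - (n - k) = k := by
    intro k hk
    rw [Finset.mem_Iio] at hk
    have h1 : ((n - k : ℕ+) : ℕ) = n - k := by rw [PNat.sub_coe, if_pos hk]
    have h2 : n - k < n := by
      rw [← PNat.coe_lt_coe, h1]
      have := k.pos
      have := n.pos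
      omega
    refine ⟨Finset.mem_Iio.2 h2, PNat.eq ?_⟩
    rw [PNat.sub_coe, if_pos h2, h1]
    have : (k : ℕ) < n := hk
    omega
  refine Finset.sum_nbij' (fun k => n - k) (fun k => n - k) (fun k hk => (h k hk).1)
    (fun k hk => (h k hk).1) (fun k hk => (h k hk).2) (fun k hk => (h k hk).2) fun k hk => ?_
  rw [(h k hk).2]

theorem l2_count_sq {ι : Type*} [MeasurableSpace ι] [MeasurableSingletonClass ι] (f : ι → ℝ≥0∞) :
    l2 Measure.count f ^ 2 = ∑' i, f i ^ 2 := by rw [l2_sq, lintegral_count]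

theorem le_of_sq_le_sq {a b : ℝ≥0∞} (h : a ^ 2 ≤ b ^ 2) : a ≤ b :=
  (ENNReal.pow_le_pow_left_iff (by norm_num)).1 h

/-- Young's inequality for sequences. -/
theorem l2_sum_Iio_le (f R : ℕ+ → ℝ≥0∞) :
    l2 Measure.count (fun n : ℕ+ => ∑ k ∈ Finset.Iio n, f k * R (n - k)) ≤
      (∑' k, f k) * l2 Measure.count R := by
  -- The sum is extended by zero to all `k` and indexed by `ℕ`, so that the triangle inequality for
  -- series applies; each term is then `f k` times a shift of `R`.
  have h1 : ∀ n : ℕ+, ∑ k ∈ Finset.Iio n, f k * R (n - k) =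
      ∑' j : ℕ, if Equiv.pnatEquivNat.symm j < n then
        f (Equiv.pnatEquivNat.symm j) * R (n - Equiv.pnatEquivNat.symm j) else 0 := by
    intro n
    rw [Equiv.tsum_eq Equiv.pnatEquivNat.symm
      (fun k : ℕ+ => if k < n then f k * R (n - k) else 0),
      tsum_eq_sum (s := Finset.Iio n)]
    · exact Finset.sum_congr rfl fun k hk => (if_pos (Finset.mem_Iio.1 hk)).symm
    · intro k hk
      exact if_neg fun h => hk (Finset.mem_Iio.2 h)
  simp only [h1]
  refine (l2_tsum_le fun j => measurable_of_countable _).trans ?_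
  rw [← Equiv.tsum_eq Equiv.pnatEquivNat.symm f, ← ENNReal.tsum_mul_right]
  refine ENNReal.tsum_le_tsum fun j => ?_
  set k := Equiv.pnatEquivNat.symm j
  refine le_of_sq_le_sq ?_
  rw [mul_pow, l2_count_sq, l2_count_sq, ← ENNReal.tsum_mul_left]
  refine le_of_eq ?_
  rw [← (add_left_injective k).tsum_eq]
  · refine tsum_congr fun m => ?_
    rw [if_pos (PNat.lt_add_left k m), PNat.add_sub, mul_pow]
  · intro n hn
    rw [Function.mem_support] at hn
    have hk : k < n := by
      by_contra h
      exact hn (by rw [if_neg h]; norm_num)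
    exact ⟨n - k, PNat.sub_add_of_lt hk⟩

/-- The weight of the indices `n`. -/
def seqWeight (N : ℕ) (n : ℕ+) : ℝ≥0∞ := ENNReal.ofReal ((jap (n : ℝ) ^ N)⁻¹)

theorem l2_seqWeight_ne_top {N : ℕ} (hN : 1 ≤ N) :
    l2 (Measure.count : Measure ℕ+) (seqWeight N) ≠ ∞ := by
  have h0 : ∫⁻ n, seqWeight N n ^ 2 ∂(Measure.count : Measure ℕ+) ≠ ∞ := by
    rw [lintegral_count]
    have h1 : Summable fun n : ℕ+ => 1 / (((n : ℕ) : ℝ)) ^ 2 :=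
      (Real.summable_one_div_nat_pow.2 (by norm_num)).comp_injective PNat.coe_injective
    refine ne_top_of_le_ne_top h1.tsum_ofReal_ne_top (ENNReal.tsum_le_tsum fun n => ?_)
    have hj := jap_pos (n : ℝ)
    have hn : (0 : ℝ) < (n : ℕ) := by exact_mod_cast n.pos
    rw [seqWeight, ← ENNReal.ofReal_pow (by positivity)]
    refine ENNReal.ofReal_le_ofReal ?_
    rw [← one_div, div_pow, one_pow]
    have h2 : ((n : ℕ) : ℝ) ≤ jap (n : ℝ) ^ N :=
      ((le_abs_self _).trans (abs_le_jap _)).trans (le_self_pow₀ (one_le_jap _) (by omega))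
    gcongr
  rw [l2]
  exact (ENNReal.rpow_lt_top_of_nonneg (by norm_num) h0).ne

/-- The discrete counterpart of `l2_wconv_le`: reflection `k ↦ n - k`, Cauchy–Schwarz against the
square summable `seqWeight`, then Young. -/
theorem l2_convolution_le (N : ℕ) (X Y : ℕ+ → ℝ≥0∞) :
    l2 Measure.count (fun n : ℕ+ => ∑ k ∈ Finset.Iio n,
      (seqWeight N k + seqWeight N (n - k)) * (X k * Y (n - k))) ≤
      2 * l2 Measure.count (seqWeight N) * (l2 Measure.count X * l2 Measure.count Y) := by
  have hm : ∀ Z : ℕ+ → ℝ≥0∞, AEMeasurable Z Measure.count :=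
    fun Z => (measurable_of_countable Z).aemeasurable
  have hcs : ∀ Z : ℕ+ → ℝ≥0∞, ∑' k, seqWeight N k * Z k ≤
      l2 Measure.count (seqWeight N) * l2 Measure.count Z := by
    intro Z
    rw [← lintegral_count]
    exact lintegral_mul_le_l2 (hm _) (hm _)
  have h1 : ∀ n : ℕ+, ∑ k ∈ Finset.Iio n,
      (seqWeight N k + seqWeight N (n - k)) * (X k * Y (n - k)) =
      (∑ k ∈ Finset.Iio n, (seqWeight N k * X k) * Y (n - k)) +
      ∑ k ∈ Finset.Iio n, (seqWeight N k * Y k) * X (n - k) := by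
    intro n
    rw [← sum_Iio_reflect n (fun k j => (seqWeight N j * Y j) * X k), ← Finset.sum_add_distrib]
    refine Finset.sum_congr rfl fun k _ => ?_
    ring
  simp only [h1]
  refine (l2_add_le (hm _) (hm _)).trans ?_
  calc _ ≤ l2 Measure.count (seqWeight N) * l2 Measure.count X * l2 Measure.count Y +
        l2 Measure.count (seqWeight N) * l2 Measure.count Y * l2 Measure.count X :=
        add_le_add
          ((l2_sum_Iio_le _ _).trans (by gcongr; exact hcs X))
          ((l2_sum_Iio_le _ _).trans (by gcongr; exact hcs Y))
    _ = _ := by ring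

end Sequences

/-! ### Square integrals over the slices `(ζ, n)`. -/

section Slices

variable {d : ℕ}

theorem l2_model {U : Freq d → ℝ≥0∞} (hU : Measurable U) :
    l2 (modelMeasure d) U =
      l2 Measure.count fun i : Fin 2 × ℕ+ => l2 (freqMeasure d) fun q => U (i, q) := by
  have h : l2 (modelMeasure d) U ^ 2 =
      l2 Measure.count (fun i : Fin 2 × ℕ+ => l2 (freqMeasure d) fun q => U (i, q)) ^ 2 := by
    rw [l2_sq, lintegral_model (hU.pow_const 2), l2_count_sq]
    exact tsum_congr fun i => (l2_sq _).symm
  exact le_antisymm (le_of_sq_le_sq h.le) (le_of_sq_le_sq h.ge)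

theorem l2_slice_le {U : Freq d → ℝ≥0∞} (hU : Measurable U) (i : Fin 2 × ℕ+) :
    l2 (freqMeasure d) (fun q => U (i, q)) ≤ l2 (modelMeasure d) U := by
  refine le_of_sq_le_sq ?_
  rw [l2_model hU, l2_count_sq]
  exact ENNReal.le_tsum (f := fun i => l2 (freqMeasure d) (fun q => U (i, q)) ^ 2) i

theorem l2_slices_le {U : Freq d → ℝ≥0∞} (hU : Measurable U) (ζ : Fin 2) :
    l2 Measure.count (fun n : ℕ+ => l2 (freqMeasure d) fun q => U ((ζ, n), q)) ≤
      l2 (modelMeasure d) U := by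
  refine le_of_sq_le_sq ?_
  rw [l2_model hU, l2_count_sq, l2_count_sq]
  exact ENNReal.tsum_comp_le_tsum_of_injective (f := fun n : ℕ+ => (ζ, n))
    (fun a b h => (Prod.ext_iff.1 h).2) _

theorem l2_count_snd_le (y : ℕ+ → ℝ≥0∞) :
    l2 Measure.count (fun i : Fin 2 × ℕ+ => y i.2) ≤ 2 * l2 Measure.count y := by
  refine le_of_sq_le_sq ?_
  rw [mul_pow, l2_count_sq, l2_count_sq, ENNReal.tsum_prod (f := fun _ n => y n ^ 2), tsum_fintype,
    Fin.sum_univ_two, ← two_mul]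
  gcongr
  norm_num

end Slices

/-! ### The majorant of the right-hand side and its size. -/

section Majorant

variable {d : ℕ}

/-- The bilinear majorant of the interactions with the first profile. -/
def burgersMajorant (b : ℝ) (X Y : Freq d → ℝ≥0∞) (x : Freq d) : ℝ≥0∞ :=
  wconv (freqMeasure d) (freqWeight d b) (fun q => X ((x.1.1, 1), q)) (fun q => Y (x.1, q)) x.2

/-- The bilinear majorant of the interactions between the two sequences of profiles. -/
def crossMajorant (N : ℕ) (b : ℝ) (X Y : Freq d → ℝ≥0∞) (x : Freq d) : ℝ≥0∞ :=
  ∑ k ∈ Finset.Iio x.1.2, (seqWeight N k + seqWeight N (x.1.2 - k)) *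
    wconv (freqMeasure d) (freqWeight d b) (fun q => X ((0, k), q))
      (fun q => Y ((1, x.1.2 - k), q)) x.2

variable {N : ℕ} {b : ℝ} {X Y : Freq d → ℝ≥0∞}

theorem measurable_slice {X : Freq d → ℝ≥0∞} (hX : Measurable X) (i : Fin 2 × ℕ+) :
    Measurable fun q => X (i, q) :=
  hX.comp measurable_prodMk_left

theorem measurable_burgersMajorant (hX : Measurable X) (hY : Measurable Y) :
    Measurable (burgersMajorant b X Y) := by
  refine measurable_from_prod_countable_right fun i => ?_
  exact measurable_wconv (μ := freqMeasure d) (measurable_freqWeight b)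
    (measurable_slice hX (i.1, 1)) (measurable_slice hY i)

theorem measurable_crossMajorant (hX : Measurable X) (hY : Measurable Y) :
    Measurable (crossMajorant N b X Y) := by
  refine measurable_from_prod_countable_right fun i => ?_
  exact Finset.measurable_fun_sum (Finset.Iio i.2) fun k _ =>
    (measurable_wconv (μ := freqMeasure d) (measurable_freqWeight b) (measurable_slice hX (0, k))
      (measurable_slice hY (1, i.2 - k))).const_mul (seqWeight N k + seqWeight N (i.2 - k))

theorem l2_burgersMajorant_le (hX : Measurable X) (hY : Measurable Y) :
    l2 (modelMeasure d) (burgersMajorant b X Y) ≤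
      2 * l2 (freqMeasure d) (freqWeight d b) *
        (l2 (modelMeasure d) X * l2 (modelMeasure d) Y) := by
  rw [l2_model (measurable_burgersMajorant hX hY)]
  calc _ ≤ l2 Measure.count (fun i : Fin 2 × ℕ+ =>
        (2 * l2 (freqMeasure d) (freqWeight d b) * l2 (modelMeasure d) X) *
          l2 (freqMeasure d) fun q => Y (i, q)) := by
        refine l2_mono fun i => ?_
        refine (l2_wconv_le (μ := freqMeasure d) (measurable_freqWeight b)
          (measurable_slice hX (i.1, 1)) (measurable_slice hY i)).trans ?_
        rw [← mul_assoc]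
        gcongr
        exact l2_slice_le hX _
    _ = _ := by
        rw [l2_const_mul _ (measurable_of_countable _).aemeasurable, ← l2_model hY, mul_assoc]

/-- The constant `8` collects a factor `2` from the convolution in `(l, ξ)`, one from the
convolution in `n`, and one from the two values of `ζ`, on which this majorant does not depend. -/
theorem l2_crossMajorant_le (hX : Measurable X) (hY : Measurable Y) :
    l2 (modelMeasure d) (crossMajorant N b X Y) ≤
      8 * l2 (freqMeasure d) (freqWeight d b) * l2 Measure.count (seqWeight N) *
        (l2 (modelMeasure d) X * l2 (modelMeasure d) Y) := by
  rw [l2_model (measurable_crossMajorant hX hY)]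
  set x : ℕ+ → ℝ≥0∞ := fun n => l2 (freqMeasure d) fun q => X ((0, n), q) with hx
  set y : ℕ+ → ℝ≥0∞ := fun n => l2 (freqMeasure d) fun q => Y ((1, n), q) with hy
  have h1 : ∀ i : Fin 2 × ℕ+, l2 (freqMeasure d) (fun q => crossMajorant N b X Y (i, q)) ≤
      2 * l2 (freqMeasure d) (freqWeight d b) * ∑ k ∈ Finset.Iio i.2,
        (seqWeight N k + seqWeight N (i.2 - k)) * (x k * y (i.2 - k)) := by
    intro i
    have hw : ∀ k, Measurable (wconv (freqMeasure d) (freqWeight d b) (fun q => X ((0, k), q))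
        (fun q => Y ((1, i.2 - k), q))) := fun k =>
      measurable_wconv (measurable_freqWeight b) (measurable_slice hX _) (measurable_slice hY _)
    refine (l2_finset_sum_le (Finset.Iio i.2) fun k =>
      ((hw k).const_mul (seqWeight N k + seqWeight N (i.2 - k))).aemeasurable).trans ?_
    rw [Finset.mul_sum]
    refine Finset.sum_le_sum fun k _ => ?_
    rw [l2_const_mul _ (hw k).aemeasurable, mul_left_comm]
    gcongr
    exact l2_wconv_le (measurable_freqWeight b) (measurable_slice hX _) (measurable_slice hY _)
  calc _ ≤ l2 Measure.count (fun i : Fin 2 × ℕ+ =>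
        2 * l2 (freqMeasure d) (freqWeight d b) * ∑ k ∈ Finset.Iio i.2,
        (seqWeight N k + seqWeight N (i.2 - k)) * (x k * y (i.2 - k))) := l2_mono h1
    _ = 2 * l2 (freqMeasure d) (freqWeight d b) * l2 Measure.count (fun i : Fin 2 × ℕ+ =>
        ∑ k ∈ Finset.Iio i.2, (seqWeight N k + seqWeight N (i.2 - k)) * (x k * y (i.2 - k))) :=
        l2_const_mul _ (measurable_of_countable _).aemeasurable
    _ ≤ 2 * l2 (freqMeasure d) (freqWeight d b) * (2 * (2 * l2 Measure.count (seqWeight N) *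
        (l2 (modelMeasure d) X * l2 (modelMeasure d) Y))) := by
        gcongr
        refine (l2_count_snd_le (fun n => ∑ k ∈ Finset.Iio n,
          (seqWeight N k + seqWeight N (n - k)) * (x k * y (n - k)))).trans ?_
        gcongr
        refine (l2_convolution_le N x y).trans ?_
        gcongr
        · exact l2_slices_le hX 0
        · exact l2_slices_le hY 1
    _ = _ := by ring

/-- The majorant of a difference of two values of the right-hand side of the model. -/
def rhsMajorant (N : ℕ) (b : ℝ) (c₁ c₂ c₃ : ℝ≥0∞) (U V D : Freq d → ℝ≥0∞) (x : Freq d) : ℝ≥0∞ :=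
  c₁ * D x + c₂ * (burgersMajorant b D U x + burgersMajorant b V D x) +
    c₃ * (crossMajorant N b D U x + crossMajorant N b V D x)

variable {c₁ c₂ c₃ : ℝ≥0∞} {U V D : Freq d → ℝ≥0∞}

theorem measurable_rhsMajorant (hU : Measurable U) (hV : Measurable V) (hD : Measurable D) :
    Measurable (rhsMajorant N b c₁ c₂ c₃ U V D) :=
  ((hD.const_mul c₁).add (((measurable_burgersMajorant hD hU).add
    (measurable_burgersMajorant hV hD)).const_mul c₂)).add
    (((measurable_crossMajorant hD hU).add (measurable_crossMajorant hV hD)).const_mul c₃)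

theorem l2_rhsMajorant_le (hU : Measurable U) (hV : Measurable V) (hD : Measurable D) :
    l2 (modelMeasure d) (rhsMajorant N b c₁ c₂ c₃ U V D) ≤
      (c₁ + c₂ * (2 * l2 (freqMeasure d) (freqWeight d b)) +
        c₃ * (8 * l2 (freqMeasure d) (freqWeight d b) * l2 Measure.count (seqWeight N))) *
      (1 + l2 (modelMeasure d) U + l2 (modelMeasure d) V) * l2 (modelMeasure d) D := by
  set u := l2 (modelMeasure d) U
  set v := l2 (modelMeasure d) V
  set δ := l2 (modelMeasure d) D
  set B := 2 * l2 (freqMeasure d) (freqWeight d b) with hB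
  set K := 8 * l2 (freqMeasure d) (freqWeight d b) * l2 Measure.count (seqWeight N) with hK
  have hA1 := measurable_burgersMajorant (b := b) hD hU
  have hA2 := measurable_burgersMajorant (b := b) hV hD
  have hC1 := measurable_crossMajorant (N := N) (b := b) hD hU
  have hC2 := measurable_crossMajorant (N := N) (b := b) hV hD
  have h1 : l2 (modelMeasure d) (fun x => burgersMajorant b D U x + burgersMajorant b V D x) ≤
      B * (u + v) * δ := by
    refine (l2_add_le hA1.aemeasurable hA2.aemeasurable).trans ((add_le_add
      (l2_burgersMajorant_le hD hU) (l2_burgersMajorant_le hV hD)).trans (le_of_eq ?_))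
    ring
  have h2 : l2 (modelMeasure d) (fun x => crossMajorant N b D U x + crossMajorant N b V D x) ≤
      K * (u + v) * δ := by
    refine (l2_add_le hC1.aemeasurable hC2.aemeasurable).trans ((add_le_add
      (l2_crossMajorant_le hD hU) (l2_crossMajorant_le hV hD)).trans (le_of_eq ?_))
    ring
  calc _ ≤ (c₁ * δ + c₂ * (B * (u + v) * δ)) + c₃ * (K * (u + v) * δ) := by
        refine (l2_add_le (((hD.const_mul c₁).add ((hA1.add hA2).const_mul c₂)).aemeasurable)
          ((hC1.add hC2).const_mul c₃).aemeasurable).trans (add_le_add ?_ ?_)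
        · refine (l2_add_le (hD.const_mul c₁).aemeasurable
            ((hA1.add hA2).const_mul c₂).aemeasurable).trans (add_le_add ?_ ?_)
          · exact (l2_const_mul _ hD.aemeasurable).le
          · refine (l2_const_mul _ (hA1.add hA2).aemeasurable).le.trans ?_
            gcongr
            exact h1
        · refine (l2_const_mul _ (hC1.add hC2).aemeasurable).le.trans ?_
          gcongr
          exact h2
    _ ≤ c₁ * (1 + u + v) * δ + c₂ * B * (1 + u + v) * δ + c₃ * K * (1 + u + v) * δ := by
        have h3 : u + v ≤ 1 + u + v := by
          rw [add_assoc]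
          exact le_add_self
        have h4 : 1 ≤ 1 + u + v := by
          rw [add_assoc]
          exact le_self_add
        refine add_le_add (add_le_add ?_ ?_) ?_
        · rw [mul_right_comm]
          exact le_mul_of_one_le_right zero_le h4
        · rw [← mul_assoc, ← mul_assoc]
          gcongr
        · rw [← mul_assoc, ← mul_assoc]
          gcongr
    _ = _ := by ring

end Majorant

/-! ### Pointwise Lipschitz bound for the right-hand side. -/

section PointwiseBound

variable {d : ℕ}

/-- The inverse of the weight of the indices `n`. -/
def seqDecay (N : ℕ) (σ : ℝ) (n : ℕ+) : ℝ≥0∞ :=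
  ENNReal.ofReal (Real.exp (-σ * (n : ℝ)) * (jap (n : ℝ) ^ N)⁻¹)

theorem seqDecay_ne_top (N : ℕ) (σ : ℝ) (n : ℕ+) : seqDecay N σ n ≠ ∞ := ENNReal.ofReal_ne_top

theorem seqDecay_le_one (N : ℕ) {σ : ℝ} (hσ : 0 ≤ σ) (n : ℕ+) : seqDecay N σ n ≤ 1 := by
  rw [seqDecay, ← ENNReal.ofReal_one]
  refine ENNReal.ofReal_le_ofReal (mul_le_one₀ ?_ ?_ ?_)
  · rw [Real.exp_le_one_iff]
    have : (0 : ℝ) ≤ (n : ℕ) := by positivity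
    nlinarith
  · have := jap_pos (n : ℝ)
    positivity
  · exact inv_le_one_of_one_le₀ (one_le_pow₀ (one_le_jap _))

/-- The larger of `k` and `n - k` has a bracket at least half that of `n`; the weight of the other
one is left over as `seqWeight`. -/
theorem seqDecay_mul_le (N : ℕ) (σ : ℝ) {k n : ℕ+} (hk : k < n) :
    seqDecay N σ k * seqDecay N σ (n - k) ≤
      ENNReal.ofReal (2 ^ N) * seqDecay N σ n * (seqWeight N k + seqWeight N (n - k)) := by
  obtain ⟨j, rfl⟩ : ∃ j, n = j + k := ⟨n - k, (PNat.sub_add_of_lt hk).symm⟩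
  rw [PNat.add_sub]
  have hpk := jap_pos (k : ℝ)
  have hpj := jap_pos (j : ℝ)
  have hpn := jap_pos (((j + k : ℕ+) : ℕ) : ℝ)
  simp only [seqDecay, seqWeight]
  rw [← ENNReal.ofReal_add (by positivity) (by positivity), ← ENNReal.ofReal_mul (by positivity),
    ← ENNReal.ofReal_mul (by positivity), ← ENNReal.ofReal_mul (by positivity)]
  refine ENNReal.ofReal_le_ofReal ?_
  have hexp : Real.exp (-σ * (k : ℝ)) * Real.exp (-σ * (j : ℝ)) =
      Real.exp (-σ * (((j + k : ℕ+) : ℕ) : ℝ)) := by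
    rw [← Real.exp_add]
    push_cast
    ring_nf
  have hle : (jap (k : ℝ) ^ N)⁻¹ * (jap (j : ℝ) ^ N)⁻¹ ≤
      2 ^ N * (jap (((j + k : ℕ+) : ℕ) : ℝ) ^ N)⁻¹ *
        ((jap (k : ℝ) ^ N)⁻¹ + (jap (j : ℝ) ^ N)⁻¹) := by
    have h1 : jap (((j + k : ℕ+) : ℕ) : ℝ) ≤ 2 * max (jap (j : ℝ)) (jap (k : ℝ)) := by
      push_cast
      exact jap_add_le _ _
    have key : ∀ x y z : ℝ, 0 < x → 0 < y → 0 < z → z ≤ 2 * y →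
        (x ^ N)⁻¹ * (y ^ N)⁻¹ ≤ 2 ^ N * (z ^ N)⁻¹ * ((x ^ N)⁻¹ + (y ^ N)⁻¹) := by
      intro x y z hx hy hz hzy
      have h2 : (y ^ N)⁻¹ ≤ 2 ^ N * (z ^ N)⁻¹ := by
        rw [← div_eq_mul_inv, le_div_iff₀ (by positivity), inv_mul_le_iff₀ (by positivity),
          mul_comm, ← mul_pow]
        gcongr
      calc _ ≤ (x ^ N)⁻¹ * (2 ^ N * (z ^ N)⁻¹) := by gcongr
        _ ≤ (x ^ N)⁻¹ * (2 ^ N * (z ^ N)⁻¹) + (y ^ N)⁻¹ * (2 ^ N * (z ^ N)⁻¹) :=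
          le_add_of_nonneg_right (by positivity)
        _ = _ := by ring
    rcases le_total (jap (j : ℝ)) (jap (k : ℝ)) with h | h
    · rw [max_eq_right h] at h1
      have := key _ _ _ hpj hpk hpn h1
      rwa [mul_comm ((jap (j : ℝ) ^ N)⁻¹), add_comm ((jap (j : ℝ) ^ N)⁻¹)] at this
    · rw [max_eq_left h] at h1
      exact key _ _ _ hpk hpj hpn h1
  calc _ = Real.exp (-σ * (k : ℝ)) * Real.exp (-σ * (j : ℝ)) *
        ((jap (k : ℝ) ^ N)⁻¹ * (jap (j : ℝ) ^ N)⁻¹) := by ring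
    _ ≤ Real.exp (-σ * (((j + k : ℕ+) : ℕ) : ℝ)) * (2 ^ N * (jap (((j + k : ℕ+) : ℕ) : ℝ) ^ N)⁻¹ *
        ((jap (k : ℝ) ^ N)⁻¹ + (jap (j : ℝ) ^ N)⁻¹)) := by
        rw [hexp]
        gcongr
    _ = _ := by ring

theorem wconv_const_mul (g U V : ℤ × Tan d → ℝ≥0∞) {k k' : ℝ≥0∞} (hk : k ≠ ∞) (hk' : k' ≠ ∞)
    (q : ℤ × Tan d) :
    wconv (freqMeasure d) g (fun p => k * U p) (fun p => k' * V p) q =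
      k * k' * wconv (freqMeasure d) g U V q := by
  rw [wconv, wconv, ← lintegral_const_mul' _ _ (ENNReal.mul_ne_top hk hk')]
  refine lintegral_congr fun p => ?_
  ring

/-- The two weights in the frequency variables. -/
def profileDecay (N : ℕ) (σ : ℝ) (x : Freq d) : ℝ≥0∞ := decay N σ x.2 * seqDecay N σ x.1.2

/-- The polynomial weights cancel, and only the difference `κ` of the exponential rates survives.
This makes domination at index `s + κ` the same as `Dom` at rate `κ` in the coordinates of index
`s`. -/
theorem profileDecay_mul_weight (N : ℕ) (s κ : ℝ) (x : Freq d) :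
    ENNReal.ofReal (weight N s x) * profileDecay N (s + κ) x =
      ENNReal.ofReal (Real.exp (-κ * radius x)) := by
  have h1 := jap_pos (x.1.2 : ℝ)
  have h2 := jap_pos (len x.2.1 x.2.2)
  rw [profileDecay, decay, seqDecay, ← ENNReal.ofReal_mul (by positivity),
    ← ENNReal.ofReal_mul (weight_pos N s x).le, weight]
  congr 1
  have hexp : Real.exp (-κ * radius x) = Real.exp (s * radius x) *
      (Real.exp (-(s + κ) * len x.2.1 x.2.2) * Real.exp (-(s + κ) * (x.1.2 : ℝ))) := by
    rw [← Real.exp_add, ← Real.exp_add, radius]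
    congr 1
    ring
  rw [hexp]
  field_simp

variable {c : Coeffs d} {m C : ℝ} {N : ℕ} {σ : ℝ}

/-- The size of the velocities. -/
def transportConst (c : Coeffs d) : ℝ≥0∞ := ∑ ζ, ‖c.v ζ‖ₑ

/-- The constant of the interactions with the first profile. -/
def burgersConst (c : Coeffs d) (C : ℝ) (N : ℕ) : ℝ≥0∞ :=
  ∑ ζ, (‖c.D ζ * fourierConst d‖ₑ * ENNReal.ofReal (2 ^ N) +
    ‖(c.w ζ : ℂ) * fourierConst d‖ₑ * ENNReal.ofReal (C * 2 ^ N))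

/-- The constant of the interactions between the two sequences. -/
def crossConst (c : Coeffs d) (N : ℕ) : ℝ≥0∞ :=
  ∑ ζ, ‖(c.K ζ : ℂ) * fourierConst d‖ₑ * (ENNReal.ofReal (2 ^ N) * ENNReal.ofReal (2 ^ N))

/-- Domination of a function of the frequency variables by the weight of `𝐘_σ²` times `U`. -/
def ProfileDom (N : ℕ) (σ : ℝ) (f : Freq d → ℂ) (U : Freq d → ℝ≥0∞) : Prop :=
  ∀ᵐ x ∂modelMeasure d, ‖f x‖ₑ ≤ profileDecay N σ x * U x

theorem one_add_abs_le_radius (i : Fin 2 × ℕ+) (q : ℤ × Tan d) :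
    1 + |(q.1 : ℝ)| ≤ radius (i, q) := by
  have h1 : (1 : ℝ) ≤ (i.2 : ℕ) := by exact_mod_cast i.2.pos
  rw [radius]
  linarith [abs_le_len q.1 q.2]

/-- One statement for the Burgers, small divisor and cross terms: `i` and `j` label the two factors,
while `i'` labels the output and enters only through `1 + |l| ≤ ρ`, which accounts for the lost
derivative. -/
theorem ae_burgers_sub_le {β : ℤ → ℤ → ℂ} {e B : ℝ} (hβ : CoeffBound β e B) (hB : 0 ≤ B)
    (he : 0 ≤ e) (hN : l2 (freqMeasure d) (freqWeight d (N - e)) ≠ ∞) (hσ : 0 ≤ σ)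
    {a b : Profiles d} {U V D : Freq d → ℝ≥0∞} (hUm : Measurable U) (hVm : Measurable V)
    (hU : l2 (modelMeasure d) U ≠ ∞) (hV : l2 (modelMeasure d) V ≠ ∞)
    (ha : ProfileDom N σ (fun x => hat (a x.1.1 x.1.2) x.2.1 x.2.2) U)
    (hb : ProfileDom N σ (fun x => hat (b x.1.1 x.1.2) x.2.1 x.2.2) V)
    (hab : ProfileDom N σ (fun x => hat (a x.1.1 x.1.2) x.2.1 x.2.2 -
      hat (b x.1.1 x.1.2) x.2.1 x.2.2) D) (i j i' : Fin 2 × ℕ+) :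
    ∀ᵐ q ∂freqMeasure d,
      ‖conv β (hat (a i.1 i.2)) (hat (a j.1 j.2)) q.1 q.2 -
        conv β (hat (b i.1 i.2)) (hat (b j.1 j.2)) q.1 q.2‖ₑ ≤
      ENNReal.ofReal (radius (i', q)) * (ENNReal.ofReal (B * 2 ^ N) * (decay N σ q *
        (seqDecay N σ i.2 * seqDecay N σ j.2 *
          (wconv (freqMeasure d) (freqWeight d (N - e)) (fun p => D (i, p)) (fun p => U (j, p)) q +
          wconv (freqMeasure d) (freqWeight d (N - e)) (fun p => V (i, p))
            (fun p => D (j, p)) q)))) := by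
  have hdom : ∀ {f : Freq d → ℂ} {W : Freq d → ℝ≥0∞}, ProfileDom N σ f W → ∀ k : Fin 2 × ℕ+,
      ∀ᵐ q ∂freqMeasure d, ‖f (k, q)‖ₑ ≤ decay N σ q * (seqDecay N σ k.2 * W (k, q)) := by
    intro f W h k
    filter_upwards [ae_of_ae_model h k] with q hq
    rw [← mul_assoc]
    exact hq
  have hmeas : ∀ {W : Freq d → ℝ≥0∞}, Measurable W → ∀ k : Fin 2 × ℕ+,
      Measurable fun q => seqDecay N σ k.2 * W (k, q) := fun h k =>
    (measurable_slice h k).const_mul _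
  have hfin : ∀ {W : Freq d → ℝ≥0∞}, Measurable W → l2 (modelMeasure d) W ≠ ∞ →
      ∀ k : Fin 2 × ℕ+, l2 (freqMeasure d) (fun q => seqDecay N σ k.2 * W (k, q)) ≠ ∞ := by
    intro W h h' k
    rw [l2_const_mul _ (measurable_slice h k).aemeasurable]
    exact ENNReal.mul_ne_top (seqDecay_ne_top N σ _) (ne_top_of_le_ne_top h' (l2_slice_le h k))
  have h1 := HatDom.ae_conv_sub_le hβ hB he hN hσ (u := a i.1 i.2) (v := a j.1 j.2)
    (u' := b i.1 i.2) (v' := b j.1 j.2) (hdom ha i) (hdom ha j) (hdom hb i) (hdom hb j)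
    (hdom hab i) (hdom hab j) (hmeas hUm i) (hmeas hUm j) (hmeas hVm i) (hmeas hVm j)
    (hfin hUm hU i) (hfin hUm hU j) (hfin hVm hV i) (hfin hVm hV j)
  filter_upwards [h1] with q hq
  refine hq.trans ?_
  rw [wconv_const_mul _ (fun p => D (i, p)) (fun p => U (j, p)) (seqDecay_ne_top _ _ _)
      (seqDecay_ne_top _ _ _),
    wconv_const_mul _ (fun p => V (i, p)) (fun p => D (j, p)) (seqDecay_ne_top _ _ _)
      (seqDecay_ne_top _ _ _), ← mul_add, ENNReal.ofReal_mul (by positivity)]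
  calc _ = ENNReal.ofReal (1 + |(q.1 : ℝ)|) * (ENNReal.ofReal (B * 2 ^ N) * (decay N σ q *
        (seqDecay N σ i.2 * seqDecay N σ j.2 *
          (wconv (freqMeasure d) (freqWeight d (N - e)) (fun p => D (i, p)) (fun p => U (j, p)) q +
          wconv (freqMeasure d) (freqWeight d (N - e)) (fun p => V (i, p))
            (fun p => D (j, p)) q)))) := by ring
    _ ≤ _ := by
      gcongr
      exact one_add_abs_le_radius i' q

theorem ae_rhsHat_sub_le (hC : 0 < C) (hm : 0 ≤ m) (h : SmallDivisorBound c m C)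
    (hN : l2 (freqMeasure d) (freqWeight d (N - (m + 2))) ≠ ∞) (hσ : 0 ≤ σ)
    {a b : Profiles d} {U V D : Freq d → ℝ≥0∞} (hUm : Measurable U) (hVm : Measurable V)
    (hU : l2 (modelMeasure d) U ≠ ∞) (hV : l2 (modelMeasure d) V ≠ ∞)
    (ha : ProfileDom N σ (fun x => hat (a x.1.1 x.1.2) x.2.1 x.2.2) U)
    (hb : ProfileDom N σ (fun x => hat (b x.1.1 x.1.2) x.2.1 x.2.2) V)
    (hab : ProfileDom N σ (fun x => hat (a x.1.1 x.1.2) x.2.1 x.2.2 -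
      hat (b x.1.1 x.1.2) x.2.1 x.2.2) D) (i : Fin 2 × ℕ+) :
    ∀ᵐ q ∂freqMeasure d,
      ‖rhsHat c (fun ζ n => hat (a ζ n)) i.1 i.2 q.1 q.2 -
        rhsHat c (fun ζ n => hat (b ζ n)) i.1 i.2 q.1 q.2‖ₑ ≤
      profileDecay N σ (i, q) * (ENNReal.ofReal (radius (i, q)) *
        rhsMajorant N (N - (m + 2)) (transportConst c) (burgersConst c C N) (crossConst c N)
          U V D (i, q)) := by
  have he : 0 ≤ m + 2 := by linarith
  have h2 := ae_burgers_sub_le (coeffBound_derivCoeff he) zero_le_one he hN hσ hUm hVm hU hV ha hb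
    hab (i.1, 1) i i
  have h3 := ae_burgers_sub_le (coeffBound_perDerivCoeff hC hm (h i.1)) hC.le he hN hσ hUm hVm hU
    hV ha hb hab (i.1, 1) i i
  have h4 := fun k => ae_burgers_sub_le (coeffBound_derivCoeff he) zero_le_one he hN hσ hUm hVm hU
    hV ha hb hab (0, k) (1, i.2 - k) i
  filter_upwards [h2, h3, ae_all_iff.2 h4, ae_of_ae_model hab i] with q h2 h3 h4 h1
  set R := ENNReal.ofReal (radius (i, q)) with hR
  set Bu := burgersMajorant (N - (m + 2)) D U (i, q) + burgersMajorant (N - (m + 2)) V D (i, q)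
    with hBu
  set Cr := crossMajorant N (N - (m + 2)) D U (i, q) + crossMajorant N (N - (m + 2)) V D (i, q)
    with hCr
  have hP : profileDecay N σ (i, q) = decay N σ q * seqDecay N σ i.2 := rfl
  have e1 : ‖Complex.I * ((inner ℝ (c.v i.1) q.2 : ℝ) : ℂ) * hat (a i.1 i.2) q.1 q.2 -
      Complex.I * ((inner ℝ (c.v i.1) q.2 : ℝ) : ℂ) * hat (b i.1 i.2) q.1 q.2‖ₑ ≤
      profileDecay N σ (i, q) * (R * (transportConst c * D (i, q))) := by
    rw [← mul_sub, enorm_mul]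
    have h5 : ‖Complex.I * ((inner ℝ (c.v i.1) q.2 : ℝ) : ℂ)‖ₑ ≤ transportConst c * R := by
      have h6 : ‖Complex.I * ((inner ℝ (c.v i.1) q.2 : ℝ) : ℂ)‖ₑ ≤ ‖c.v i.1‖ₑ * R := by
        rw [← ofReal_norm, ← ofReal_norm, hR, ← ENNReal.ofReal_mul (norm_nonneg _)]
        refine ENNReal.ofReal_le_ofReal ((norm_dirDeriv_symbol_le _ q.1 _).trans ?_)
        gcongr
        rw [radius]
        have : (0 : ℝ) ≤ (i.2 : ℕ) := by positivity
        linarith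
      refine h6.trans ?_
      gcongr
      exact Finset.single_le_sum (f := fun ζ => ‖c.v ζ‖ₑ) (fun _ _ => zero_le) (Finset.mem_univ i.1)
    calc _ ≤ transportConst c * R * (profileDecay N σ (i, q) * D (i, q)) := by gcongr
      _ = _ := by ring
  -- Profiles `1` and `n` interact to produce an output of index `n`, not `n + 1`; the decay
  -- attached to index `1` is simply discarded.
  have hs1 : seqDecay N σ 1 * seqDecay N σ i.2 ≤ seqDecay N σ i.2 :=
    mul_le_of_le_one_left zero_le (seqDecay_le_one N hσ 1)
  have e2 : ‖c.D i.1 * fourierConst d * conv derivCoeff (hat (a i.1 1)) (hat (a i.1 i.2)) q.1 q.2 -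
      c.D i.1 * fourierConst d * conv derivCoeff (hat (b i.1 1)) (hat (b i.1 i.2)) q.1 q.2‖ₑ ≤
      profileDecay N σ (i, q) * (R * (‖c.D i.1 * fourierConst d‖ₑ *
        ENNReal.ofReal (2 ^ N) * Bu)) := by
    rw [← mul_sub, enorm_mul]
    calc _ ≤ ‖c.D i.1 * fourierConst d‖ₑ * (R * (ENNReal.ofReal (1 * 2 ^ N) * (decay N σ q *
        (seqDecay N σ i.2 * Bu)))) := by
          refine mul_le_mul_right (h2.trans ?_) _
          exact mul_le_mul_right (mul_le_mul_right (mul_le_mul_right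
            (mul_le_mul_left hs1 _) _) _) _
      _ = _ := by
          rw [one_mul, hP]
          ring
  have e3 : ‖c.w i.1 * fourierConst d * conv (perDerivCoeff (c.δ₁ i.1) (c.δ₃ i.1))
      (hat (a i.1 1)) (hat (a i.1 i.2)) q.1 q.2 -
      c.w i.1 * fourierConst d * conv (perDerivCoeff (c.δ₁ i.1) (c.δ₃ i.1))
      (hat (b i.1 1)) (hat (b i.1 i.2)) q.1 q.2‖ₑ ≤
      profileDecay N σ (i, q) * (R * (‖(c.w i.1 : ℂ) * fourierConst d‖ₑ *
        ENNReal.ofReal (C * 2 ^ N) * Bu)) := by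
    rw [← mul_sub, enorm_mul]
    calc _ ≤ ‖(c.w i.1 : ℂ) * fourierConst d‖ₑ * (R * (ENNReal.ofReal (C * 2 ^ N) * (decay N σ q *
        (seqDecay N σ i.2 * Bu)))) := by
          refine mul_le_mul_right (h3.trans ?_) _
          exact mul_le_mul_right (mul_le_mul_right (mul_le_mul_right
            (mul_le_mul_left hs1 _) _) _) _
      _ = _ := by
          rw [hP]
          ring
  have e23 : profileDecay N σ (i, q) * (R * (‖c.D i.1 * fourierConst d‖ₑ *
        ENNReal.ofReal (2 ^ N) * Bu)) + profileDecay N σ (i, q) *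
        (R * (‖(c.w i.1 : ℂ) * fourierConst d‖ₑ * ENNReal.ofReal (C * 2 ^ N) * Bu)) ≤
      profileDecay N σ (i, q) * (R * (burgersConst c C N * Bu)) := by
    rw [← mul_add, ← mul_add, ← add_mul]
    gcongr
    exact Finset.single_le_sum (f := fun ζ => (‖c.D ζ * fourierConst d‖ₑ * ENNReal.ofReal (2 ^ N) +
      ‖(c.w ζ : ℂ) * fourierConst d‖ₑ * ENNReal.ofReal (C * 2 ^ N))) (fun _ _ => zero_le)
      (Finset.mem_univ i.1)
  have e4 : ‖c.K i.1 * fourierConst d * ∑ k ∈ Finset.Iio i.2,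
        conv derivCoeff (hat (a 0 k)) (hat (a 1 (i.2 - k))) q.1 q.2 -
      c.K i.1 * fourierConst d * ∑ k ∈ Finset.Iio i.2,
        conv derivCoeff (hat (b 0 k)) (hat (b 1 (i.2 - k))) q.1 q.2‖ₑ ≤
      profileDecay N σ (i, q) * (R * (crossConst c N * Cr)) := by
    rw [← mul_sub, enorm_mul, ← Finset.sum_sub_distrib]
    have h5 : ∀ k ∈ Finset.Iio i.2, ‖conv derivCoeff (hat (a 0 k)) (hat (a 1 (i.2 - k))) q.1 q.2 -
        conv derivCoeff (hat (b 0 k)) (hat (b 1 (i.2 - k))) q.1 q.2‖ₑ ≤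
        profileDecay N σ (i, q) * (R * ((ENNReal.ofReal (2 ^ N) * ENNReal.ofReal (2 ^ N)) *
        ((seqWeight N k + seqWeight N (i.2 - k)) *
          wconv (freqMeasure d) (freqWeight d (N - (m + 2))) (fun p => D ((0, k), p))
            (fun p => U ((1, i.2 - k), p)) q +
        (seqWeight N k + seqWeight N (i.2 - k)) *
          wconv (freqMeasure d) (freqWeight d (N - (m + 2))) (fun p => V ((0, k), p))
            (fun p => D ((1, i.2 - k), p)) q))) := by
      intro k hk
      refine (h4 k).trans ?_
      rw [one_mul, ← mul_add, hP]
      refine (mul_le_mul_right (mul_le_mul_right (mul_le_mul_right (mul_le_mul_left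
        (seqDecay_mul_le N σ (Finset.mem_Iio.1 hk)) _) _) _) _).trans (le_of_eq ?_)
      ring
    calc _ ≤ ‖(c.K i.1 : ℂ) * fourierConst d‖ₑ * ∑ k ∈ Finset.Iio i.2,
          profileDecay N σ (i, q) * (R * ((ENNReal.ofReal (2 ^ N) * ENNReal.ofReal (2 ^ N)) *
        ((seqWeight N k + seqWeight N (i.2 - k)) *
          wconv (freqMeasure d) (freqWeight d (N - (m + 2))) (fun p => D ((0, k), p))
            (fun p => U ((1, i.2 - k), p)) q +
        (seqWeight N k + seqWeight N (i.2 - k)) *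
          wconv (freqMeasure d) (freqWeight d (N - (m + 2))) (fun p => V ((0, k), p))
            (fun p => D ((1, i.2 - k), p)) q))) :=
          mul_le_mul_right ((enorm_sum_le _ _).trans (Finset.sum_le_sum h5)) _
      _ = profileDecay N σ (i, q) * (R * ((‖(c.K i.1 : ℂ) * fourierConst d‖ₑ *
          (ENNReal.ofReal (2 ^ N) * ENNReal.ofReal (2 ^ N))) * Cr)) := by
          rw [← Finset.mul_sum, ← Finset.mul_sum, ← Finset.mul_sum, Finset.sum_add_distrib, hCr,
            crossMajorant, crossMajorant]
          ring
      _ ≤ _ := by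
          gcongr
          exact Finset.single_le_sum (f := fun ζ => ‖(c.K ζ : ℂ) * fourierConst d‖ₑ *
            (ENNReal.ofReal (2 ^ N) * ENNReal.ofReal (2 ^ N))) (fun _ _ => zero_le)
            (Finset.mem_univ i.1)
  have hsplit : ∀ x₁ x₂ x₃ x₄ y₁ y₂ y₃ y₄ : ℂ, ‖(x₁ - x₂ - x₃ + x₄) - (y₁ - y₂ - y₃ + y₄)‖ₑ ≤
      ‖x₁ - y₁‖ₑ + (‖x₂ - y₂‖ₑ + ‖x₃ - y₃‖ₑ) + ‖x₄ - y₄‖ₑ := by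
    intro x₁ x₂ x₃ x₄ y₁ y₂ y₃ y₄
    have h7 : (x₁ - x₂ - x₃ + x₄) - (y₁ - y₂ - y₃ + y₄) =
        ((x₁ - y₁) - ((x₂ - y₂) + (x₃ - y₃))) + (x₄ - y₄) := by ring
    rw [h7]
    refine (enorm_add_le _ _).trans ?_
    gcongr
    refine enorm_sub_le.trans ?_
    gcongr
    exact enorm_add_le _ _
  refine (hsplit _ _ _ _ _ _ _ _).trans ?_
  refine (add_le_add (add_le_add e1 ((add_le_add e2 e3).trans e23)) e4).trans (le_of_eq ?_)
  rw [rhsMajorant]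
  ring

end PointwiseBound

/-! ### The model as a map of `L²` and its majorant Lipschitz property. -/

section ModelMap

variable {d : ℕ} {c : Coeffs d} {m C : ℝ} {N : ℕ}

theorem le_profileDecay_mul_iff (N : ℕ) (s κ : ℝ) (x : Freq d) (z : ℂ) (X : ℝ≥0∞) :
    ‖z‖ₑ ≤ profileDecay N (s + κ) x * X ↔
      ‖(weight N s x : ℂ) * z‖ₑ ≤ ENNReal.ofReal (Real.exp (-κ * radius x)) * X := by
  have hw : ‖(weight N s x : ℂ)‖ₑ = ENNReal.ofReal (weight N s x) := by
    rw [← ofReal_norm, Complex.norm_real, Real.norm_of_nonneg (weight_pos N s x).le]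
  rw [enorm_mul, hw, ← profileDecay_mul_weight N s κ x, mul_assoc,
    ENNReal.mul_le_mul_iff_right (ENNReal.ofReal_pos.2 (weight_pos N s x)).ne'
      ENNReal.ofReal_ne_top]

theorem profileDom_of_coord_le {s κ : ℝ} {a : Profiles d} {U : Freq d → ℝ≥0∞}
    (h : ∀ᵐ x ∂modelMeasure d,
      ‖coord N s a x‖ₑ ≤ ENNReal.ofReal (Real.exp (-κ * radius x)) * U x) :
    ProfileDom N (s + κ) (fun x => hat (a x.1.1 x.1.2) x.2.1 x.2.2) U := by
  filter_upwards [h] with x hx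
  exact (le_profileDecay_mul_iff N s κ x _ _).2 hx

theorem profileDom_sub_of_coord_le {s κ : ℝ} {a b : Profiles d} {D : Freq d → ℝ≥0∞}
    (h : ∀ᵐ x ∂modelMeasure d,
      ‖coord N s a x - coord N s b x‖ₑ ≤ ENNReal.ofReal (Real.exp (-κ * radius x)) * D x) :
    ProfileDom N (s + κ) (fun x => hat (a x.1.1 x.1.2) x.2.1 x.2.2 -
      hat (b x.1.1 x.1.2) x.2.1 x.2.2) D := by
  filter_upwards [h] with x hx
  refine (le_profileDecay_mul_iff N s κ x _ _).2 ?_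
  rw [mul_sub]
  exact hx

theorem ProfileDom.exists_hatDom {σ : ℝ} {a : Profiles d} {U : Freq d → ℝ≥0∞}
    (hUm : Measurable U) (hU : l2 (modelMeasure d) U ≠ ∞)
    (h : ProfileDom N σ (fun x => hat (a x.1.1 x.1.2) x.2.1 x.2.2) U) (ζ : Fin 2) (n : ℕ+) :
    ∃ V, Measurable V ∧ l2 (freqMeasure d) V ≠ ∞ ∧ HatDom N σ (a ζ n) V := by
  refine ⟨fun q => seqDecay N σ n * U ((ζ, n), q), (measurable_slice hUm _).const_mul _, ?_, ?_⟩
  · rw [l2_const_mul _ (measurable_slice hUm _).aemeasurable]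
    exact ENNReal.mul_ne_top (seqDecay_ne_top N σ _) (ne_top_of_le_ne_top hU (l2_slice_le hUm _))
  · filter_upwards [ae_of_ae_model h (ζ, n)] with q hq
    rw [← mul_assoc]
    exact hq

theorem rhs_eq_add (c : Coeffs d) (H a : Profiles d) : rhs c H a = rhs c 0 a + H := by
  funext ζ n
  simp only [rhs, Pi.add_apply, Pi.zero_apply]
  abel

theorem conv_hat_zero_left (β : ℤ → ℤ → ℂ) (R : ℤ → Tan d → ℂ) (l : ℤ) (ξ : Tan d) :
    conv β (hat (0 : L2 d)) R l ξ = 0 := by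
  rw [conv_congr_ae β (P' := fun _ _ => 0) (R' := R) hat_zero
    (fun l => Eventually.of_forall fun ξ => rfl)]
  simp [conv]

theorem l2_ofReal_radius_mul_ne_top {κ : ℝ} (hκ : 0 < κ) {M : Freq d → ℝ≥0∞} (hM : Measurable M)
    (h : l2 (modelMeasure d) M ≠ ∞) :
    l2 (modelMeasure d) (fun x => ENNReal.ofReal (Real.exp (-κ * radius x)) *
      (ENNReal.ofReal (radius x) * M x)) ≠ ∞ := by
  refine ne_top_of_le_ne_top (ENNReal.mul_ne_top (ENNReal.ofReal_ne_top (r := κ⁻¹)) h) ?_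
  rw [← l2_const_mul _ hM.aemeasurable]
  refine l2_mono fun x => ?_
  rw [← mul_assoc, ← ENNReal.ofReal_mul (Real.exp_pos _).le]
  gcongr
  exact exp_mul_le_inv hκ

theorem coord_zero (N : ℕ) (s : ℝ) :
    ∀ᵐ x ∂modelMeasure d, coord N s (0 : Profiles d) x = 0 := by
  refine ae_profile (measurableSet_eq_fun (measurable_coord N s _) measurable_const)
    fun ζ n l => ?_
  filter_upwards [hat_zero (d := d) l] with ξ hξ
  simp [coord, hξ]

theorem ae_coord_rhs_sub_le (hC : 0 < C) (hm : 0 ≤ m) (h : SmallDivisorBound c m C)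
    (hN : l2 (freqMeasure d) (freqWeight d (N - (m + 2))) ≠ ∞) {s κ : ℝ} (hs : 0 ≤ s) (hκ : 0 < κ) {a b H : Profiles d}
    {U V D : Freq d → ℝ≥0∞} (hUm : Measurable U) (hVm : Measurable V)
    (hU : l2 (modelMeasure d) U ≠ ∞) (hV : l2 (modelMeasure d) V ≠ ∞) (hDm : Measurable D)
    (ha : ∀ᵐ x ∂modelMeasure d,
      ‖coord N s a x‖ₑ ≤ ENNReal.ofReal (Real.exp (-κ * radius x)) * U x)
    (hb : ∀ᵐ x ∂modelMeasure d,
      ‖coord N s b x‖ₑ ≤ ENNReal.ofReal (Real.exp (-κ * radius x)) * V x)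
    (hab : ∀ᵐ x ∂modelMeasure d,
      ‖coord N s a x - coord N s b x‖ₑ ≤ ENNReal.ofReal (Real.exp (-κ * radius x)) * D x) :
    ∀ᵐ x ∂modelMeasure d, ‖coord N s (rhs c H a) x - coord N s (rhs c H b) x‖ₑ ≤
      ENNReal.ofReal (Real.exp (-κ * radius x)) * (ENNReal.ofReal (radius x) *
        rhsMajorant N (N - (m + 2)) (transportConst c) (burgersConst c C N) (crossConst c N)
          U V D x) := by
  have hσ : 0 < s + κ := by linarith
  have ha' := profileDom_of_coord_le ha
  have hb' := profileDom_of_coord_le hb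
  have hab' := profileDom_sub_of_coord_le hab
  have hra := hat_rhs hC hm h hN hσ (ha'.exists_hatDom hUm hU) H
  have hrb := hat_rhs hC hm h hN hσ (hb'.exists_hatDom hVm hV) H
  have hmaj : Measurable (rhsMajorant N (N - (m + 2)) (transportConst c) (burgersConst c C N)
    (crossConst c N) U V D) := measurable_rhsMajorant hUm hVm hDm
  have hmeas : MeasurableSet {x : Freq d | ‖coord N s (rhs c H a) x - coord N s (rhs c H b) x‖ₑ ≤
      ENNReal.ofReal (Real.exp (-κ * radius x)) * (ENNReal.ofReal (radius x) *
        rhsMajorant N (N - (m + 2)) (transportConst c) (burgersConst c C N) (crossConst c N)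
          U V D x)} :=
    measurableSet_le ((measurable_coord N s _).sub (measurable_coord N s _)).enorm
      ((measurable_radius.const_mul _).exp.ennreal_ofReal.mul
        (measurable_radius.ennreal_ofReal.mul hmaj))
  refine (ae_model_iff hmeas).2 fun i => ?_
  have hfa : ∀ᵐ q ∂freqMeasure d, hat (rhs c H a i.1 i.2) q.1 q.2 - hat (rhs c H b i.1 i.2) q.1 q.2
      = rhsHat c (fun ζ n => hat (a ζ n)) i.1 i.2 q.1 q.2 -
        rhsHat c (fun ζ n => hat (b ζ n)) i.1 i.2 q.1 q.2 := by
    have hrm : ∀ (a : Profiles d) (l : ℤ),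
        Measurable (rhsHat c (fun ζ n => hat (a ζ n)) i.1 i.2 l) := by
      intro a l
      have hcm : ∀ (β : ℤ → ℤ → ℂ) (u v : L2 d), Measurable (conv β (hat u) (hat v) l) :=
        fun β u v => measurable_conv (measurable_hat u) (measurable_hat v) l
      have h1 : Measurable fun ξ : Tan d => Complex.I * ((inner ℝ (c.v i.1) ξ : ℝ) : ℂ) := by
        fun_prop
      exact (((h1.mul (measurable_hat _ l)).sub ((hcm _ _ _).const_mul _)).sub
        ((hcm _ _ _).const_mul _)).add
        ((Finset.measurable_fun_sum _ fun k _ => hcm _ _ _).const_mul _)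
    refine (ae_freq_iff (measurableSet_eq_fun
      ((measurable_uncurry_freq (measurable_hat _)).sub (measurable_uncurry_freq (measurable_hat _)))
      ((measurable_uncurry_freq (hrm a)).sub (measurable_uncurry_freq (hrm b))))).2 fun l => ?_
    filter_upwards [hra i.1 i.2 l, hrb i.1 i.2 l] with ξ h1 h2
    simp only [Pi.sub_apply]
    rw [h1, h2, add_sub_add_right_eq_sub]
  filter_upwards [hfa, ae_rhsHat_sub_le hC hm h hN hσ.le hUm hVm hU hV ha' hb' hab' i] with q h1 h2
  rw [← h1] at h2
  have h3 := (le_profileDecay_mul_iff N s κ (i, q) _ _).1 h2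
  rw [mul_sub] at h3
  exact h3

/-- The operators are defined by choice, so their vanishing at zero is checked on the Fourier side.
-/
theorem rhs_zero_zero (hC : 0 < C) (hm : 0 ≤ m) (h : SmallDivisorBound c m C)
    (hN : l2 (freqMeasure d) (freqWeight d (N - (m + 2))) ≠ ∞) : rhs c 0 (0 : Profiles d) = 0 := by
  have hz : ∀ (ζ : Fin 2) (n : ℕ+), ∃ V, Measurable V ∧ l2 (freqMeasure d) V ≠ ∞ ∧
      HatDom N 1 ((0 : Profiles d) ζ n) V := by
    intro ζ n
    refine ⟨fun _ => 0, measurable_const, by simp [l2], ?_⟩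
    refine (ae_freq_iff (measurableSet_le (measurable_uncurry_freq (measurable_hat _)).enorm
      ((measurable_decay N 1).mul measurable_const))).2 fun l => ?_
    filter_upwards [hat_zero (d := d) l] with ξ hξ
    simp [hξ]
  funext ζ n
  refine eq_of_hat fun l => ?_
  filter_upwards [hat_rhs hC hm h hN one_pos hz 0 ζ n l, hat_zero (d := d) l] with ξ h1 h2
  rw [h1]
  simp only [rhsHat, Pi.zero_apply, conv_hat_zero_left, h2, mul_zero, Finset.sum_const_zero,
    sub_zero, add_zero]

/-- The quadratic part of the model, read in `L²`. -/
def modelMap (c : Coeffs d) (N : ℕ) (s : ℝ) (f : FreqL2 d) : FreqL2 d :=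
  embed N s (rhs c 0 (unembed N s f))

/-- The Lipschitz constant of the model. -/
def lipConst (c : Coeffs d) (m C : ℝ) (N : ℕ) : ℝ≥0∞ :=
  transportConst c + burgersConst c C N * (2 * l2 (freqMeasure d) (freqWeight d (N - (m + 2)))) +
    crossConst c N * (8 * l2 (freqMeasure d) (freqWeight d (N - (m + 2))) *
      l2 Measure.count (seqWeight N))

theorem lipConst_ne_top (hN : l2 (freqMeasure d) (freqWeight d (N - (m + 2))) ≠ ∞) (hN1 : 1 ≤ N) :
    lipConst c m C N ≠ ∞ := by
  have h1 := l2_seqWeight_ne_top hN1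
  have t1 : transportConst c ≠ ∞ := ENNReal.sum_ne_top.2 fun _ _ => enorm_ne_top
  have t2 : burgersConst c C N ≠ ∞ := ENNReal.sum_ne_top.2 fun _ _ => ENNReal.add_ne_top.2
    ⟨ENNReal.mul_ne_top enorm_ne_top ENNReal.ofReal_ne_top,
      ENNReal.mul_ne_top enorm_ne_top ENNReal.ofReal_ne_top⟩
  have t3 : crossConst c N ≠ ∞ := ENNReal.sum_ne_top.2 fun _ _ =>
    ENNReal.mul_ne_top enorm_ne_top (ENNReal.mul_ne_top ENNReal.ofReal_ne_top ENNReal.ofReal_ne_top)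
  refine ENNReal.add_ne_top.2 ⟨ENNReal.add_ne_top.2 ⟨t1, ENNReal.mul_ne_top t2 ?_⟩,
    ENNReal.mul_ne_top t3 ?_⟩
  · exact ENNReal.mul_ne_top (by norm_num) hN
  · exact ENNReal.mul_ne_top (ENNReal.mul_ne_top (by norm_num) hN) h1

theorem normYY_zero (N : ℕ) (s : ℝ) : normYY N s (0 : Profiles d) = 0 := by
  have h : ∀ᵐ x ∂modelMeasure d, ‖coord N s (0 : Profiles d) x‖ₑ = (fun _ => (0 : ℝ≥0∞)) x := by
    filter_upwards [coord_zero N s] with x hx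
    rw [hx, enorm_zero]
  rw [normYY_eq, l2_congr_ae h]
  simp [l2]

/-- Comparison with the zero profile gives the bound `e^{-κρ} ρ M`, which is square integrable since
`ρ e^{-κρ} ≤ κ⁻¹`. -/
theorem normYY_rhs_ne_top (hC : 0 < C) (hm : 0 ≤ m) (h : SmallDivisorBound c m C)
    (hN : l2 (freqMeasure d) (freqWeight d (N - (m + 2))) ≠ ∞) (hN1 : 1 ≤ N) {s κ : ℝ} (hs : 0 ≤ s) (hκ : 0 < κ) {a : Profiles d}
    {U : Freq d → ℝ≥0∞} (hUm : Measurable U) (hU : l2 (modelMeasure d) U ≠ ∞)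
    (ha : ∀ᵐ x ∂modelMeasure d,
      ‖coord N s a x‖ₑ ≤ ENNReal.ofReal (Real.exp (-κ * radius x)) * U x) :
    normYY N s (rhs c 0 a) ≠ ∞ := by
  have h0 : l2 (modelMeasure d) (fun _ => (0 : ℝ≥0∞)) ≠ ∞ := by simp [l2]
  have hmaj := measurable_rhsMajorant (N := N) (b := N - (m + 2)) (c₁ := transportConst c)
    (c₂ := burgersConst c C N) (c₃ := crossConst c N) hUm (measurable_const (a := (0 : ℝ≥0∞))) hUm
  have key := ae_coord_rhs_sub_le hC hm h hN hs hκ (b := 0) (H := 0) hUm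
    (measurable_const (a := (0 : ℝ≥0∞))) hU h0 hUm ha (by
      filter_upwards [coord_zero (d := d) N s] with x hx
      rw [hx, enorm_zero]
      exact zero_le) (by
      filter_upwards [ha, coord_zero (d := d) N s] with x hx hx0
      rwa [hx0, sub_zero])
  rw [rhs_zero_zero hC hm h hN] at key
  rw [normYY_eq]
  refine ne_top_of_le_ne_top (l2_ofReal_radius_mul_ne_top hκ hmaj
    (ne_top_of_le_ne_top ?_ (l2_rhsMajorant_le hUm measurable_const hUm))) (l2_mono_ae ?_)
  · refine ENNReal.mul_ne_top (ENNReal.mul_ne_top (lipConst_ne_top hN hN1) ?_) hU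
    exact ENNReal.add_ne_top.2 ⟨ENNReal.add_ne_top.2 ⟨ENNReal.one_ne_top, hU⟩, h0⟩
  · filter_upwards [key, coord_zero (d := d) N s] with x hx hx0
    rwa [hx0, sub_zero] at hx

theorem modelMap_zero (hC : 0 < C) (hm : 0 ≤ m) (h : SmallDivisorBound c m C)
    (hN : l2 (freqMeasure d) (freqWeight d (N - (m + 2))) ≠ ∞) {s : ℝ} (hs : 0 ≤ s) : modelMap c N s (0 : FreqL2 d) = 0 := by
  have h0 : normYY N s (0 : Profiles d) ≠ ∞ := by simp [normYY_zero]
  have hz : embed N s (0 : Profiles d) = 0 := by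
    rw [← enorm_eq_zero, enorm_embed h0, normYY_zero]
  have hu : unembed N s (0 : FreqL2 d) = 0 := by
    rw [← hz, unembed_embed hs h0]
  rw [modelMap, hu, rhs_zero_zero hC hm h hN, hz]

theorem majorantLip_modelMap (hC : 0 < C) (hm : 0 ≤ m) (h : SmallDivisorBound c m C)
    (hN : l2 (freqMeasure d) (freqWeight d (N - (m + 2))) ≠ ∞) (hN1 : 1 ≤ N) {s : ℝ} (hs : 0 ≤ s) :
    MajorantLip radius (lipConst c m C N) (modelMap (d := d) c N s) := by
  intro U V D
  refine ⟨rhsMajorant N (N - (m + 2)) (transportConst c) (burgersConst c C N) (crossConst c N)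
    U V D, fun hUm hVm hDm hU hV hD => ⟨measurable_rhsMajorant hUm hVm hDm,
      l2_rhsMajorant_le hUm hVm hDm, fun κ hκ f g hf hg hfg => ?_⟩⟩
  have ha : ∀ᵐ x ∂modelMeasure d, ‖coord N s (unembed N s f) x‖ₑ ≤
      ENNReal.ofReal (Real.exp (-κ * radius x)) * U x := by
    filter_upwards [hf, coord_unembed N hs f] with x h1 h2
    rwa [h2]
  have hb : ∀ᵐ x ∂modelMeasure d, ‖coord N s (unembed N s g) x‖ₑ ≤
      ENNReal.ofReal (Real.exp (-κ * radius x)) * V x := by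
    filter_upwards [hg, coord_unembed N hs g] with x h1 h2
    rwa [h2]
  have hab : ∀ᵐ x ∂modelMeasure d, ‖coord N s (unembed N s f) x - coord N s (unembed N s g) x‖ₑ ≤
      ENNReal.ofReal (Real.exp (-κ * radius x)) * D x := by
    filter_upwards [hfg, coord_unembed N hs f, coord_unembed N hs g, Lp.coeFn_sub f g]
      with x h1 h2 h3 h4
    rwa [h2, h3, ← Pi.sub_apply, ← h4]
  filter_upwards [ae_coord_rhs_sub_le hC hm h hN hs hκ (H := 0) hUm hVm hU hV hDm ha hb hab,
    coeFn_embed (normYY_rhs_ne_top hC hm h hN hN1 hs hκ hUm hU ha),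
    coeFn_embed (normYY_rhs_ne_top hC hm h hN hN1 hs hκ hVm hV hb),
    Lp.coeFn_sub (modelMap c N s f) (modelMap c N s g)] with x h1 h2 h3 h4
  rw [h4, Pi.sub_apply, modelMap, modelMap, h2, h3]
  exact h1

end ModelMap

/-! ### Translation between `𝐘_s²` and `L²`. -/

section Bridge

variable {d : ℕ} {N : ℕ} {s s' : ℝ}

theorem coord_eq_exp_mul (N : ℕ) (s s' : ℝ) (a : Profiles d) (x : Freq d) :
    coord N s' a x = (Real.exp (-(s - s') * radius x) : ℂ) * coord N s a x := by
  have h := weight_eq_exp_mul N s' s x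
  rw [show (s' - s) * radius x = -(s - s') * radius x by ring] at h
  rw [coord, h, coord]
  push_cast
  ring

theorem enorm_coord_eq (N : ℕ) (s s' : ℝ) (a : Profiles d) (x : Freq d) :
    ‖coord N s' a x‖ₑ = ENNReal.ofReal (Real.exp (-(s - s') * radius x)) * ‖coord N s a x‖ₑ := by
  rw [coord_eq_exp_mul N s s', enorm_mul]
  congr 1
  rw [← ofReal_norm, Complex.norm_real, Real.norm_of_nonneg (Real.exp_pos _).le]

theorem normYY_mono (h : s' ≤ s) (a : Profiles d) : normYY N s' a ≤ normYY N s a := by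
  rw [normYY_eq, normYY_eq]
  refine l2_mono fun x => ?_
  rw [enorm_coord_eq N s s']
  refine mul_le_of_le_one_left zero_le ?_
  rw [← ENNReal.ofReal_one]
  refine ENNReal.ofReal_le_ofReal (Real.exp_le_one_iff.2 ?_)
  nlinarith [one_le_radius x]

theorem embed_add {a b : Profiles d} (ha : normYY N s a ≠ ∞) (hb : normYY N s b ≠ ∞) :
    embed N s (a + b) = embed N s a + embed N s b := by
  have hb' : normYY N s ((-1 : ℂ) • b) ≠ ∞ := by
    rw [normYY_smul]
    exact ENNReal.mul_ne_top enorm_ne_top hb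
  have h1 : a + b = a - (-1 : ℂ) • b := by rw [neg_one_smul, sub_neg_eq_add]
  rw [h1, embed_sub ha hb', embed_smul _ hb, neg_one_smul, sub_neg_eq_add]

theorem normYY_add_ne_top {a b : Profiles d} (ha : normYY N s a ≠ ∞) (hb : normYY N s b ≠ ∞) :
    normYY N s (a + b) ≠ ∞ := by
  have hb' : normYY N s ((-1 : ℂ) • b) ≠ ∞ := by
    rw [normYY_smul]
    exact ENNReal.mul_ne_top enorm_ne_top hb
  have h1 : a + b = a - (-1 : ℂ) • b := by rw [neg_one_smul, sub_neg_eq_add]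
  rw [h1]
  exact normYY_sub_ne_top ha hb'

theorem ofReal_smul_freq (r : ℝ) (f : FreqL2 d) : (r : ℂ) • f = r • f := by
  refine Lp.ext ?_
  filter_upwards [Lp.coeFn_smul (r : ℂ) f, Lp.coeFn_smul r f] with x h1 h2
  rw [h1, h2, Pi.smul_apply, Pi.smul_apply, Complex.coe_smul]

theorem enorm_embed_sub {a b : Profiles d} (ha : normYY N s a ≠ ∞) (hb : normYY N s b ≠ ∞) :
    ‖embed N s a - embed N s b‖ₑ = normYY N s (a - b) := by
  rw [← embed_sub ha hb, enorm_embed (normYY_sub_ne_top ha hb)]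

theorem tendsto_iff_enorm_sub {E ι : Type*} [NormedAddCommGroup E] {l : Filter ι} {f : ι → E}
    {x : E} : Tendsto f l (𝓝 x) ↔ Tendsto (fun i => ‖f i - x‖ₑ) l (𝓝 0) := by
  rw [tendsto_iff_edist_tendsto_0]
  simp only [edist_eq_enorm_sub]

theorem continuousOnYY_iff {H : ℝ → Profiles d} {J : Set ℝ} :
    ContinuousOnYY N s H J ↔
      (∀ t ∈ J, normYY N s (H t) ≠ ∞) ∧ ContinuousOn (fun t => embed N s (H t)) J := by
  have key : (∀ t ∈ J, normYY N s (H t) ≠ ∞) → ∀ t ∈ J,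
      (Tendsto (fun t' => normYY N s (H t' - H t)) (𝓝[J] t) (𝓝 0) ↔
        ContinuousWithinAt (fun t => embed N s (H t)) J t) := by
    intro h t ht
    rw [ContinuousWithinAt, tendsto_iff_enorm_sub]
    refine tendsto_congr' ?_
    filter_upwards [self_mem_nhdsWithin] with t' ht'
    exact (enorm_embed_sub (h t' ht') (h t ht)).symm
  constructor
  · intro h
    have h1 : ∀ t ∈ J, normYY N s (H t) ≠ ∞ := fun t ht => (h t ht).1.ne
    exact ⟨h1, fun t ht => (key h1 t ht).1 (h t ht).2⟩
  · rintro ⟨h1, h2⟩ t ht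
    exact ⟨(h1 t ht).lt_top, (key h1 t ht).2 (h2 t ht)⟩

/-- The embedding is linear and isometric on profiles of finite norm, so difference quotients
correspond; `J` is open in order that `t + h` remain in it for small `h`. -/
theorem hasC1DerivYY_iff {a a' : ℝ → Profiles d} {J : Set ℝ} (hJ : IsOpen J) :
    HasC1DerivYY N s a a' J ↔
      (∀ t ∈ J, normYY N s (a t) ≠ ∞) ∧ (∀ t ∈ J, normYY N s (a' t) ≠ ∞) ∧
      (∀ t ∈ J, HasDerivAt (fun t => embed N s (a t)) (embed N s (a' t)) t) ∧
      ContinuousOn (fun t => embed N s (a' t)) J := by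
  have key : (∀ t ∈ J, normYY N s (a t) ≠ ∞) → (∀ t ∈ J, normYY N s (a' t) ≠ ∞) → ∀ t ∈ J,
      (Tendsto (fun h : ℝ => normYY N s ((h⁻¹ : ℂ) • (a (t + h) - a t) - a' t)) (𝓝[≠] 0) (𝓝 0) ↔
        HasDerivAt (fun t => embed N s (a t)) (embed N s (a' t)) t) := by
    intro ha ha' t ht
    rw [hasDerivAt_iff_tendsto_slope_zero, tendsto_iff_enorm_sub]
    refine tendsto_congr' ?_
    have hnear : ∀ᶠ h : ℝ in 𝓝[≠] 0, t + h ∈ J := by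
      refine mem_nhdsWithin_of_mem_nhds ?_
      have hc : Tendsto (fun h : ℝ => t + h) (𝓝 0) (𝓝 t) := by
        have : Continuous fun h : ℝ => t + h := by fun_prop
        simpa using this.tendsto 0
      exact hc (hJ.mem_nhds ht)
    filter_upwards [hnear] with h hh
    have h1 := normYY_sub_ne_top (ha _ hh) (ha t ht)
    have h2 : normYY N s ((h⁻¹ : ℂ) • (a (t + h) - a t)) ≠ ∞ := by
      rw [normYY_smul]
      exact ENNReal.mul_ne_top enorm_ne_top h1
    rw [← enorm_embed_sub h2 (ha' t ht), embed_smul _ h1, embed_sub (ha _ hh) (ha t ht),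
      ← ofReal_smul_freq, Complex.ofReal_inv]
  constructor
  · rintro ⟨h1, h2⟩
    obtain ⟨h3, h4⟩ := continuousOnYY_iff.1 h2
    have h5 : ∀ t ∈ J, normYY N s (a t) ≠ ∞ := fun t ht => (h1 t ht).1.ne
    exact ⟨h5, h3, fun t ht => (key h5 h3 t ht).1 (h1 t ht).2, h4⟩
  · rintro ⟨h1, h2, h3, h4⟩
    exact ⟨fun t ht => ⟨(h1 t ht).lt_top, (key h1 h2 t ht).2 (h3 t ht)⟩,
      continuousOnYY_iff.2 ⟨h2, h4⟩⟩

theorem ContinuousOnYY.mono {H : ℝ → Profiles d} {J J' : Set ℝ} (h : ContinuousOnYY N s H J)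
    (hs : s' ≤ s) (hJ : J' ⊆ J) : ContinuousOnYY N s' H J' := fun t ht =>
  ⟨(normYY_mono hs _).trans_lt (h t (hJ ht)).1,
    tendsto_of_tendsto_of_tendsto_of_le_of_le tendsto_const_nhds
      ((h t (hJ ht)).2.mono_left (nhdsWithin_mono t hJ)) (fun _ => zero_le)
      fun _ => normYY_mono hs _⟩

theorem HasC1DerivYY.mono {a a' : ℝ → Profiles d} {J J' : Set ℝ} (h : HasC1DerivYY N s a a' J)
    (hs : s' ≤ s) (hJ : J' ⊆ J) : HasC1DerivYY N s' a a' J' :=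
  ⟨fun t ht => ⟨(normYY_mono hs _).trans_lt (h.1 t (hJ ht)).1,
    tendsto_of_tendsto_of_tendsto_of_le_of_le tendsto_const_nhds (h.1 t (hJ ht)).2
      (fun _ => zero_le) fun _ => normYY_mono hs _⟩, h.2.mono hs hJ⟩

theorem IsSolution.mono {c : Coeffs d} {H a : ℝ → Profiles d} {r r' : ℝ}
    (h : IsSolution c N H s r a) (hs : s' ≤ s) (hr : r' ≤ r) : IsSolution c N H s' r' a := by
  have hJ : Set.Ioo (-r') r' ⊆ Set.Ioo (-r) r := Set.Ioo_subset_Ioo (by linarith) hr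
  obtain ⟨h0, a', h1, h2⟩ := h
  exact ⟨h0, a', h1.mono hs hJ, fun t ht => h2 t (hJ ht)⟩

theorem IsSolution.congr {c : Coeffs d} {H a b : ℝ → Profiles d} {r : ℝ}
    (h : IsSolution c N H s r a) (h0 : b 0 = 0) (hab : ∀ t ∈ Set.Ioo (-r) r, b t = a t) :
    IsSolution c N H s r b := by
  obtain ⟨-, a', h1, h2⟩ := h
  rw [hasC1DerivYY_iff isOpen_Ioo] at h1
  obtain ⟨h3, h4, h5, h6⟩ := h1
  refine ⟨h0, a', (hasC1DerivYY_iff isOpen_Ioo).2 ⟨fun t ht => by rw [hab t ht]; exact h3 t ht, h4,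
    fun t ht => (h5 t ht).congr_of_eventuallyEq ?_, h6⟩, fun t ht => by rw [hab t ht]; exact h2 t ht⟩
  filter_upwards [isOpen_Ioo.mem_nhds ht] with t' ht'
  rw [hab t' ht']

end Bridge

/-! ### Existence, uniqueness and gluing of solutions. -/

section Solutions

variable {d : ℕ} {c : Coeffs d} {m C : ℝ} {N : ℕ}

theorem embed_eq_zero_of_zero (N : ℕ) (s : ℝ) : embed N s (0 : Profiles d) = 0 := by
  have h0 : normYY N s (0 : Profiles d) ≠ ∞ := by simp [normYY_zero]
  rw [← enorm_eq_zero, enorm_embed h0, normYY_zero]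

theorem unembed_zero (N : ℕ) {s : ℝ} (hs : 0 ≤ s) : unembed N s (0 : FreqL2 d) = 0 := by
  have h0 : normYY N s (0 : Profiles d) ≠ ∞ := by simp [normYY_zero]
  rw [← embed_eq_zero_of_zero N s, unembed_embed hs h0]

theorem ae_enorm_embed_eq {s s' : ℝ} {a : Profiles d} (hs : s' ≤ s) (ha : normYY N s a ≠ ∞) :
    ∀ᵐ x ∂modelMeasure d, ‖embed N s' a x‖ₑ =
      ENNReal.ofReal (Real.exp (-(s - s') * radius x)) * ‖embed N s a x‖ₑ := by
  filter_upwards [coeFn_embed ha, coeFn_embed (ne_top_of_le_ne_top ha (normYY_mono hs a))]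
    with x h1 h2
  rw [h1, h2, enorm_coord_eq N s s']

/-- At the index `s₁ = (1 + s)/2` the source is bounded by `2M₀/(1 - s)`. Over a time interval of
length `2δ(1 - s)` this contributes at most `4M₀δ`. -/
theorem exists_isSolution (hC : 0 < C) (hm : 0 ≤ m) (h : SmallDivisorBound c m C)
    (hN : l2 (freqMeasure d) (freqWeight d (N - (m + 2))) ≠ ∞) (hN1 : 1 ≤ N) {T δ M₀ : ℝ}
    (hδ : 0 < δ) (hδT : δ < T) (hδC : ENNReal.ofReal (2 * δ) * (lipConst c m C N * 3) ≤ 2⁻¹)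
    (hδM : 4 * M₀ * δ ≤ 1 / 2) {H : ℝ → Profiles d} (hH : ContinuousOnYY N 1 H (Set.Icc (-T) T))
    (hHM : ∀ s : ℝ, 0 < s → s < 1 → ∀ t : ℝ, |t| < T →
      normYY N s (H t) ≤ ENNReal.ofReal (M₀ / (1 - s))) (hM₀ : 0 < M₀) {s : ℝ} (hs : 0 < s)
    (hs1 : s < 1) : ∃ a : ℝ → Profiles d, IsSolution c N H s (δ * (1 - s)) a := by
  set r := δ * (1 - s) with hr
  have hr0 : 0 < r := mul_pos hδ (by linarith)
  have hrT : r < T := by nlinarith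
  set s₁ := (1 + s) / 2 with hs₁
  have hsub : Set.Icc (-r) r ⊆ Set.Icc (-T) T := Set.Icc_subset_Icc (by linarith) hrT.le
  have hc₁ := continuousOnYY_iff.1 (hH.mono (s' := s₁) (by linarith) hsub)
  have hc₀ := continuousOnYY_iff.1 (hH.mono (s' := s) hs1.le hsub)
  -- Seen from the index `s`, the source decays at rate `s₁ - s`. The slope `λ = 1/(2δ)` is the one
  -- that consumes exactly this rate during the time `r`.
  have hlam : (1 / (2 * δ)) * r = s₁ - s := by
    rw [hr, hs₁]
    field_simp
    ring
  obtain ⟨u, hu0, hud, hGc, U, hUm, hU, hdom⟩ :=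
    (majorantLip_modelMap hC hm h hN hN1 hs.le).exists_solution (lipConst_ne_top hN hN1)
      (modelMap_zero hC hm h hN hs.le) measurable_radius one_le_radius
      (lam := 1 / (2 * δ)) (r := r) (B := M₀ / (1 - s₁)) (by positivity) hr0
      (by rwa [one_div, inv_inv]) hc₁.2 (fun t ht => by
        have h1 : |t| < T := (abs_le.2 ht).trans_lt hrT
        have h2 := hHM s₁ (by linarith) (by linarith) t h1
        rw [← enorm_embed (hc₁.1 t ht), ← ofReal_norm] at h2
        exact (ENNReal.ofReal_le_ofReal_iff (div_nonneg hM₀.le (by linarith))).1 h2) (by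
        have h3 : (1 - s : ℝ) ≠ 0 := by linarith
        have h4 : M₀ / (1 - s₁) * (2 * r) = 4 * M₀ * δ := by
          rw [hr, hs₁, show (1 : ℝ) - (1 + s) / 2 = (1 - s) / 2 by ring]
          field_simp
          ring
        rw [h4]
        exact hδM) hc₀.2 (fun t ht => by
        filter_upwards [ae_enorm_embed_eq (s := s₁) (s' := s) (by linarith) (hc₁.1 t ht)] with x hx
        rw [hx, hlam])
  have hκ : ∀ t ∈ Set.Ioo (-r) r, 0 < 1 / (2 * δ) * (r - |t|) := fun t ht =>
    mul_pos (by positivity) (by linarith [abs_lt.2 ht])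
  have hrhs : ∀ t ∈ Set.Ioo (-r) r, normYY N s (rhs c 0 (unembed N s (u t))) ≠ ∞ := by
    intro t ht
    refine normYY_rhs_ne_top hC hm h hN hN1 hs.le (hκ t ht) hUm hU ?_
    filter_upwards [hdom t ht, coord_unembed N hs.le (u t)] with x h1 h2
    rwa [h2]
  have hHt : ∀ t ∈ Set.Ioo (-r) r, normYY N s (H t) ≠ ∞ := fun t ht =>
    hc₀.1 t (Set.Ioo_subset_Icc_self ht)
  have hemb : ∀ t ∈ Set.Ioo (-r) r, embed N s (rhs c (H t) (unembed N s (u t))) =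
      modelMap c N s (u t) + embed N s (H t) := by
    intro t ht
    rw [rhs_eq_add, embed_add (hrhs t ht) (hHt t ht)]
    rfl
  refine ⟨fun t => unembed N s (u t), ?_, fun t => rhs c (H t) (unembed N s (u t)), ?_,
    fun t _ => rfl⟩
  · simp only [hu0, unembed_zero N hs.le]
  · refine (hasC1DerivYY_iff isOpen_Ioo).2 ⟨fun t _ => normYY_unembed_ne_top N hs.le _,
      fun t ht => ?_, fun t ht => ?_, ?_⟩
    · rw [rhs_eq_add]
      exact normYY_add_ne_top (hrhs t ht) (hHt t ht)
    · simp only [embed_unembed N hs.le]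
      rw [hemb t ht]
      exact hud t ht
    · exact (hGc.add (hc₀.2.mono Set.Ioo_subset_Icc_self)).congr hemb

/-- Continuity in norm alone gives no `L²` function above all the `a(t)`. As `a(0) = 0` and `a'` is
continuous, the integral of `|a'|` over `[-R, R]` is one. -/
theorem IsSolution.exists_majorant {H a : ℝ → Profiles d} {s r R : ℝ}
    (ha : IsSolution c N H s r a) (hR : 0 < R) (hRr : R < r) :
    ∃ D : Freq d → ℝ≥0∞, Measurable D ∧ l2 (modelMeasure d) D ≠ ∞ ∧
      ∀ t ∈ Set.Icc (-R) R, ∀ᵐ x ∂modelMeasure d, ‖embed N s (a t) x‖ₑ ≤ D x := by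
  obtain ⟨h0, a', h1, -⟩ := ha
  obtain ⟨-, -, hd, hc⟩ := (hasC1DerivYY_iff isOpen_Ioo).1 h1
  have hsub : Set.Icc (-R) R ⊆ Set.Ioo (-r) r := Set.Icc_subset_Ioo (by linarith) hRr
  have hc' := hc.mono hsub
  obtain ⟨B, hB⟩ := isCompact_Icc.exists_bound_of_continuousOn hc'
  obtain ⟨D, hDm, hDl, hD⟩ := exists_majorant_integral (by linarith : -R ≤ R) hc' hB
  refine ⟨D, hDm, ne_top_of_le_ne_top ENNReal.ofReal_ne_top hDl, fun t ht => ?_⟩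
  have h0R : (0 : ℝ) ∈ Set.Icc (-R) R := ⟨by linarith, hR.le⟩
  have huI : Set.uIcc 0 t ⊆ Set.Icc (-R) R := Set.ordConnected_Icc.uIcc_subset h0R ht
  have hftc : ∫ τ in (0 : ℝ)..t, embed N s (a' τ) = embed N s (a t) := by
    rw [intervalIntegral.integral_eq_sub_of_hasDerivAt
      (fun τ hτ => hd τ (hsub (huI hτ))) (hc'.mono huI).intervalIntegrable, h0,
      embed_eq_zero_of_zero, sub_zero]
  have h2 := hD (fun τ => embed N s (a' τ)) (fun _ => 1) measurable_const (fun _ => zero_le_one)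
    (fun _ => le_rfl) hc' (fun τ _ => Eventually.of_forall fun x => by simp) 0 h0R t ht
  rw [hftc] at h2
  filter_upwards [h2] with x hx
  simpa using hx

theorem IsSolution.hasDerivAt_embed {H a : ℝ → Profiles d} {s s' r : ℝ} (hs' : 0 ≤ s')
    (hss' : s' ≤ s) (ha : IsSolution c N H s r a)
    (hH : ∀ t ∈ Set.Ioo (-r) r, normYY N s (H t) ≠ ∞) :
    ∀ t ∈ Set.Ioo (-r) r, HasDerivAt (fun t => embed N s' (a t))
      (modelMap c N s' (embed N s' (a t)) + embed N s' (H t)) t := by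
  intro t ht
  obtain ⟨-, a', h1, h2⟩ := ha
  obtain ⟨h3, h4, h5, -⟩ := (hasC1DerivYY_iff isOpen_Ioo).1 (h1.mono hss' subset_rfl)
  have hHt : normYY N s' (H t) ≠ ∞ := ne_top_of_le_ne_top (hH t ht) (normYY_mono hss' _)
  have h6 := h4 t ht
  have h7 := h5 t ht
  rw [h2 t ht] at h6 h7
  have h8 : rhs c 0 (a t) = rhs c (H t) (a t) - H t := by
    rw [rhs_eq_add c (H t), add_sub_cancel_right]
  have h9 : normYY N s' (rhs c 0 (a t)) ≠ ∞ := by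
    rw [h8]
    exact normYY_sub_ne_top h6 hHt
  rw [rhs_eq_add, embed_add h9 hHt] at h7
  rw [modelMap, unembed_embed hs' (h3 t ht)]
  exact h7

/-- Read at the index `s/2`, a solution in `𝐘_s²` is dominated at rate `s/2` on compact time
intervals, so local uniqueness applies there. Connectedness of the interval does the rest. -/
theorem IsSolution.eq_on (hC : 0 < C) (hm : 0 ≤ m) (h : SmallDivisorBound c m C)
    (hN : l2 (freqMeasure d) (freqWeight d (N - (m + 2))) ≠ ∞) (hN1 : 1 ≤ N)
    {H a b : ℝ → Profiles d} {s r : ℝ} (hs : 0 < s)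
    (hH : ∀ t ∈ Set.Ioo (-r) r, normYY N s (H t) ≠ ∞)
    (ha : IsSolution c N H s r a) (hb : IsSolution c N H s r b) :
    ∀ t ∈ Set.Ioo (-r) r, a t = b t := by
  have hs2 : s / 2 ≤ s := by linarith
  have hfin : ∀ {e : ℝ → Profiles d}, IsSolution c N H s r e → ∀ t ∈ Set.Ioo (-r) r,
      normYY N s (e t) ≠ ∞ := by
    rintro e ⟨-, e', h1, -⟩ t ht
    exact (h1.1 t ht).1.ne
  have hfin' : ∀ {e : ℝ → Profiles d}, IsSolution c N H s r e → ∀ t ∈ Set.Ioo (-r) r,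
      normYY N (s / 2) (e t) ≠ ∞ := fun he t ht =>
    ne_top_of_le_ne_top (hfin he t ht) (normYY_mono hs2 _)
  have hda := ha.hasDerivAt_embed (s' := s / 2) (by linarith) hs2 hH
  have hdb := hb.hasDerivAt_embed (s' := s / 2) (by linarith) hs2 hH
  rcases le_or_gt r 0 with hr | hr
  · intro t ht
    linarith [ht.1, ht.2]
  -- The coincidence set contains `0`; it is open by local uniqueness and relatively closed by
  -- continuity.
  set W : Set ℝ := {t | t ∈ Set.Ioo (-r) r ∧
    embed N (s / 2) (a t) = embed N (s / 2) (b t)} with hW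
  have hopen : IsOpen W := by
    rw [isOpen_iff_mem_nhds]
    rintro t₀ ⟨ht₀, heq⟩
    have ht₀r : |t₀| < r := abs_lt.2 ht₀
    obtain ⟨R, hR1, hR2⟩ := exists_between ht₀r
    have hR0 : 0 < R := (abs_nonneg t₀).trans_lt hR1
    have hsub : Set.Ioo (-R) R ⊆ Set.Ioo (-r) r := Set.Ioo_subset_Ioo (by linarith) hR2.le
    have ht₀R : t₀ ∈ Set.Ioo (-R) R := abs_lt.1 hR1
    obtain ⟨Da, hDam, hDa, hDad⟩ := ha.exists_majorant hR0 hR2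
    obtain ⟨Db, hDbm, hDb, hDbd⟩ := hb.exists_majorant hR0 hR2
    have hdom : ∀ {e : ℝ → Profiles d} {D : Freq d → ℝ≥0∞}, IsSolution c N H s r e →
        (∀ t ∈ Set.Icc (-R) R, ∀ᵐ x ∂modelMeasure d, ‖embed N s (e t) x‖ₑ ≤ D x) →
        (∀ x, D x ≤ Da x + Db x) → ∀ t ∈ Set.Ioo (-R) R,
        Dom radius (s / 2) (embed N (s / 2) (e t)) fun x => Da x + Db x := by
      intro e D he hD hDle t ht
      filter_upwards [hD t (Set.Ioo_subset_Icc_self ht),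
        ae_enorm_embed_eq hs2 (hfin he t (hsub ht))] with x h1 h2
      rw [h2, sub_half]
      gcongr
      exact h1.trans (hDle x)
    obtain ⟨ε, hε, hloc⟩ :=
      (majorantLip_modelMap hC hm h hN hN1 (s := s / 2) (by linarith)).eventually_eq
      (lipConst_ne_top hN hN1) measurable_radius one_le_radius (κ₀ := s / 2) (by linarith)
      (s := Set.Ioo (-R) R) Set.ordConnected_Ioo ht₀R (U := fun x => Da x + Db x)
      (hDam.add hDbm)
      (ne_top_of_le_ne_top (ENNReal.add_ne_top.2 ⟨hDa, hDb⟩)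
        (l2_add_le hDam.aemeasurable hDbm.aemeasurable))
      (H := fun t => embed N (s / 2) (H t))
      (fun t ht => hda t (hsub ht)) (fun t ht => hdb t (hsub ht))
      (hdom ha hDad fun x => le_self_add) (hdom hb hDbd fun x => le_add_self) heq
    filter_upwards [isOpen_Ioo.mem_nhds ht₀R, Metric.ball_mem_nhds t₀ hε] with t h1 h2
    exact ⟨hsub h1, hloc t h1 (by rwa [← Real.dist_eq])⟩
  have h0 : (0 : ℝ) ∈ Set.Ioo (-r) r := ⟨by linarith, hr⟩
  have hsubW : Set.Ioo (-r) r ⊆ W := by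
    refine isPreconnected_Ioo.subset_of_closure_inter_subset hopen
      ⟨0, h0, h0, by rw [ha.1, hb.1]⟩ ?_
    rintro t ⟨htc, ht⟩
    refine ⟨ht, ?_⟩
    have hne : (𝓝[W] t).NeBot := mem_closure_iff_nhdsWithin_neBot.1 htc
    have hta := (hda t ht).continuousAt.tendsto.mono_left (nhdsWithin_le_nhds (s := W))
    have htb := (hdb t ht).continuousAt.tendsto.mono_left (nhdsWithin_le_nhds (s := W))
    refine tendsto_nhds_unique hta (htb.congr' ?_)
    filter_upwards [self_mem_nhdsWithin] with t' ht'
    exact ht'.2.symm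
  intro t ht
  exact eq_of_embed (hfin' ha t ht) (hfin' hb t ht) (hsubW ht).2

/-- For each `s < 1` there is a solution on its own interval; by uniqueness the one at the larger
index restricts to the one at the smaller index, and a single function is assembled from all of
them. -/
theorem exists_unique_solution (hC : 0 < C) (hm : 0 ≤ m) (h : SmallDivisorBound c m C)
    (hN : l2 (freqMeasure d) (freqWeight d (N - (m + 2))) ≠ ∞) (hN1 : 1 ≤ N) {T δ M₀ : ℝ}
    (hδ : 0 < δ) (hδT : δ < T) (hδC : ENNReal.ofReal (2 * δ) * (lipConst c m C N * 3) ≤ 2⁻¹)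
    (hδM : 4 * M₀ * δ ≤ 1 / 2) {H : ℝ → Profiles d} (hH : ContinuousOnYY N 1 H (Set.Icc (-T) T))
    (hHM : ∀ s : ℝ, 0 < s → s < 1 → ∀ t : ℝ, |t| < T →
      normYY N s (H t) ≤ ENNReal.ofReal (M₀ / (1 - s))) (hM₀ : 0 < M₀) :
    ∃ a : ℝ → Profiles d,
      (∀ s : ℝ, 0 < s → s ≤ 1 → IsSolution c N H s (δ * (1 - s)) a) ∧
      ∀ s : ℝ, 0 < s → s ≤ 1 → ∀ b : ℝ → Profiles d,
        IsSolution c N H s (δ * (1 - s)) b →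
        ∀ t ∈ Set.Ioo (-(δ * (1 - s))) (δ * (1 - s)), b t = a t := by
  have hHfin : ∀ s ≤ 1, ∀ r ≤ δ, ∀ t ∈ Set.Ioo (-r) r, normYY N s (H t) ≠ ∞ := by
    intro s hs r hr t ht
    exact ne_top_of_le_ne_top (hH t ⟨by linarith [ht.1], by linarith [ht.2]⟩).1.ne (normYY_mono hs _)
  have hex : ∀ s : ℝ, ∃ a : ℝ → Profiles d, 0 < s → s < 1 →
      IsSolution c N H s (δ * (1 - s)) a := by
    intro s
    by_cases hs : 0 < s ∧ s < 1
    · obtain ⟨a, ha⟩ := exists_isSolution hC hm h hN hN1 hδ hδT hδC hδM hH hHM hM₀ hs.1 hs.2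
      exact ⟨a, fun _ _ => ha⟩
    · exact ⟨0, fun h1 h2 => absurd ⟨h1, h2⟩ hs⟩
  choose A hA using hex
  have hcons : ∀ s s' t : ℝ, 0 < s → s ≤ s' → s' < 1 → |t| < δ * (1 - s') → A s t = A s' t := by
    intro s s' t hs hss' hs' ht
    have hr : δ * (1 - s') ≤ δ * (1 - s) := by gcongr
    refine IsSolution.eq_on hC hm h hN hN1 hs (hHfin s (by linarith) (δ * (1 - s')) ?_)
      ((hA s hs (by linarith)).mono le_rfl hr) ((hA s' (by linarith) hs').mono hss' le_rfl) t
      (abs_lt.1 ht)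
    nlinarith
  -- At time `t` the admissible indices are those below `1 - |t|/δ`; half of this bound is an
  -- admissible choice.
  set σ : ℝ → ℝ := fun t => (1 - |t| / δ) / 2 with hσ
  set a : ℝ → Profiles d := fun t => if |t| < δ then A (σ t) t else 0 with ha
  have ha0 : a 0 = 0 := by
    simp only [ha, abs_zero, if_pos hδ]
    have h1 : σ 0 = 1 / 2 := by simp [hσ]
    rw [h1]
    exact (hA (1 / 2) (by norm_num) (by norm_num)).1
  have haA : ∀ s, 0 < s → s < 1 → ∀ t ∈ Set.Ioo (-(δ * (1 - s))) (δ * (1 - s)),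
      a t = A s t := by
    intro s hs hs1 t ht
    have ht' : |t| < δ * (1 - s) := abs_lt.2 ht
    have htδ : |t| < δ := by nlinarith
    have hdiv : |t| / δ < 1 := (div_lt_one hδ).2 htδ
    have hdiv0 : 0 ≤ |t| / δ := by positivity
    have hmul : δ * (|t| / δ) = |t| := by field_simp
    have hσ0 : 0 < σ t := by simp only [hσ]; linarith
    have hσ1 : σ t < 1 := by simp only [hσ]; linarith
    have htσ : |t| < δ * (1 - σ t) := by
      simp only [hσ]
      nlinarith
    simp only [ha, if_pos htδ]
    rcases le_total (σ t) s with hle | hle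
    · exact hcons _ _ _ hσ0 hle hs1 ht'
    · exact (hcons _ _ _ hs hle hσ1 htσ).symm
  have hempty : ∀ t, t ∉ Set.Ioo (-(δ * (1 - 1))) (δ * (1 - 1)) := by simp
  have hsol : ∀ s : ℝ, 0 < s → s ≤ 1 → IsSolution c N H s (δ * (1 - s)) a := by
    intro s hs hs1
    rcases hs1.eq_or_lt with rfl | hlt
    -- For `s = 1` the time interval is empty and only `a(0) = 0` remains.
    · exact ⟨ha0, 0, ⟨fun t ht => absurd ht (hempty t), fun t ht => absurd ht (hempty t)⟩,
        fun t ht => absurd ht (hempty t)⟩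
    · exact (hA s hs hlt).congr ha0 (haA s hs hlt)
  refine ⟨a, hsol, fun s hs hs1 b hb t ht => ?_⟩
  refine IsSolution.eq_on hC hm h hN hN1 hs (hHfin s hs1 (δ * (1 - s)) ?_) hb (hsol s hs hs1) t ht
  nlinarith

end Solutions

/-! ### The determinant on a characteristic plane and the small divisors. -/

section SmallDivisors

/-- Vieta's relations by divided differences, stated for the homogenized cubic so that `X = 0` is
allowed. -/
theorem cubic_eq_of_roots {c₀ c₁ c₂ c₃ x y z : ℝ} (hxy : x ≠ y) (hyz : y ≠ z) (hxz : x ≠ z)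
    (hx : c₀ + c₁ * x + c₂ * x ^ 2 + c₃ * x ^ 3 = 0)
    (hy : c₀ + c₁ * y + c₂ * y ^ 2 + c₃ * y ^ 3 = 0)
    (hz : c₀ + c₁ * z + c₂ * z ^ 2 + c₃ * z ^ 3 = 0) (X w : ℝ) :
    c₀ * X ^ 3 + c₁ * X ^ 2 * w + c₂ * X * w ^ 2 + c₃ * w ^ 3 =
      c₃ * ((w - X * x) * (w - X * y) * (w - X * z)) := by
  have h1 : c₁ + c₂ * (x + y) + c₃ * (x ^ 2 + x * y + y ^ 2) = 0 :=
    mul_left_cancel₀ (sub_ne_zero.2 hxy) (by linear_combination hx - hy)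
  have h2 : c₁ + c₂ * (y + z) + c₃ * (y ^ 2 + y * z + z ^ 2) = 0 :=
    mul_left_cancel₀ (sub_ne_zero.2 hyz) (by linear_combination hy - hz)
  have h3 : c₂ + c₃ * (x + y + z) = 0 :=
    mul_left_cancel₀ (sub_ne_zero.2 hxz) (by linear_combination h1 - h2)
  have e2 : c₂ = -c₃ * (x + y + z) := by linear_combination h3
  subst e2
  have e1 : c₁ = c₃ * (x * y + y * z + x * z) := by linear_combination h1
  subst e1
  have e0 : c₀ = -c₃ * (x * y * z) := by linear_combination hx
  subst e0
  ring

theorem exists_det_smul_add_smul (S B : Matrix (Fin 3) (Fin 3) ℝ) :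
    ∃ c₀ c₁ c₂ : ℝ, ∀ X w : ℝ, (X • S + w • B).det =
      c₀ * X ^ 3 + c₁ * X ^ 2 * w + c₂ * X * w ^ 2 + B.det * w ^ 3 := by
  refine ⟨S.det,
    B 0 0 * (S 1 1 * S 2 2 - S 1 2 * S 2 1) - B 0 1 * (S 1 0 * S 2 2 - S 1 2 * S 2 0) +
    B 0 2 * (S 1 0 * S 2 1 - S 1 1 * S 2 0) + B 1 1 * (S 0 0 * S 2 2 - S 0 2 * S 2 0) -
    B 1 0 * (S 0 1 * S 2 2 - S 0 2 * S 2 1) - B 1 2 * (S 0 0 * S 2 1 - S 0 1 * S 2 0) +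
    B 2 0 * (S 0 1 * S 1 2 - S 0 2 * S 1 1) - B 2 1 * (S 0 0 * S 1 2 - S 0 2 * S 1 0) +
    B 2 2 * (S 0 0 * S 1 1 - S 0 1 * S 1 0),
    S 0 0 * (B 1 1 * B 2 2 - B 1 2 * B 2 1) - S 0 1 * (B 1 0 * B 2 2 - B 1 2 * B 2 0) +
    S 0 2 * (B 1 0 * B 2 1 - B 1 1 * B 2 0) + S 1 1 * (B 0 0 * B 2 2 - B 0 2 * B 2 0) -
    S 1 0 * (B 0 1 * B 2 2 - B 0 2 * B 2 1) - S 1 2 * (B 0 0 * B 2 1 - B 0 1 * B 2 0) +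
    S 2 0 * (B 0 1 * B 1 2 - B 0 2 * B 1 1) - S 2 1 * (B 0 0 * B 1 2 - B 0 2 * B 1 0) +
    S 2 2 * (B 0 0 * B 1 1 - B 0 1 * B 1 0), fun X w => ?_⟩
  simp only [Matrix.det_fin_three, Matrix.add_apply, Matrix.smul_apply, smul_eq_mul]
  ring

variable {d : ℕ}

theorem symbol_eq (A : Fin (d - 1) → Matrix (Fin 3) (Fin 3) ℝ) (Ad : Matrix (Fin 3) (Fin 3) ℝ)
    (τ : ℝ) (η : Tan d) (x y l k : ℝ) :
    symbol A Ad (l • (τ, η, x) + k • (τ, η, y)) =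
      (l + k) • (τ • (1 : Matrix (Fin 3) (Fin 3) ℝ) + ∑ i, η i • A i) + (l * x + k * y) • Ad := by
  simp only [symbol, Prod.smul_mk, Prod.mk_add_mk, smul_eq_mul, PiLp.add_apply, PiLp.smul_apply]
  rw [smul_add, smul_smul, Finset.smul_sum, ← add_mul]
  congr 2
  refine Finset.sum_congr rfl fun i _ => ?_
  rw [smul_smul, ← add_mul]

/-- With `X = l + k` and `w = l ξ₁ + k ξ₃`, the factors `w - X ξ₁`, `w - X ξ₃`, `w - X ξ₂` equal `k
(ξ₃ - ξ₁)`, `-l (ξ₃ - ξ₁)` and `l (ξ₁ - ξ₂) + k (ξ₃ - ξ₂)`. -/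
theorem det_symbol_combination {A : Fin (d - 1) → Matrix (Fin 3) (Fin 3) ℝ}
    {Ad : Matrix (Fin 3) (Fin 3) ℝ} {τ : ℝ} {η : Tan d} {ξ : Fin 3 → ℝ}
    (hξ : Function.Injective ξ) (hchar : ∀ j, (symbol A Ad (τ, η, ξ j)).det = 0) (l k : ℝ) :
    (symbol A Ad (l • (τ, η, ξ 0) + k • (τ, η, ξ 2))).det =
      -(Ad.det * (ξ 2 - ξ 0) ^ 2 * (l * k) * (l * (ξ 0 - ξ 1) + k * (ξ 2 - ξ 1))) := by
  obtain ⟨c₀, c₁, c₂, hdet⟩ := exists_det_smul_add_smul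
    (τ • (1 : Matrix (Fin 3) (Fin 3) ℝ) + ∑ i, η i • A i) Ad
  have hroot : ∀ j, c₀ + c₁ * ξ j + c₂ * ξ j ^ 2 + Ad.det * ξ j ^ 3 = 0 := by
    intro j
    have h1 := hdet 1 (ξ j)
    rw [one_smul] at h1
    have h2 : (τ • (1 : Matrix (Fin 3) (Fin 3) ℝ) + ∑ i, η i • A i) + ξ j • Ad =
      symbol A Ad (τ, η, ξ j) := rfl
    rw [h2, hchar j] at h1
    linarith
  rw [symbol_eq, hdet, cubic_eq_of_roots (hξ.ne (by decide)) (hξ.ne (by decide))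
    (hξ.ne (by decide)) (hroot 0) (hroot 1) (hroot 2)]
  ring

/-- A divisor of modulus at least `1` is harmless. Otherwise `l₁ δ₁` and `l₃ δ₃` nearly cancel and
the two indices are comparable. The exponent `m₀ + 2` is `m₀` from the hypothesis plus `2` from the
product `l₁ l₃`. -/
theorem exists_smallDivisor_bound {δ₁ δ₃ m₀ B : ℝ} (hm₀ : 0 < m₀) (hB : 0 < B) (hδ₁ : δ₁ ≠ 0)
    (hδ₃ : δ₃ ≠ 0) (h : ∀ l₁ l₃ : ℤ, l₁ ≠ 0 → l₃ ≠ 0 →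
      B * Real.sqrt ((l₁ : ℝ) ^ 2 + (l₃ : ℝ) ^ 2) ^ (-m₀) ≤
        |(l₁ : ℝ)| * |(l₃ : ℝ)| * |(l₁ : ℝ) * δ₁ + (l₃ : ℝ) * δ₃|) :
    ∃ C : ℝ, 0 < C ∧ ∀ l₁ l₃ : ℤ, l₁ ≠ 0 → l₃ ≠ 0 → (l₁ : ℝ) * δ₁ + (l₃ : ℝ) * δ₃ ≠ 0 ∧
      1 / |(l₁ : ℝ) * δ₁ + (l₃ : ℝ) * δ₃| ≤
        C * min (|(l₁ : ℝ)| ^ (m₀ + 2)) (|(l₃ : ℝ)| ^ (m₀ + 2)) := by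
  -- `K` is the comparison constant: a divisor smaller than `1` forces each index to be at most `K`
  -- times the other.
  set K : ℝ := 1 + (1 + |δ₁|) / |δ₃| + (1 + |δ₃|) / |δ₁| with hK
  have h1 : 0 < |δ₁| := abs_pos.2 hδ₁
  have h3 : 0 < |δ₃| := abs_pos.2 hδ₃
  have hK1 : 1 ≤ K := by
    have : 0 ≤ (1 + |δ₁|) / |δ₃| + (1 + |δ₃|) / |δ₁| := by positivity
    linarith
  have hKa : (1 + |δ₁|) / |δ₃| ≤ K := by
    have : 0 ≤ (1 + |δ₃|) / |δ₁| := by positivity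
    linarith
  have hKb : (1 + |δ₃|) / |δ₁| ≤ K := by
    have : 0 ≤ (1 + |δ₁|) / |δ₃| := by positivity
    linarith
  refine ⟨1 + B⁻¹ * K ^ 2 * (2 * K) ^ m₀, by positivity, fun l₁ l₃ hl₁ hl₃ => ?_⟩
  have ha₁ : 1 ≤ |(l₁ : ℝ)| := by exact_mod_cast Int.one_le_abs hl₁
  have ha₃ : 1 ≤ |(l₃ : ℝ)| := by exact_mod_cast Int.one_le_abs hl₃
  have hsq : 0 < Real.sqrt ((l₁ : ℝ) ^ 2 + (l₃ : ℝ) ^ 2) := by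
    refine Real.sqrt_pos.2 ?_
    have : (0 : ℝ) < |(l₁ : ℝ)| ^ 2 := by positivity
    rw [sq_abs] at this
    positivity
  have hmain := h l₁ l₃ hl₁ hl₃
  set Λ := (l₁ : ℝ) * δ₁ + (l₃ : ℝ) * δ₃ with hΛ
  have hΛ0 : Λ ≠ 0 := by
    intro h0
    rw [h0, abs_zero, mul_zero] at hmain
    have : 0 < B * Real.sqrt ((l₁ : ℝ) ^ 2 + (l₃ : ℝ) ^ 2) ^ (-m₀) := by positivity
    linarith
  refine ⟨hΛ0, ?_⟩
  have hΛp : 0 < |Λ| := abs_pos.2 hΛ0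
  set x := |(l₁ : ℝ)| with hx
  set y := |(l₃ : ℝ)| with hy
  have hx0 : 0 < x := by linarith
  have hy0 : 0 < y := by linarith
  have hmin1 : 1 ≤ min (x ^ (m₀ + 2)) (y ^ (m₀ + 2)) :=
    le_min (Real.one_le_rpow ha₁ (by linarith)) (Real.one_le_rpow ha₃ (by linarith))
  have hP : 0 ≤ B⁻¹ * K ^ 2 * (2 * K) ^ m₀ := by positivity
  rcases le_or_gt 1 |Λ| with hge | hlt
  · calc 1 / |Λ| ≤ 1 := (div_le_one hΛp).2 hge
      _ ≤ (1 + B⁻¹ * K ^ 2 * (2 * K) ^ m₀) * min (x ^ (m₀ + 2)) (y ^ (m₀ + 2)) := by nlinarith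
  have hyx : y ≤ K * x := by
    have h4 : y * |δ₃| ≤ (1 + |δ₁|) * x := by
      have h5 : (l₃ : ℝ) * δ₃ = Λ - (l₁ : ℝ) * δ₁ := by rw [hΛ]; ring
      have h6 : y * |δ₃| ≤ |Λ| + x * |δ₁| := by
        rw [hy, hx, ← abs_mul, ← abs_mul, h5]
        exact abs_sub _ _
      nlinarith
    rw [← le_div_iff₀ h3] at h4
    refine h4.trans ?_
    rw [mul_div_right_comm]
    gcongr
  have hxy : x ≤ K * y := by
    have h4 : x * |δ₁| ≤ (1 + |δ₃|) * y := by
      have h5 : (l₁ : ℝ) * δ₁ = Λ - (l₃ : ℝ) * δ₃ := by rw [hΛ]; ring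
      have h6 : x * |δ₁| ≤ |Λ| + y * |δ₃| := by
        rw [hy, hx, ← abs_mul, ← abs_mul, h5]
        exact abs_sub _ _
      nlinarith
    rw [← le_div_iff₀ h1] at h4
    refine h4.trans ?_
    rw [mul_div_right_comm]
    gcongr
  have hinv : 1 / |Λ| ≤ B⁻¹ * (x * y) * Real.sqrt ((l₁ : ℝ) ^ 2 + (l₃ : ℝ) ^ 2) ^ m₀ := by
    rw [Real.rpow_neg hsq.le] at hmain
    rw [div_le_iff₀ hΛp]
    have hsm : 0 < Real.sqrt ((l₁ : ℝ) ^ 2 + (l₃ : ℝ) ^ 2) ^ m₀ := by positivity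
    have h7 : B ≤ x * y * |Λ| * Real.sqrt ((l₁ : ℝ) ^ 2 + (l₃ : ℝ) ^ 2) ^ m₀ := by
      rwa [← div_eq_mul_inv, div_le_iff₀ hsm] at hmain
    calc (1 : ℝ) = B⁻¹ * B := (inv_mul_cancel₀ hB.ne').symm
      _ ≤ B⁻¹ * (x * y * |Λ| * Real.sqrt ((l₁ : ℝ) ^ 2 + (l₃ : ℝ) ^ 2) ^ m₀) := by gcongr
      _ = _ := by ring
  have key : ∀ z : ℝ, 1 ≤ z → x ≤ K * z → y ≤ K * z →
      1 / |Λ| ≤ (1 + B⁻¹ * K ^ 2 * (2 * K) ^ m₀) * z ^ (m₀ + 2) := by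
    intro z hz hxz hyz
    have hz0 : 0 < z := by linarith
    have hs : Real.sqrt ((l₁ : ℝ) ^ 2 + (l₃ : ℝ) ^ 2) ≤ 2 * K * z := by
      refine Real.sqrt_le_iff.2 ⟨by positivity, ?_⟩
      rw [← sq_abs (l₁ : ℝ), ← sq_abs (l₃ : ℝ), ← hx, ← hy]
      have h8 : x ^ 2 ≤ (K * z) ^ 2 := by gcongr
      have h9 : y ^ 2 ≤ (K * z) ^ 2 := by gcongr
      nlinarith [sq_nonneg (K * z)]
    have hz2 : z ^ (m₀ + 2) = z ^ m₀ * z ^ 2 := by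
      rw [Real.rpow_add hz0, Real.rpow_two]
    calc 1 / |Λ| ≤ B⁻¹ * (x * y) * Real.sqrt ((l₁ : ℝ) ^ 2 + (l₃ : ℝ) ^ 2) ^ m₀ := hinv
      _ ≤ B⁻¹ * ((K * z) * (K * z)) * (2 * K * z) ^ m₀ := by gcongr
      _ = B⁻¹ * K ^ 2 * (2 * K) ^ m₀ * z ^ (m₀ + 2) := by
        rw [Real.mul_rpow (by positivity) hz0.le, hz2]
        ring
      _ ≤ _ := by
        gcongr
        linarith
  rcases le_total (x ^ (m₀ + 2)) (y ^ (m₀ + 2)) with hle | hle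
  · rw [min_eq_left hle]
    exact key x ha₁ (le_mul_of_one_le_left hx0.le hK1) hyx
  · rw [min_eq_right hle]
    exact key y ha₃ hxy (le_mul_of_one_le_left hy0.le hK1)

end SmallDivisors

end BoundaryModel

end

open BoundaryModel in
theorem proposition3p9 (d : ℕ) (hd : 2 ≤ d) (T : ℝ) (hT : 0 < T)
    -- the matrices `A_1(0), …, A_{d-1}(0)` and `A_d(0)`, the latter invertible
    (A : Fin (d - 1) → Matrix (Fin 3) (Fin 3) ℝ) (Ad : Matrix (Fin 3) (Fin 3) ℝ)
    (hAd : IsUnit Ad.det)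
    -- the boundary frequencies `ζ = (τ_ζ, η_ζ)`, `ζ = φ, ψ`, and the three distinct real numbers
    -- `ξ_1(ζ), ξ_2(ζ), ξ_3(ζ)` such that `ζ_j = (ζ, ξ_j(ζ))` is characteristic
    (τ : Fin 2 → ℝ) (η : Fin 2 → Tan d) (ξ : Fin 2 → Fin 3 → ℝ)
    (hξ : ∀ ζ, Function.Injective (ξ ζ))
    (hchar : ∀ ζ j, (symbol A Ad (τ ζ, η ζ, ξ ζ j)).det = 0)
    -- the small divisors assumption
    (hsd : ∃ C : ℝ, 0 < C ∧ ∃ m₀ : ℝ, 0 < m₀ ∧ ∀ ζ : Fin 2, ∀ l₁ l₃ : ℤ, l₁ ≠ 0 → l₃ ≠ 0 →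
      C * Real.sqrt ((l₁ : ℝ) ^ 2 + (l₃ : ℝ) ^ 2) ^ (-m₀) ≤
        |(symbol A Ad ((l₁ : ℝ) • (τ ζ, η ζ, ξ ζ 0) + (l₃ : ℝ) • (τ ζ, η ζ, ξ ζ 2))).det|)
    -- the coefficients of the model
    (c : Coeffs d)
    (hδ₁ : ∀ ζ, c.δ₁ ζ = (ξ ζ 0 - ξ ζ 1) / (ξ ζ 2 - ξ ζ 0))
    (hδ₃ : ∀ ζ, c.δ₃ ζ = (ξ ζ 2 - ξ ζ 1) / (ξ ζ 2 - ξ ζ 0)) :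
    (∃ m : ℝ, 0 ≤ m ∧ SmallDivisorExponent c m) ∧
    ∀ m : ℝ, 0 ≤ m → SmallDivisorExponent c m →
    ∀ N : ℕ, m + 2 + ((d : ℝ) + 1) / 2 < (N : ℝ) →
    ∀ M₀ : ℝ, 0 < M₀ → ∃ δ : ℝ, 0 < δ ∧ δ < T ∧
      ∀ H : ℝ → Profiles d, ContinuousOnYY N 1 H (Set.Icc (-T) T) →
        (∀ s : ℝ, 0 < s → s < 1 → ∀ t : ℝ, |t| < T →
          normYY N s (H t) ≤ ENNReal.ofReal (M₀ / (1 - s))) →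
        ∃ a : ℝ → Profiles d,
          (∀ s : ℝ, 0 < s → s ≤ 1 → IsSolution c N H s (δ * (1 - s)) a) ∧
          ∀ s : ℝ, 0 < s → s ≤ 1 → ∀ b : ℝ → Profiles d,
            IsSolution c N H s (δ * (1 - s)) b →
            ∀ t ∈ Set.Ioo (-(δ * (1 - s))) (δ * (1 - s)), b t = a t := by
  constructor
  · obtain ⟨C, hC, m₀, hm₀, hsd⟩ := hsd
    have key : ∀ ζ, ∃ K : ℝ, 0 < K ∧ ∀ l₁ l₃ : ℤ, l₁ ≠ 0 → l₃ ≠ 0 →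
        (l₁ : ℝ) * c.δ₁ ζ + (l₃ : ℝ) * c.δ₃ ζ ≠ 0 ∧
        1 / |(l₁ : ℝ) * c.δ₁ ζ + (l₃ : ℝ) * c.δ₃ ζ| ≤
          K * min (|(l₁ : ℝ)| ^ (m₀ + 2)) (|(l₃ : ℝ)| ^ (m₀ + 2)) := by
      intro ζ
      have h20 : ξ ζ 2 - ξ ζ 0 ≠ 0 := sub_ne_zero.2 ((hξ ζ).ne (by decide))
      have h01 : ξ ζ 0 - ξ ζ 1 ≠ 0 := sub_ne_zero.2 ((hξ ζ).ne (by decide))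
      have h21 : ξ ζ 2 - ξ ζ 1 ≠ 0 := sub_ne_zero.2 ((hξ ζ).ne (by decide))
      -- The third power of `ξ₃ - ξ₁` appears when the linear factor of the determinant is expressed
      -- through `δ₁` and `δ₃`.
      set Q := |Ad.det * (ξ ζ 2 - ξ ζ 0) ^ 3| with hQ
      have hQ0 : 0 < Q := abs_pos.2 (mul_ne_zero hAd.ne_zero (pow_ne_zero 3 h20))
      refine exists_smallDivisor_bound hm₀ (div_pos hC hQ0)
        (by rw [hδ₁]; exact div_ne_zero h01 h20) (by rw [hδ₃]; exact div_ne_zero h21 h20)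
        fun l₁ l₃ hl₁ hl₃ => ?_
      have h1 := hsd ζ l₁ l₃ hl₁ hl₃
      have h2 : (symbol A Ad ((l₁ : ℝ) • (τ ζ, η ζ, ξ ζ 0) + (l₃ : ℝ) • (τ ζ, η ζ, ξ ζ 2))).det =
          -((Ad.det * (ξ ζ 2 - ξ ζ 0) ^ 3) *
            ((l₁ : ℝ) * l₃ * ((l₁ : ℝ) * c.δ₁ ζ + (l₃ : ℝ) * c.δ₃ ζ))) := by
        rw [det_symbol_combination (hξ ζ) (hchar ζ), hδ₁, hδ₃]
        field_simp
      rw [h2, abs_neg, abs_mul, ← hQ, abs_mul, abs_mul] at h1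
      rw [div_mul_eq_mul_div, div_le_iff₀ hQ0]
      linarith
    choose K hK hbound using key
    refine ⟨m₀ + 2, by linarith, ∑ ζ, K ζ, Finset.sum_pos (fun ζ _ => hK ζ) Finset.univ_nonempty,
      fun ζ l₁ l₃ hl₁ hl₃ => ⟨(hbound ζ l₁ l₃ hl₁ hl₃).1, (hbound ζ l₁ l₃ hl₁ hl₃).2.trans ?_⟩⟩
    gcongr
    exact Finset.single_le_sum (f := K) (fun ζ _ => (hK ζ).le) (Finset.mem_univ ζ)
  · rintro m hm ⟨C, hC, hbound⟩ N hN M₀ hM₀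
    have hd0 : (0 : ℝ) ≤ d := Nat.cast_nonneg d
    have hw : l2 (freqMeasure d) (freqWeight d (N - (m + 2))) ≠ ∞ :=
      l2_freqWeight_ne_top hd (by linarith)
    have hN1 : 1 ≤ N := by
      have : (1 : ℝ) < N := by linarith
      exact_mod_cast this.le
    obtain ⟨L, hL⟩ : ∃ L : NNReal, lipConst c m C N = L :=
      ⟨(lipConst c m C N).toNNReal, (ENNReal.coe_toNNReal (lipConst_ne_top hw hN1)).symm⟩
    have hL0 : (0 : ℝ) ≤ L := L.2
    -- The three bounds ensure `δ < T`, `4 M₀ δ ≤ 1/2` for the source, and `2δ · 3L ≤ 1/2` for the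
    -- contraction; `L + 1` avoids dividing by zero.
    set δ : ℝ := min (T / 2) (min (1 / (8 * M₀)) (1 / (12 * (L + 1)))) with hδ
    have hδ0 : 0 < δ := lt_min (by positivity) (lt_min (by positivity) (by positivity))
    have hδT : δ ≤ T / 2 := min_le_left _ _
    have hδM : δ ≤ 1 / (8 * M₀) := (min_le_right _ _).trans (min_le_left _ _)
    have hδL : δ ≤ 1 / (12 * (L + 1)) := (min_le_right _ _).trans (min_le_right _ _)
    rw [le_div_iff₀ (by positivity)] at hδM hδL
    refine ⟨δ, hδ0, by linarith, fun H hH hHM => ?_⟩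
    refine exists_unique_solution hC hm hbound hw hN1 hδ0 (by linarith) ?_ (by linarith) hH hHM hM₀
    have h2 : (2⁻¹ : ℝ≥0∞) = ENNReal.ofReal 2⁻¹ := by
      rw [ENNReal.ofReal_inv_of_pos (by norm_num)]; simp
    have h3 : (3 : ℝ≥0∞) = ENNReal.ofReal 3 := by simp
    rw [hL, h2, h3, ← ENNReal.ofReal_coe_nnreal, ← ENNReal.ofReal_mul hL0,
      ← ENNReal.ofReal_mul (by positivity)]
    refine ENNReal.ofReal_le_ofReal ?_
    nlinarith
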